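/- Let $\mathcal C$ and $\mathcal D$ be rigid C*-tensor categories, i.e. semi-simple C*-tensor categories with duals and simple tensor unit. Free product. Words are finite sequences with letters in $\mathrm{Obj}\,\mathcal C\sqcup\mathrm{Obj}\,\mathcal D$. For a word $\sigma$ let $t(\sigma_{\mathcal C})\in\mathcal C$ (resp. $t(\sigma_{\mathcal D})\in\mathcal D$) be the tensor product, in order, of the letters of $\sigma$ from $\mathcal C$ (resp. $\mathcal D$); the empty product is the unit. A $(\sigma,\tau)$-NCP $T$ is a non-crossing partition of the letters of $\sigma$ (on the bottom of a rectangle) and $\tau$ (on its top), each block having letters from $\mathcal C$ only or from $\mathcal D$ only, together with, for each block with bottom letters $\sigma_0$ and top letters $\tau_0$, a morphism $t(\sigma_0)\to t(\tau_0)$ in the corresponding category. Reading the $\mathcal C$-blocks and the $\mathcal D$-blocks by the graphical calculus gives $Z_T=Z_{T_{\mathcal C}}\otimes Z_{T_{\mathcal D}}\in \mathcal C(t(\sigma_{\mathcal C}),t(\tau_{\mathcal C}))\otimes_{\mathbb C}\mathcal D(t(\sigma_{\mathcal D}),t(\tau_{\mathcal D}))$. Put $\mathcal{NCP}(\sigma,\tau)=\mathrm{span}\{Z_T\}$,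 with composition and $*$ taken componentwise and with $\sigma\otimes\tau$ the concatenation $\sigma\tau$. The free product $\mathcal C*\mathcal D$ is the projection category of $\mathcal{NCP}$: its objects are the pairs $(\sigma,p)$ with $p=p^2=p^*\in\mathcal{NCP}(\sigma,\sigma)$, its morphism spaces are $(\mathcal C*\mathcal D)((\sigma,p),(\tau,q))=q\circ\mathcal{NCP}(\sigma,\tau)\circ p$, and $(\sigma,p)\otimes(\tau,q)=(\sigma\tau,p\otimes q)$. A word $w$ is regarded as the object $(w,1_w)$. Annular spaces. Let $\mathrm{Irr}(\mathcal C*\mathcal D)$ be any set of representatives of the isomorphism classes of simple objects of $\mathcal C*\mathcal D$. For objects $b,c$ of $\mathcal C*\mathcal D$ put $$\mathcal A\Lambda_{b,c}=\bigoplus_{a\in\mathrm{Irr}(\mathcal C*\mathcal D)}(\mathcal C*\mathcal D)(a\otimes b,\;c\otimes a).$$ Let $\mathbf I_{\mathcal C}$, $\mathbf I_{\mathcal D}$ be sets of representatives of the isomorphism classes of simple objects of $\mathcal C$, $\mathcal D$ other than the class of the tensor unit, and let $\mathbf W$ be the set of words of strictly positive even length whose letters come alternately from $\mathbf I_{\mathcal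 C}$ and $\mathbf I_{\mathcal D}$, the first letter being from $\mathbf I_{\mathcal C}$. Lemma. For $w_1,w_2\in\mathbf W$, one has $\mathcal A\Lambda_{w_1,w_2}\neq\{0\}$ if and only if there are (possibly empty) words $u,v$ with $w_1=uv$ and $w_2=vu$. -/

import Mathlib

open CategoryTheory MonoidalCategory
open scoped TensorProduct DirectSum ComplexConjugate

universe v u v₁ u₁ v₂ u₂

namespace AnnularFreeProduct

noncomputable section

/-! ## Rigid C*-tensor categories -/

/-- A `*`-structure on a `ℂ`-linear category: an involutive, conjugate linear, contravariant
functor which is the identity on objects. -/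
class StarCategory (C : Type u) [Category.{v} C] [Preadditive C] [Linear ℂ C] where
  /-- The adjoint of a morphism. -/
  dag : ∀ {X Y : C}, (X ⟶ Y) → (Y ⟶ X)
  dag_id : ∀ X : C, dag (𝟙 X) = 𝟙 X
  dag_comp : ∀ {X Y Z : C} (f : X ⟶ Y) (g : Y ⟶ Z), dag (f ≫ g) = dag g ≫ dag f
  dag_dag : ∀ {X Y : C} (f : X ⟶ Y), dag (dag f) = f
  dag_add : ∀ {X Y : C} (f g : X ⟶ Y), dag (f + g) = dag f + dag g
  dag_smul : ∀ {X Y : C} (c : ℂ) (f : X ⟶ Y), dag (c • f) = conj c • dag f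

open StarCategory

section Category

variable (C : Type u) [Category.{v} C] [Preadditive C] [Linear ℂ C] [StarCategory C]

/-- A C*-category: the morphism spaces carry Banach norms with the C*-identity, and `f* f` is a
positive element of the C*-algebra `End X` (that is, of the form `g* g` with `g : X ⟶ X`). -/
def IsCStarCategory : Prop :=
  (∃ N : ∀ X Y : C, Norm (X ⟶ Y),
    (∀ X Y : C, @NormedSpace.Core ℂ (X ⟶ Y) _ _ _ (N X Y)) ∧
    (∀ (X Y : C) (s : ℕ → (X ⟶ Y)),
      (∀ ε : ℝ, 0 < ε → ∃ n₀, ∀ m n, n₀ ≤ m → n₀ ≤ n → (N X Y).norm (s m - s n) < ε) →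
      ∃ l : X ⟶ Y, ∀ ε : ℝ, 0 < ε → ∃ n₀, ∀ n, n₀ ≤ n → (N X Y).norm (s n - l) < ε) ∧
    (∀ (X Y Z : C) (f : X ⟶ Y) (g : Y ⟶ Z),
      (N X Z).norm (f ≫ g) ≤ (N X Y).norm f * (N Y Z).norm g) ∧
    (∀ (X Y : C) (f : X ⟶ Y),
      (N X X).norm (f ≫ dag f) = (N X Y).norm f ^ 2 ∧
      (N Y Y).norm (dag f ≫ f) = (N X Y).norm f ^ 2)) ∧
  ∀ (X Y : C) (f : X ⟶ Y), ∃ g : X ⟶ X, f ≫ dag f = g ≫ dag g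

variable {C}

/-- A simple object: `End X = ℂ 1_X`, and `X` is not a zero object. -/
def IsSimpleObj (X : C) : Prop :=
  𝟙 X ≠ 0 ∧ ∀ f : X ⟶ X, ∃ c : ℂ, f = c • 𝟙 X

/-- `Z` is a unitary (orthogonal) direct sum of the finite family `S`. -/
def IsUnitaryDirectSum {n : ℕ} (S : Fin n → C) (Z : C) : Prop :=
  ∃ i : ∀ k, S k ⟶ Z,
    (∀ k, i k ≫ dag (i k) = 𝟙 (S k)) ∧
    (∀ k l, k ≠ l → i k ≫ dag (i l) = 0) ∧
    ∑ k, dag (i k) ≫ i k = 𝟙 Z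

variable (C) in
/-- Semi-simplicity: unitary direct sums, subobjects for projections, and every object is
isomorphic to a finite direct sum of simple objects. -/
structure IsSemisimpleCategory : Prop where
  directSum : ∀ X Y : C, ∃ Z : C, IsUnitaryDirectSum ![X, Y] Z
  subobject : ∀ (X : C) (p : X ⟶ X), p ≫ p = p → dag p = p →
    ∃ (Y : C) (i : Y ⟶ X), i ≫ dag i = 𝟙 Y ∧ dag i ≫ i = p
  decomposition : ∀ X : C, ∃ (n : ℕ) (S : Fin n → C) (Z : C),
    (∀ k, IsSimpleObj (S k)) ∧ IsUnitaryDirectSum S Z ∧ Nonempty (X ≅ Z)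

end Category

/-- A rigid C*-tensor category: a semi-simple C*-tensor category with duals and simple tensor
unit. -/
class IsRigidCStarTensorCategory (C : Type u) [Category.{v} C] [Preadditive C] [Linear ℂ C]
    [MonoidalCategory C] [MonoidalPreadditive C] [MonoidalLinear ℂ C] [StarCategory C] :
    Prop where
  cstar : IsCStarCategory C
  semisimple : IsSemisimpleCategory C
  dag_tensor : ∀ {X Y X' Y' : C} (f : X ⟶ Y) (g : X' ⟶ Y'), dag (f ⊗ₘ g) = dag f ⊗ₘ dag g
  associator_unitary : ∀ X Y Z : C, dag (α_ X Y Z).hom = (α_ X Y Z).inv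
  leftUnitor_unitary : ∀ X : C, dag (λ_ X).hom = (λ_ X).inv
  rightUnitor_unitary : ∀ X : C, dag (ρ_ X).hom = (ρ_ X).inv
  unit_simple : IsSimpleObj (𝟙_ C)
  duals : ∀ X : C, ∃ (X' : C) (R : 𝟙_ C ⟶ X' ⊗ X) (R' : 𝟙_ C ⟶ X ⊗ X'),
    (λ_ X).inv ≫ (R' ▷ X) ≫ (α_ X X' X).hom ≫ (X ◁ dag R) ≫ (ρ_ X).hom = 𝟙 X ∧
    (ρ_ X').inv ≫ (X' ◁ R') ≫ (α_ X' X X').inv ≫ (dag R ▷ X') ≫ (λ_ X').hom = 𝟙 X'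

/-- `S` is a set of representatives of the isomorphism classes of simple objects other than the
class of the tensor unit. -/
structure IsNonunitSimpleReps {C : Type u} [Category.{v} C] [Preadditive C] [Linear ℂ C]
    [MonoidalCategory C] (S : Set C) : Prop where
  simple : ∀ X ∈ S, IsSimpleObj X
  nonunit : ∀ X ∈ S, IsEmpty (X ≅ 𝟙_ C)
  unique : ∀ X ∈ S, ∀ Y ∈ S, Nonempty (X ≅ Y) → X = Y
  complete : ∀ X : C, IsSimpleObj X → IsEmpty (X ≅ 𝟙_ C) → ∃ Y ∈ S, Nonempty (X ≅ Y)

/-! ## Tensor products of words, and planar diagrams over one category -/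

section OneColour

variable {M : Type u} [Category.{v} M] [MonoidalCategory M]

/-- The tensor product of a list of letters, where the letter `l` stands for the object `ob l`. -/
def tens {L : Type*} (ob : L → M) : List L → M
  | [] => 𝟙_ M
  | a :: x => ob a ⊗ tens ob x

/-- The canonical isomorphism given by the associators and unitors. -/
def tensAppend {L : Type*} (ob : L → M) :
    ∀ x y : List L, tens ob (x ++ y) ≅ tens ob x ⊗ tens ob y
  | [], y => (λ_ (tens ob y)).symm
  | a :: x, y => whiskerLeftIso (ob a) (tensAppend ob x y) ≪≫ (α_ _ _ _).symm

/-- The morphism `1 ⊗ h ⊗ 1` on `x κ y ⟶ x κ' y`. -/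
def layer {L : Type*} (ob : L → M) (x y : List L) {κ κ' : List L}
    (h : tens ob κ ⟶ tens ob κ') :
    tens ob (x ++ (κ ++ y)) ⟶ tens ob (x ++ (κ' ++ y)) :=
  (tensAppend ob x (κ ++ y)).hom ≫
    (tens ob x ◁ ((tensAppend ob κ y).hom ≫ (h ▷ tens ob y) ≫ (tensAppend ob κ' y).inv)) ≫
    (tensAppend ob x (κ' ++ y)).inv

theorem tens_map {L L' : Type*} (ob : L → M) (g : L' → L) (x : List L') :
    tens ob (x.map g) = tens (fun l => ob (g l)) x := by
  induction x with
  | nil => rfl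
  | cons a x ih => simp only [List.map_cons, tens, ih]

/-- The letters of a labelled word which lie in the block with label `b`. -/
def block {L : Type*} (x : List (L × ℕ)) (b : ℕ) : List (L × ℕ) :=
  x.filter (fun p => decide (p.2 = b))

/-- The letters of the labelled words `bot` (on the bottom of a rectangle) and `top` (on its top)
are partitioned into blocks by their labels, and `f b` is the morphism attached to the block `b`.
The predicate says that `g` is obtained by reading, from the bottom upwards, a planar diagram in
which the blocks of the set `S` have been drawn, each of them once, as boxes at different heights;
a box of the block `b` takes as its input strings exactly the bottom letters of `b`, which must be
adjacent to each other at that height, and puts out the top letters of `b`. The labelled word `z`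
is the list of strings at the current height. -/
inductive Drawn (bot top : List (M × ℕ))
    (f : ∀ b : ℕ, tens Prod.fst (block bot b) ⟶ tens Prod.fst (block top b)) :
    Finset ℕ → (z : List (M × ℕ)) → (tens Prod.fst bot ⟶ tens Prod.fst z) → Prop
  | start : Drawn bot top f ∅ bot (𝟙 _)
  | box (S : Finset ℕ) (x y : List (M × ℕ)) (b : ℕ)
      (g : tens Prod.fst bot ⟶ tens Prod.fst (x ++ (block bot b ++ y)))
      (hg : Drawn bot top f S (x ++ (block bot b ++ y)) g)
      (hb : b ∈ (bot ++ top).map Prod.snd) (hS : b ∉ S) :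
      Drawn bot top f (insert b S) (x ++ (block top b ++ y)) (g ≫ layer Prod.fst x y (f b))

/-- `g` is the value, in the graphical calculus of `M`, of the labelled partition with the
morphisms `f b` attached to its blocks. -/
def IsValue (bot top : List (M × ℕ))
    (f : ∀ b : ℕ, tens Prod.fst (block bot b) ⟶ tens Prod.fst (block top b))
    (g : tens Prod.fst bot ⟶ tens Prod.fst top) : Prop :=
  Drawn bot top f ((bot ++ top).map Prod.snd).toFinset top g

end OneColour

/-! ## Non-crossing partitions with two colours

Words have letters in `Obj C ⊔ Obj D`. -/

section Words

variable {C : Type u₁} {D : Type u₂}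

/-- The subword of the letters from `C`. -/
def wordL (σ : List (C ⊕ D)) : List C := σ.filterMap Sum.getLeft?

/-- The subword of the letters from `D`. -/
def wordR (σ : List (C ⊕ D)) : List D := σ.filterMap Sum.getRight?

/-- The labelled subword of the letters from `C`. -/
def labL (x : List ((C ⊕ D) × ℕ)) : List (C × ℕ) :=
  x.filterMap (fun p => p.1.getLeft?.map (fun c => (c, p.2)))

/-- The labelled subword of the letters from `D`. -/
def labR (x : List ((C ⊕ D) × ℕ)) : List (D × ℕ) :=
  x.filterMap (fun p => p.1.getRight?.map (fun d => (d, p.2)))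

theorem map_labL (x : List ((C ⊕ D) × ℕ)) :
    (labL x).map Prod.fst = wordL (x.map Prod.fst) := by
  induction x with
  | nil => rfl
  | cons p x ih =>
    obtain ⟨c | d, n⟩ := p <;> simpa [labL, wordL, List.filterMap_cons] using ih

theorem map_labR (x : List ((C ⊕ D) × ℕ)) :
    (labR x).map Prod.fst = wordR (x.map Prod.fst) := by
  induction x with
  | nil => rfl
  | cons p x ih =>
    obtain ⟨c | d, n⟩ := p <;> simpa [labR, wordR, List.filterMap_cons] using ih

theorem wordL_append (σ τ : List (C ⊕ D)) : wordL (σ ++ τ) = wordL σ ++ wordL τ :=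
  List.filterMap_append

theorem wordR_append (σ τ : List (C ⊕ D)) : wordR (σ ++ τ) = wordR σ ++ wordR τ :=
  List.filterMap_append

end Words

section FreeProduct

/-- The tensor product of the letters of `σ` from `C`. -/
abbrev tL {C : Type u₁} [Category.{v₁} C] [MonoidalCategory C] {D : Type u₂}
    (σ : List (C ⊕ D)) : C :=
  tens (fun c => c) (wordL σ)

/-- The tensor product of the letters of `σ` from `D`. -/
abbrev tR {C : Type u₁} {D : Type u₂} [Category.{v₂} D] [MonoidalCategory D]
    (σ : List (C ⊕ D)) : D :=
  tens (fun d => d) (wordR σ)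

theorem tL_eq {C : Type u₁} [Category.{v₁} C] [MonoidalCategory C] {D : Type u₂}
    {σ : List (C ⊕ D)} {x : List ((C ⊕ D) × ℕ)} (h : x.map Prod.fst = σ) :
    tL σ = tens Prod.fst (labL x) := by
  subst h
  rw [tL, ← map_labL, tens_map]

theorem tR_eq {C : Type u₁} {D : Type u₂} [Category.{v₂} D] [MonoidalCategory D]
    {σ : List (C ⊕ D)} {x : List ((C ⊕ D) × ℕ)} (h : x.map Prod.fst = σ) :
    tR σ = tens Prod.fst (labR x) := by
  subst h
  rw [tR, ← map_labR, tens_map]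

variable {C : Type u₁} [Category.{v₁} C] [MonoidalCategory C]
variable {D : Type u₂} [Category.{v₂} D] [MonoidalCategory D]

/-- A `(σ, τ)`-NCP: a non-crossing partition of the letters of `σ` (bottom) and `τ` (top) into
blocks which do not mix letters from `C` and from `D`, together with a morphism for every block.
The partition is given by labelling each letter with the name of its block. Running along the
boundary of the rectangle (bottom from left to right, then top from right to left) one never meets
two different blocks in the order `a, b, a, b`. -/
structure NCP (σ τ : List (C ⊕ D)) where
  /-- The bottom word with the labels of its letters. -/
  bot : List ((C ⊕ D) × ℕ)
  /-- The top word with the labels of its letters. -/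
  top : List ((C ⊕ D) × ℕ)
  bot_eq : bot.map Prod.fst = σ
  top_eq : top.map Prod.fst = τ
  monochrome : ∀ p ∈ bot ++ top, ∀ q ∈ bot ++ top, p.2 = q.2 → p.1.isLeft = q.1.isLeft
  noncrossing : ∀ a b : ℕ,
    [a, b, a, b].Sublist ((bot ++ top.reverse).map Prod.snd) → a = b
  /-- The morphism attached to a block of letters from `C` (irrelevant for other labels). -/
  morL : ∀ b : ℕ, tens Prod.fst (block (labL bot) b) ⟶ tens Prod.fst (block (labL top) b)
  /-- The morphism attached to a block of letters from `D` (irrelevant for other labels). -/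
  morR : ∀ b : ℕ, tens Prod.fst (block (labR bot) b) ⟶ tens Prod.fst (block (labR top) b)

/-- `f` is the value of the part of the NCP that consists of the blocks from `C`. -/
def NCP.IsValueL {σ τ : List (C ⊕ D)} (T : NCP σ τ) (f : tL σ ⟶ tL τ) : Prop :=
  ∃ g, IsValue (labL T.bot) (labL T.top) T.morL g ∧
    f = eqToHom (tL_eq T.bot_eq) ≫ g ≫ eqToHom (tL_eq T.top_eq).symm

/-- `f` is the value of the part of the NCP that consists of the blocks from `D`. -/
def NCP.IsValueR {σ τ : List (C ⊕ D)} (T : NCP σ τ) (f : tR σ ⟶ tR τ) : Prop :=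
  ∃ g, IsValue (labR T.bot) (labR T.top) T.morR g ∧
    f = eqToHom (tR_eq T.bot_eq) ≫ g ≫ eqToHom (tR_eq T.top_eq).symm

variable [Preadditive C] [Linear ℂ C] [Preadditive D] [Linear ℂ D]

/-- The morphisms `σ ⟶ τ` of the Deligne product of `C` and `D`. -/
abbrev Amb (σ τ : List (C ⊕ D)) : Type (max v₁ v₂) :=
  (tL σ ⟶ tL τ) ⊗[ℂ] (tR σ ⟶ tR τ)

/-- The morphism space `σ ⟶ τ` of the category of non-crossing partitions: the linear span of
the values of all `(σ, τ)`-NCPs. -/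
def ncpHom (σ τ : List (C ⊕ D)) : Submodule ℂ (Amb σ τ) :=
  Submodule.span ℂ {z | ∃ (T : NCP σ τ) (f : tL σ ⟶ tL τ) (g : tR σ ⟶ tR τ),
    T.IsValueL f ∧ T.IsValueR g ∧ z = f ⊗ₜ[ℂ] g}

/-- The identity of the word `σ`. -/
def ambId (σ : List (C ⊕ D)) : Amb σ σ := 𝟙 (tL σ) ⊗ₜ[ℂ] 𝟙 (tR σ)

/-- Composition, in diagrammatic order, of the tensor components. -/
def ambComp (σ τ κ : List (C ⊕ D)) : Amb σ τ →ₗ[ℂ] Amb τ κ →ₗ[ℂ] Amb σ κ :=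
  TensorProduct.map₂ (Linear.comp (tL σ) (tL τ) (tL κ)) (Linear.comp (tR σ) (tR τ) (tR κ))

/-- The adjoint of a morphism as a conjugate linear map. -/
def dagMap {E : Type u} [Category.{v} E] [Preadditive E] [Linear ℂ E] [StarCategory E] (X Y : E) :
    (X ⟶ Y) →ₛₗ[starRingEnd ℂ] (Y ⟶ X) where
  toFun f := StarCategory.dag f
  map_add' := StarCategory.dag_add
  map_smul' := StarCategory.dag_smul

/-- The adjoint, applied to each of the tensor components. -/
def ambDag [StarCategory C] [StarCategory D] (σ τ : List (C ⊕ D)) :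
    Amb σ τ →ₛₗ[starRingEnd ℂ] Amb τ σ :=
  TensorProduct.map (dagMap (tL σ) (tL τ)) (dagMap (tR σ) (tR τ))

/-- The tensor product of morphisms as a bilinear map. -/
def tensorMap {E : Type u} [Category.{v} E] [Preadditive E] [Linear ℂ E] [MonoidalCategory E]
    [MonoidalPreadditive E] [MonoidalLinear ℂ E] {X X' Y Y' U U' : E}
    (i : U ≅ X ⊗ Y) (i' : U' ≅ X' ⊗ Y') :
    (X ⟶ X') →ₗ[ℂ] (Y ⟶ Y') →ₗ[ℂ] (U ⟶ U') :=
  LinearMap.mk₂ ℂ (fun f g => i.hom ≫ (f ⊗ₘ g) ≫ i'.inv)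
    (fun f f' g => by simp [MonoidalPreadditive.add_tensor])
    (fun c f g => by simp [MonoidalCategory.tensorHom_def])
    (fun f g g' => by simp [MonoidalPreadditive.tensor_add])
    (fun c f g => by simp [MonoidalCategory.tensorHom_def])

/-- The canonical isomorphism for the tensor product of the letters of a concatenation. -/
def tLAppend (σ τ : List (C ⊕ D)) : tL (σ ++ τ) ≅ tL σ ⊗ tL τ :=
  eqToIso (congrArg (tens fun c => c) (wordL_append σ τ)) ≪≫ tensAppend _ (wordL σ) (wordL τ)

/-- The canonical isomorphism for the tensor product of the letters of a concatenation. -/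
def tRAppend (σ τ : List (C ⊕ D)) : tR (σ ++ τ) ≅ tR σ ⊗ tR τ :=
  eqToIso (congrArg (tens fun d => d) (wordR_append σ τ)) ≪≫ tensAppend _ (wordR σ) (wordR τ)

/-- The tensor product of morphisms between words (on words it is concatenation). -/
def ambTensor [MonoidalPreadditive C] [MonoidalLinear ℂ C]
    [MonoidalPreadditive D] [MonoidalLinear ℂ D] (σ σ' τ τ' : List (C ⊕ D)) :
    Amb σ σ' →ₗ[ℂ] Amb τ τ' →ₗ[ℂ] Amb (σ ++ τ) (σ' ++ τ') :=
  TensorProduct.map₂ (tensorMap (tLAppend σ τ) (tLAppend σ' τ'))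
    (tensorMap (tRAppend σ τ) (tRAppend σ' τ'))

variable (C D) in
/-- A word `σ` with a candidate `p` for a projection on it; the objects of the free product are
those pairs for which `IsObj` holds. -/
structure WordEnd where
  /-- The word. -/
  word : List (C ⊕ D)
  /-- The endomorphism. -/
  proj : Amb word word

namespace WordEnd

/-- `(σ, p)` is an object of the free product: `p` is a projection in the category of non-crossing
partitions. -/
def IsObj [StarCategory C] [StarCategory D] (X : WordEnd C D) : Prop :=
  X.proj ∈ ncpHom X.word X.word ∧
    ambComp X.word X.word X.word X.proj X.proj = X.proj ∧
    ambDag X.word X.word X.proj = X.proj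

/-- The morphism space `(σ, p) ⟶ (τ, q)` of the free product: `q ∘ NCP(σ, τ) ∘ p`. -/
def hom (X Y : WordEnd C D) : Submodule ℂ (Amb X.word Y.word) :=
  (ncpHom X.word Y.word).map
    (((ambComp X.word Y.word Y.word).flip Y.proj) ∘ₗ (ambComp X.word X.word Y.word X.proj))

/-- A word as an object of the free product. -/
def ofWord (σ : List (C ⊕ D)) : WordEnd C D := ⟨σ, ambId σ⟩

/-- Tensor product of objects of the free product. -/
def tensor [MonoidalPreadditive C] [MonoidalLinear ℂ C]
    [MonoidalPreadditive D] [MonoidalLinear ℂ D] (X Y : WordEnd C D) : WordEnd C D :=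
  ⟨X.word ++ Y.word, ambTensor X.word X.word Y.word Y.word X.proj Y.proj⟩

/-- Isomorphism of objects of the free product (the identity of `(σ, p)` is `p`). -/
def Isomorphic (X Y : WordEnd C D) : Prop :=
  ∃ f ∈ hom X Y, ∃ g ∈ hom Y X,
    ambComp X.word Y.word X.word f g = X.proj ∧ ambComp Y.word X.word Y.word g f = Y.proj

/-- Simple objects of the free product. -/
def IsSimple (X : WordEnd C D) : Prop :=
  X.proj ≠ 0 ∧ ∀ f ∈ hom X X, ∃ c : ℂ, f = c • X.proj

end WordEnd

/-- `Irr` is a set of representatives of the isomorphism classes of simple objects of the free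
product. -/
structure IsSimpleReps [StarCategory C] [StarCategory D] (Irr : Set (WordEnd C D)) : Prop where
  isObj : ∀ X ∈ Irr, X.IsObj
  simple : ∀ X ∈ Irr, X.IsSimple
  unique : ∀ X ∈ Irr, ∀ Y ∈ Irr, X.Isomorphic Y → X = Y
  complete : ∀ X : WordEnd C D, X.IsObj → X.IsSimple → ∃ Y ∈ Irr, X.Isomorphic Y

/-- The annular space from `b` to `c`: the direct sum, over the simple objects `a` in `Irr`, of
the morphism spaces `a ⊗ b ⟶ c ⊗ a` of the free product. -/
abbrev AnnularSpace [MonoidalPreadditive C] [MonoidalLinear ℂ C]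
    [MonoidalPreadditive D] [MonoidalLinear ℂ D] (Irr : Set (WordEnd C D))
    (b c : WordEnd C D) : Type _ :=
  ⨁ a : Irr, WordEnd.hom (a.1.tensor b) (c.tensor a.1)

end FreeProduct

/-- Words of strictly positive even length whose letters come alternately from `IC` and `ID`,
the first one from `IC`. -/
def evenWords {C : Type u₁} {D : Type u₂} (IC : Set C) (ID : Set D) : Set (List (C ⊕ D)) :=
  {w | 0 < w.length ∧ Even w.length ∧
    (∀ l ∈ w, Sum.elim (fun c => c ∈ IC) (fun d => d ∈ ID) l) ∧
    w.IsChain (fun l l' => l.isLeft ≠ l'.isLeft) ∧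
    ∃ c : C, w.head? = some (Sum.inl c)}

end

end AnnularFreeProduct

open AnnularFreeProduct

/-! A morphism space of the free product is spanned by diagrams built from boxes of a single colour,
and the simple objects are modelled by reduced words, whose letters come alternately from `IC` and
`ID`. A nonzero morphism from `a w₁` to `w₂ a`, with `a` simple, makes some reduced word a
constituent of both tensor products. The fusion rules of reduced words then turn this into a word
equation whose solutions are rotations.

In detail, `Planar` is the span of composites of morphisms `1 ⊗ u ⊗ 1` with `u` between words of one
colour. `mem_ncpHom_iff` identifies it with the span of the values of non-crossing partitions, after
which composition and tensor products need no further work with partitions. To see that values are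
planar, look at the blocks that still have letters in the current word. Non-crossing forces one of
them to have adjacent letters, and `Path.front` lets it be drawn first. Blocks without bottom
letters are handled by passing to the adjoint (`Strip.planar`).

Conversely, a planar morphism out of a reduced word has a normal form (`Planar.fan`): every letter
is sent to a nonempty word of its own colour, and further words of one colour are then inserted. A
box cannot join the images of neighbouring letters, whose colours differ, and a nonunit simple
letter has no nonzero morphism to the unit. By semisimplicity the identity of every word is a sum of
planar morphisms through reduced words (`Thru.id`). A planar morphism is therefore a sum of products
`f* g` with `f` and `g` in normal form and with a common reduced source, and such a product is
visibly a combination of non-crossing partitions (`Fan.wdag_comp_mem`).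

The normal form also gives Schur's lemma for reduced words (`Fan.schur`) and the fusion rules
(`Fan.fusion`). If a reduced word `z` maps nontrivially into `x y` with `x` and `y` reduced, then
`z` arises by cancelling dual letters where `x` and `y` meet, and possibly merging one further pair
of letters of equal colour.

For the forward direction, a simple object factors through a reduced word `r`, so there is a nonzero
planar morphism `r w₁ ⟶ w₂ r`, and hence a reduced `z` occurring in both `r w₁` and `w₂ r`. Words in
`evenWords` begin and end with different colours. Comparing colours at the ends rules out most of
the possible shapes (`rotation_of_fuseWith`). What remains is the equation `r w₁ = w₂ r`, the same
equation for dual words, an explicit rotation `w₁ = f z`, `w₂ = z f`, or `w₁ = w₂`.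

For the converse, if `w₁ = u v` and `w₂ = v u`, then `v w₁` and `w₂ v` are the same word `v u v`.
Its nonzero identity, transported to the representative of the simple object `v`, is the required
element (`exists_ne_zero_of_rotation`). -/

namespace AnnularFreeProduct

noncomputable section

open StarCategory

/-! ## Whiskering by words over one category -/

section OneColourWords

variable {M : Type u} [Category.{v} M] [MonoidalCategory M]

/-- The tensor product of a list of objects. -/
abbrev tw (x : List M) : M := tens (fun c => c) x

/-- The canonical isomorphism for a word that is a concatenation. -/
def app {σ x y : List M} (h : σ = x ++ y) : tw σ ≅ tw x ⊗ tw y :=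
  eqToIso (congrArg tw h) ≪≫ tensAppend _ x y

theorem app_nil {y : List M} (h : y = [] ++ y) : app h = (λ_ (tw y)).symm := by
  ext
  simp only [app, eqToIso_refl, Iso.trans_hom, Iso.refl_hom]
  erw [Category.id_comp]
  rfl

theorem app_cons {a : M} {σ x y : List M} (h : a :: σ = (a :: x) ++ y) (h' : σ = x ++ y) :
    (app h).hom = (a ◁ (app h').hom) ≫ (α_ a (tw x) (tw y)).inv := by
  subst h'
  simp only [app, eqToIso_refl, Iso.trans_hom, Iso.refl_hom]
  erw [Category.id_comp, Category.id_comp]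
  rfl

theorem pentagon_step {a X Y Z m N S : M} (p : S ⟶ X ⊗ m) (q : m ⟶ Y ⊗ Z) (r : S ⟶ N ⊗ Z)
    (s : N ⟶ X ⊗ Y) (h : p ≫ X ◁ q = r ≫ s ▷ Z ≫ (α_ _ _ _).hom) :
    (a ◁ p ≫ (α_ _ _ _).inv) ≫ (a ⊗ X) ◁ q =
      (a ◁ r ≫ (α_ _ _ _).inv) ≫ (a ◁ s ≫ (α_ _ _ _).inv) ▷ Z ≫ (α_ _ _ _).hom := by
  have h2 := congrArg (fun t => a ◁ t ≫ (α_ _ _ _).inv) h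
  simp only [MonoidalCategory.whiskerLeft_comp] at h2
  simp only [Category.assoc] at h2 ⊢
  simpa [comp_whiskerRight] using h2

theorem triangle_step {Y Z S : M} (f : S ⟶ Y ⊗ Z) :
    (λ_ S).inv ≫ 𝟙_ M ◁ f = f ≫ (λ_ Y).inv ▷ Z ≫ (α_ _ _ _).hom := by
  simp

/-- Coherence for splitting a word into three parts, by induction on the first part: the pentagon
handles a new letter, and the left unitor handles the empty word. The splittings are equations given
as hypotheses, here and throughout, so that reassociating a concatenation needs no cast. -/
theorem app_assoc {σ x m y z n : List M} (h₁ : σ = x ++ m) (h₂ : m = y ++ z) (h₃ : σ = n ++ z)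
    (h₄ : n = x ++ y) :
    (app h₁).hom ≫ tw x ◁ (app h₂).hom =
      (app h₃).hom ≫ (app h₄).hom ▷ tw z ≫ (α_ _ _ _).hom := by
  subst h₂ h₄
  induction x generalizing σ with
  | nil =>
    subst h₁
    have e : app h₃ = app (rfl : y ++ z = y ++ z) := rfl
    rw [e]
    erw [app_nil (y := y ++ z), app_nil (y := y)]
    exact triangle_step _
  | cons a x ih =>
    subst h₁
    have ih' := ih rfl (List.append_assoc _ _ _).symm
    erw [app_cons (σ := x ++ (y ++ z)) _ rfl, app_cons (σ := x ++ (y ++ z)) h₃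
      (List.append_assoc _ _ _).symm, app_cons (σ := x ++ y) _ rfl]
    exact pentagon_step _ _ _ _ ih'

theorem app_assoc_inv {σ x m y z n : List M} (h₁ : σ = x ++ m) (h₂ : m = y ++ z)
    (h₃ : σ = n ++ z) (h₄ : n = x ++ y) :
    tw x ◁ (app h₂).inv ≫ (app h₁).inv =
      (α_ _ _ _).inv ≫ (app h₄).inv ▷ tw z ≫ (app h₃).inv := by
  have e : (app h₁).hom ≫ tw x ◁ (app h₂).hom ≫ tw x ◁ (app h₂).inv ≫ (app h₁).inv = 𝟙 _ := by
    simp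
  rw [← cancel_epi (tw x ◁ (app h₂).hom), ← cancel_epi (app h₁).hom, e, ← Category.assoc,
    app_assoc h₁ h₂ h₃ h₄]
  simp

variable [Preadditive M] [Linear ℂ M] [MonoidalPreadditive M] [MonoidalLinear ℂ M]

/-- `f ↦ 1_x ⊗ f` on words. -/
def Lw {σ τ x κ κ' : List M} (hσ : σ = x ++ κ) (hτ : τ = x ++ κ') :
    (tw κ ⟶ tw κ') →ₗ[ℂ] (tw σ ⟶ tw τ) where
  toFun f := (app hσ).hom ≫ (tw x ◁ f) ≫ (app hτ).inv
  map_add' := by simp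
  map_smul' := by simp

/-- `f ↦ f ⊗ 1_y` on words. -/
def Rw {σ τ y κ κ' : List M} (hσ : σ = κ ++ y) (hτ : τ = κ' ++ y) :
    (tw κ ⟶ tw κ') →ₗ[ℂ] (tw σ ⟶ tw τ) where
  toFun f := (app hσ).hom ≫ (f ▷ tw y) ≫ (app hτ).inv
  map_add' := by simp
  map_smul' := by simp

theorem Lw_apply {σ τ x κ κ' : List M} (hσ : σ = x ++ κ) (hτ : τ = x ++ κ')
    (f : tw κ ⟶ tw κ') : Lw hσ hτ f = (app hσ).hom ≫ (tw x ◁ f) ≫ (app hτ).inv := rfl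

theorem Rw_apply {σ τ y κ κ' : List M} (hσ : σ = κ ++ y) (hτ : τ = κ' ++ y)
    (f : tw κ ⟶ tw κ') : Rw hσ hτ f = (app hσ).hom ≫ (f ▷ tw y) ≫ (app hτ).inv := rfl

theorem Lw_id {σ x κ : List M} (hσ : σ = x ++ κ) : Lw hσ hσ (𝟙 (tw κ)) = 𝟙 _ := by
  simp [Lw_apply]

theorem Rw_id {σ y κ : List M} (hσ : σ = κ ++ y) : Rw hσ hσ (𝟙 (tw κ)) = 𝟙 _ := by
  simp [Rw_apply]

theorem Lw_comp {σ τ ρ x κ κ' κ'' : List M} (hσ : σ = x ++ κ) (hτ : τ = x ++ κ')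
    (hρ : ρ = x ++ κ'') (f : tw κ ⟶ tw κ') (g : tw κ' ⟶ tw κ'') :
    Lw hσ hρ (f ≫ g) = Lw hσ hτ f ≫ Lw hτ hρ g := by
  simp [Lw_apply]

theorem Rw_comp {σ τ ρ y κ κ' κ'' : List M} (hσ : σ = κ ++ y) (hτ : τ = κ' ++ y)
    (hρ : ρ = κ'' ++ y) (f : tw κ ⟶ tw κ') (g : tw κ' ⟶ tw κ'') :
    Rw hσ hρ (f ≫ g) = Rw hσ hτ f ≫ Rw hτ hρ g := by
  simp [Rw_apply]

theorem leftUnitor_conj {X Y : M} (f : X ⟶ Y) :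
    (λ_ X).symm.hom ≫ 𝟙_ M ◁ f ≫ (λ_ Y).symm.inv = f := by
  simp

theorem rightUnitor_conj {X Y : M} (f : X ⟶ Y) :
    (ρ_ X).symm.hom ≫ f ▷ 𝟙_ M ≫ (ρ_ Y).symm.inv = f := by
  simp

theorem Lw_nil {κ κ' : List M} (h : κ = [] ++ κ) (h' : κ' = [] ++ κ') (f : tw κ ⟶ tw κ') :
    Lw h h' f = f := by
  rw [Lw_apply, app_nil, app_nil]
  exact leftUnitor_conj f

theorem app_append_nil {x : List M} (h : x = x ++ []) : app h = (ρ_ (tw x)).symm := by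
  induction x with
  | nil =>
    rw [app_nil h]
    ext
    exact unitors_inv_equal
  | cons a x ih =>
    ext
    rw [app_cons h (List.append_nil x).symm, ih (List.append_nil x).symm]
    have e : a ◁ (ρ_ (tw x)).inv ≫ (α_ a (tw x) (𝟙_ M)).inv = (ρ_ (a ⊗ tw x)).inv := by simp
    exact e

theorem Rw_nil {κ κ' : List M} (h : κ = κ ++ []) (h' : κ' = κ' ++ []) (f : tw κ ⟶ tw κ') :
    Rw h h' f = f := by
  rw [Rw_apply, app_append_nil, app_append_nil]
  exact rightUnitor_conj f

theorem Lw_Lw {σ τ μ μ' κ κ' x y z : List M} (h₁ : σ = x ++ μ) (h₁' : τ = x ++ μ')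
    (h₂ : μ = y ++ κ) (h₂' : μ' = y ++ κ') (hz : z = x ++ y)
    (h₃ : σ = z ++ κ) (h₃' : τ = z ++ κ') (f : tw κ ⟶ tw κ') :
    Lw h₁ h₁' (Lw h₂ h₂' f) = Lw h₃ h₃' f := by
  have e := app_assoc h₁ h₂ h₃ hz
  have e' := app_assoc_inv h₁' h₂' h₃' hz
  simp only [Lw_apply, MonoidalCategory.whiskerLeft_comp, Category.assoc, e']
  have k : tw z ◁ f = (app hz).hom ▷ _ ≫ ((α_ _ _ _).hom ≫ tw x ◁ tw y ◁ f ≫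
      (α_ _ _ _).inv) ≫ (app hz).inv ▷ _ := by
    have k' : (α_ (tw x) (tw y) _).hom ≫ tw x ◁ tw y ◁ f ≫ (α_ _ _ _).inv =
        (tw x ⊗ tw y) ◁ f := by simp
    rw [k', ← whisker_exchange_assoc, ← comp_whiskerRight]
    simp
  rw [reassoc_of% e, k]
  simp

theorem Rw_Rw {σ τ μ μ' κ κ' x y z : List M} (h₁ : σ = μ ++ y) (h₁' : τ = μ' ++ y)
    (h₂ : μ = κ ++ x) (h₂' : μ' = κ' ++ x) (hz : z = x ++ y)
    (h₃ : σ = κ ++ z) (h₃' : τ = κ' ++ z) (f : tw κ ⟶ tw κ') :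
    Rw h₁ h₁' (Rw h₂ h₂' f) = Rw h₃ h₃' f := by
  have e := app_assoc h₃ hz h₁ h₂
  have e' := app_assoc_inv h₃' hz h₁' h₂'
  have k : f ▷ tw z = tw κ ◁ (app hz).hom ≫ f ▷ _ ≫ tw κ' ◁ (app hz).inv := by
    rw [whisker_exchange_assoc, ← MonoidalCategory.whiskerLeft_comp]
    simp
  simp only [Rw_apply, comp_whiskerRight, Category.assoc, k, e']
  rw [reassoc_of% e]
  simp

theorem Lw_Rw {σ τ μ μ' ν ν' κ κ' x y : List M} (h₁ : σ = x ++ μ) (h₁' : τ = x ++ μ')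
    (h₂ : μ = κ ++ y) (h₂' : μ' = κ' ++ y) (h₃ : σ = ν ++ y) (h₃' : τ = ν' ++ y)
    (h₄ : ν = x ++ κ) (h₄' : ν' = x ++ κ') (f : tw κ ⟶ tw κ') :
    Lw h₁ h₁' (Rw h₂ h₂' f) = Rw h₃ h₃' (Lw h₄ h₄' f) := by
  have e := app_assoc h₁ h₂ h₃ h₄
  have e' := app_assoc_inv h₁' h₂' h₃' h₄'
  simp only [Lw_apply, Rw_apply, MonoidalCategory.whiskerLeft_comp, Category.assoc, e',
    comp_whiskerRight]
  rw [reassoc_of% e]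
  simp

theorem whisker_word_exchange {σ τ ρ ν x x' y y' : List M} (h₁ : σ = x ++ y) (h₂ : τ = x' ++ y)
    (h₃ : ρ = x ++ y') (h₄ : ν = x' ++ y') (f : tw x ⟶ tw x') (g : tw y ⟶ tw y') :
    Rw h₁ h₂ f ≫ Lw h₂ h₄ g = Lw h₁ h₃ g ≫ Rw h₃ h₄ f := by
  simp [Lw_apply, Rw_apply, whisker_exchange_assoc]

/-- `f ↦ 1_x ⊗ f ⊗ 1_y` on words. -/
def lay {σ τ x y κ κ' : List M} (hσ : σ = x ++ (κ ++ y)) (hτ : τ = x ++ (κ' ++ y)) :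
    (tw κ ⟶ tw κ') →ₗ[ℂ] (tw σ ⟶ tw τ) :=
  Lw hσ hτ ∘ₗ Rw rfl rfl

theorem lay_apply {σ τ x y κ κ' : List M} (hσ : σ = x ++ (κ ++ y)) (hτ : τ = x ++ (κ' ++ y))
    (f : tw κ ⟶ tw κ') : lay hσ hτ f = Lw hσ hτ (Rw rfl rfl f) := rfl

theorem lay_id {σ x y κ : List M} (hσ : σ = x ++ (κ ++ y)) : lay hσ hσ (𝟙 (tw κ)) = 𝟙 _ := by
  rw [lay_apply, Rw_id, Lw_id]

theorem lay_comp {σ τ ρ x y κ κ' κ'' : List M} (hσ : σ = x ++ (κ ++ y))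
    (hτ : τ = x ++ (κ' ++ y)) (hρ : ρ = x ++ (κ'' ++ y)) (f : tw κ ⟶ tw κ')
    (g : tw κ' ⟶ tw κ'') : lay hσ hρ (f ≫ g) = lay hσ hτ f ≫ lay hτ hρ g := by
  rw [lay_apply, lay_apply, lay_apply, Rw_comp rfl rfl rfl, Lw_comp hσ hτ hρ]

theorem lay_nil {κ κ' : List M} (h : κ = [] ++ (κ ++ [])) (h' : κ' = [] ++ (κ' ++ []))
    (f : tw κ ⟶ tw κ') : lay h h' f = f := by
  have key : ∀ {μ μ' : List M} (p : μ = κ ++ []) (q : μ' = κ' ++ []) (r : κ = [] ++ μ)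
      (t : κ' = [] ++ μ'), Lw r t (Rw p q f) = f := by
    intro μ μ' p q r t
    obtain rfl : μ = κ := by simpa using p
    obtain rfl : μ' = κ' := by simpa using q
    rw [Lw_nil, Rw_nil]
  exact key rfl rfl h h'

/-- Whiskering twice is whiskering by the concatenated words. The inner left word is moved outwards
past the outer right word by `Lw_Rw`, and the two sides are then combined separately. -/
theorem lay_lay {σ τ x y κ κ' x' y' μ μ' a b : List M} (hσ : σ = x ++ (κ ++ y))
    (hτ : τ = x ++ (κ' ++ y)) (hκ : κ = x' ++ (μ ++ y')) (hκ' : κ' = x' ++ (μ' ++ y'))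
    (ha : a = x ++ x') (hb : b = y' ++ y) (hσ' : σ = a ++ (μ ++ b)) (hτ' : τ = a ++ (μ' ++ b))
    (f : tw μ ⟶ tw μ') : lay hσ hτ (lay hκ hκ' f) = lay hσ' hτ' f := by
  subst ha hb
  rw [lay_apply, lay_apply, lay_apply,
    ← Lw_Rw (σ := κ ++ y) (τ := κ' ++ y) (μ := (μ ++ y') ++ y) (μ' := (μ' ++ y') ++ y)
      (by simp [hκ]) (by simp [hκ']) rfl rfl rfl rfl hκ hκ',
    Rw_Rw rfl rfl rfl rfl rfl (List.append_assoc _ _ _) (List.append_assoc _ _ _)]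
  -- The two bracketings of the middle word are equal but not definitionally so; they become
  -- variables that `subst` can identify.
  have key : ∀ {p p' q q' : List M} (hp : p = μ ++ y' ++ y) (hp' : p' = μ' ++ y' ++ y)
      (_ : q = p) (_ : q' = p') (h1 : κ ++ y = x' ++ p) (h2 : κ' ++ y = x' ++ p')
      (h3 : p = μ ++ (y' ++ y)) (h4 : p' = μ' ++ (y' ++ y)) (h5 : q = μ ++ (y' ++ y))
      (h6 : q' = μ' ++ (y' ++ y)) (h7 : σ = (x ++ x') ++ q) (h8 : τ = (x ++ x') ++ q'),
      Lw hσ hτ (Lw h1 h2 (Rw h3 h4 f)) = Lw h7 h8 (Rw h5 h6 f) := by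
    intro p p' q q' hp hp' hq hq' h1 h2 h3 h4 h5 h6 h7 h8
    subst hq hq'
    exact Lw_Lw hσ hτ h1 h2 rfl h7 h8 _
  exact key rfl rfl (by simp) (by simp) _ _ _ _ _ _ _ _

/-- The interchange law for boxes at disjoint places of a word. The right box is rewritten as a box
in the complement of the left one, and naturality of whiskering applies. Every later reordering of
boxes rests on this. -/
theorem lay_exchange {σ τ ρ ν x κ κ' m μ μ' y x₁ x₂ y₁ y₂ : List M}
    (hx₁ : x₁ = x ++ (κ ++ m)) (hx₂ : x₂ = x ++ (κ' ++ m)) (hy₁ : y₁ = m ++ (μ ++ y))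
    (hy₂ : y₂ = m ++ (μ' ++ y))
    (h₁ : σ = x ++ (κ ++ y₁)) (h₂ : τ = x ++ (κ' ++ y₁)) (h₃ : τ = x₂ ++ (μ ++ y))
    (h₄ : ν = x₂ ++ (μ' ++ y)) (h₅ : σ = x₁ ++ (μ ++ y)) (h₆ : ρ = x₁ ++ (μ' ++ y))
    (h₇ : ρ = x ++ (κ ++ y₂)) (h₈ : ν = x ++ (κ' ++ y₂)) (f : tw κ ⟶ tw κ')
    (g : tw μ ⟶ tw μ') :
    lay h₁ h₂ f ≫ lay h₃ h₄ g = lay h₅ h₆ g ≫ lay h₇ h₈ f := by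
  have e₁ : lay h₃ h₄ g = Lw h₂ h₈ (Lw rfl rfl (lay hy₁ hy₂ g)) := by
    rw [Lw_Lw h₂ h₈ rfl rfl rfl (by simp [h₂]) (by simp [h₈]), lay_apply hy₁,
      Lw_Lw _ _ hy₁ hy₂ (by simp [hx₂]) h₃ h₄, lay_apply]
  have e₂ : lay h₅ h₆ g = Lw h₁ h₇ (Lw rfl rfl (lay hy₁ hy₂ g)) := by
    rw [Lw_Lw h₁ h₇ rfl rfl rfl (by simp [h₁]) (by simp [h₇]), lay_apply hy₁,
      Lw_Lw _ _ hy₁ hy₂ (by simp [hx₁]) h₅ h₆, lay_apply]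
  rw [e₁, e₂, lay_apply h₁, lay_apply h₇, ← Lw_comp h₁ h₂ h₈, ← Lw_comp h₁ h₇ h₈,
    whisker_word_exchange rfl rfl rfl rfl]

theorem tensorMap_app {σ σ' x y x' y' τ : List M} (h : σ = x ++ y) (h' : σ' = x' ++ y')
    (ht : τ = x' ++ y) (f : tw x ⟶ tw x') (g : tw y ⟶ tw y') :
    tensorMap (app h) (app h') f g = Rw h ht f ≫ Lw ht h' g := by
  simp [tensorMap, Lw_apply, Rw_apply, MonoidalCategory.tensorHom_def]

theorem tw_map {L : Type*} (ob : L → M) (x : List L) : tens ob x = tw (x.map ob) :=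
  (tens_map (fun c => c) ob x).symm

theorem whiskerLeft_cast {a X X' Y Z Y' Z' : M} (p : X = X') (q : Y = Y') (r : Z = Z')
    (f : X ⟶ Y ⊗ Z) :
    a ◁ f ≫ (α_ a Y Z).inv = eqToHom (by rw [p]) ≫
      (a ◁ (eqToHom p.symm ≫ f ≫ (eqToHom q ⊗ₘ eqToHom r)) ≫ (α_ a Y' Z').inv) ≫
      (eqToHom (by rw [q]) ⊗ₘ eqToHom (by rw [r])) := by
  subst p q r
  simp

theorem tensAppend_map {L : Type*} (ob : L → M) (x y : List L) :
    (tensAppend ob x y).hom = eqToHom (tw_map ob (x ++ y)) ≫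
      (app (List.map_append (f := ob))).hom ≫
      (eqToHom (tw_map ob x).symm ⊗ₘ eqToHom (tw_map ob y).symm) := by
  induction x with
  | nil =>
    have key : ∀ (X Y : M) (p : X = Y), (λ_ X).inv = eqToHom p ≫ (λ_ Y).inv ≫
        (𝟙 (𝟙_ M) ⊗ₘ eqToHom p.symm) := by
      rintro X _ rfl
      simp
    have e := key _ _ (tw_map ob y)
    have e1 : app (List.map_append (f := ob) (l₁ := []) (l₂ := y)) = (λ_ (tw (y.map ob))).symm :=
      app_nil (y := y.map ob) rfl
    rw [e1]
    exact e
  | cons a x ih =>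
    have e := whiskerLeft_cast (a := ob a) (tw_map ob (x ++ y)) (tw_map ob x) (tw_map ob y)
      (tensAppend ob x y).hom
    have e1 := app_cons (a := ob a) (List.map_append (f := ob) (l₁ := a :: x) (l₂ := y))
      (List.map_append (f := ob))
    refine e.trans ?_
    rw [ih]
    have e2 : eqToHom (tw_map ob (x ++ y)).symm ≫ (eqToHom (tw_map ob (x ++ y)) ≫
      (app (List.map_append (f := ob))).hom ≫
      (eqToHom (tw_map ob x).symm ⊗ₘ eqToHom (tw_map ob y).symm)) ≫
      (eqToHom (tw_map ob x) ⊗ₘ eqToHom (tw_map ob y)) = (app (List.map_append (f := ob))).hom := by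
      simp [tensorHom_comp_tensorHom]
    rw [e2]
    erw [e1]
    rfl

theorem cast_whiskerLeft {S S' X X' Y Y' Z Z' W W' : M} (hS : S = S') (hX : X' = X)
    (hY : Y' = Y) (hX' : X = X') (hZ : Z = Z') (hW : W' = W) (a : S' ⟶ X' ⊗ Y')
    (b : X' ⊗ Z' ⟶ W') (g : Y ⟶ Z) :
    (eqToHom hS ≫ a ≫ (eqToHom hX ⊗ₘ eqToHom hY)) ≫ X ◁ g ≫
      ((eqToHom hX' ⊗ₘ eqToHom hZ) ≫ b ≫ eqToHom hW) =
    eqToHom hS ≫ (a ≫ X' ◁ (eqToHom hY ≫ g ≫ eqToHom hZ) ≫ b) ≫ eqToHom hW := by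
  subst hS hX hY hZ hW
  simp

theorem cast_whiskerRight {S S' X X' Y Y' Z Z' W W' : M} (hS : S = S') (hX : X' = X)
    (hY : Y' = Y) (hX' : X = X') (hZ : Z = Z') (hW : W' = W) (a : S' ⟶ Y' ⊗ X')
    (b : Z' ⊗ X' ⟶ W') (g : Y ⟶ Z) :
    (eqToHom hS ≫ a ≫ (eqToHom hY ⊗ₘ eqToHom hX)) ≫ g ▷ X ≫
      ((eqToHom hZ ⊗ₘ eqToHom hX') ≫ b ≫ eqToHom hW) =
    eqToHom hS ≫ (a ≫ (eqToHom hY ≫ g ≫ eqToHom hZ) ▷ X' ≫ b) ≫ eqToHom hW := by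
  subst hS hX hY hZ hW
  simp

theorem tensAppend_map_inv {L : Type*} (ob : L → M) (x y : List L) :
    (tensAppend ob x y).inv =
      (eqToHom (tw_map ob x) ⊗ₘ eqToHom (tw_map ob y)) ≫
      (app (List.map_append (f := ob))).inv ≫ eqToHom (tw_map ob (x ++ y)).symm := by
  rw [← cancel_epi (tensAppend ob x y).hom, Iso.hom_inv_id, tensAppend_map]
  simp [tensorHom_comp_tensorHom_assoc]

/-- Translates the layers used to evaluate diagrams, which live over labelled letters, into `lay`
over plain words. -/
theorem layer_map {L : Type*} (ob : L → M) (x y : List L) {κ κ' : List L}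
    (f : tens ob κ ⟶ tens ob κ') {σ τ x' y' μ μ' : List M} (hx : x.map ob = x')
    (hy : y.map ob = y') (hμ : κ.map ob = μ) (hμ' : κ'.map ob = μ')
    (hσ : σ = x' ++ (μ ++ y')) (hτ : τ = x' ++ (μ' ++ y'))
    (p : tens ob (x ++ (κ ++ y)) = tw σ) (q : tw τ = tens ob (x ++ (κ' ++ y)))
    (r : tw μ = tens ob κ) (t : tens ob κ' = tw μ') :
    layer ob x y f = eqToHom p ≫ lay hσ hτ (eqToHom r ≫ f ≫ eqToHom t) ≫ eqToHom q := by
  subst hx hy hμ hμ'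
  have hσ' : σ = (x ++ (κ ++ y)).map ob := by simp [hσ]
  have hτ' : τ = (x ++ (κ' ++ y)).map ob := by simp [hτ]
  subst hσ' hτ'
  have e : (tensAppend ob κ y).hom ≫ (f ▷ tens ob y) ≫ (tensAppend ob κ' y).inv =
      eqToHom (tw_map ob _) ≫ Rw List.map_append List.map_append
        (eqToHom r ≫ f ≫ eqToHom t) ≫ eqToHom (tw_map ob _).symm := by
    rw [tensAppend_map, tensAppend_map_inv, cast_whiskerRight, Rw_apply]
  rw [layer, e, tensAppend_map, tensAppend_map_inv, cast_whiskerLeft, lay_apply, Lw_apply]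
  congr 2
  have key : ∀ {ν ν' : List M} (h₁ : ν = κ.map ob ++ y.map ob) (h₂ : ν' = κ'.map ob ++ y.map ob)
      (h₃ : ((x ++ (κ ++ y)).map ob) = x.map ob ++ ν)
      (h₄ : ((x ++ (κ' ++ y)).map ob) = x.map ob ++ ν') (f : tw (κ.map ob) ⟶ tw (κ'.map ob)),
      (app (List.map_append (f := ob))).hom ≫
        tw (x.map ob) ◁ (Rw List.map_append List.map_append f) ≫
        (app (List.map_append (f := ob))).inv =
      (app h₃).hom ≫ tw (x.map ob) ◁ (Rw h₁ h₂ f) ≫ (app h₄).inv := by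
    intro ν ν' h₁ h₂ h₃ h₄ f
    rw [← List.map_append] at h₁ h₂
    subst h₁ h₂
    rfl
  simp only [Category.assoc, eqToHom_trans, eqToHom_refl, Category.comp_id,
    eqToHom_trans_assoc, Category.id_comp]
  exact key _ _ _ _ _

section Star

variable [StarCategory M] [IsRigidCStarTensorCategory M]

theorem dag_whiskerLeft (X : M) {Y Z : M} (f : Y ⟶ Z) : dag (X ◁ f) = X ◁ dag f := by
  rw [← id_tensorHom, IsRigidCStarTensorCategory.dag_tensor, dag_id, id_tensorHom]

theorem dag_whiskerRight {Y Z : M} (f : Y ⟶ Z) (X : M) : dag (f ▷ X) = dag f ▷ X := by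
  rw [← tensorHom_id, IsRigidCStarTensorCategory.dag_tensor, dag_id, tensorHom_id]

theorem dag_associator_inv (X Y Z : M) : dag (α_ X Y Z).inv = (α_ X Y Z).hom := by
  rw [← IsRigidCStarTensorCategory.associator_unitary, dag_dag]

theorem dag_leftUnitor_inv (X : M) : dag (λ_ X).inv = (λ_ X).hom := by
  rw [← IsRigidCStarTensorCategory.leftUnitor_unitary, dag_dag]

theorem dag_tensAppend {L : Type*} (ob : L → M) (x y : List L) :
    dag (tensAppend ob x y).hom = (tensAppend ob x y).inv := by
  induction x with
  | nil => exact dag_leftUnitor_inv _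
  | cons a x ih =>
    have key : ∀ {X Y Z : M} (e : X ≅ Y ⊗ Z) (_ : dag e.hom = e.inv),
        dag (ob a ◁ e.hom ≫ (α_ (ob a) Y Z).inv) = (α_ (ob a) Y Z).hom ≫ ob a ◁ e.inv := by
      intro X Y Z e he
      rw [dag_comp, dag_whiskerLeft, dag_associator_inv, he]
    exact key _ ih

theorem dag_app {σ x y : List M} (h : σ = x ++ y) : dag (app h).hom = (app h).inv := by
  subst h
  simp [app, dag_tensAppend]

theorem dag_Lw {σ τ x κ κ' : List M} (hσ : σ = x ++ κ) (hτ : τ = x ++ κ')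
    (f : tw κ ⟶ tw κ') : dag (Lw hσ hτ f) = Lw hτ hσ (dag f) := by
  rw [Lw_apply, Lw_apply, ← dag_app hτ, ← dag_app hσ]
  simp [dag_comp, dag_whiskerLeft, dag_dag]

theorem dag_Rw {σ τ y κ κ' : List M} (hσ : σ = κ ++ y) (hτ : τ = κ' ++ y)
    (f : tw κ ⟶ tw κ') : dag (Rw hσ hτ f) = Rw hτ hσ (dag f) := by
  rw [Rw_apply, Rw_apply, ← dag_app hτ, ← dag_app hσ]
  simp [dag_comp, dag_whiskerRight, dag_dag]

theorem dag_lay {σ τ x y κ κ' : List M} (hσ : σ = x ++ (κ ++ y)) (hτ : τ = x ++ (κ' ++ y))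
    (f : tw κ ⟶ tw κ') : dag (lay hσ hτ f) = lay hτ hσ (dag f) := by
  rw [lay_apply, lay_apply, dag_Lw, dag_Rw]

end Star

end OneColourWords

/-! ## The category of two-coloured words -/

section WordCategory

variable {C : Type u₁} [Category.{v₁} C] [Preadditive C] [Linear ℂ C] [MonoidalCategory C]
  [MonoidalPreadditive C] [MonoidalLinear ℂ C]
variable {D : Type u₂} [Category.{v₂} D] [Preadditive D] [Linear ℂ D] [MonoidalCategory D]
  [MonoidalPreadditive D] [MonoidalLinear ℂ D]

theorem ambComp_tmul {σ τ κ : List (C ⊕ D)} (f : tL σ ⟶ tL τ) (g : tR σ ⟶ tR τ)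
    (f' : tL τ ⟶ tL κ) (g' : tR τ ⟶ tR κ) :
    ambComp σ τ κ (f ⊗ₜ g) (f' ⊗ₜ g') = (f ≫ f') ⊗ₜ[ℂ] (g ≫ g') := rfl

/-- Words form a category with the morphisms of the Deligne product. -/
instance wordCategory : Category (List (C ⊕ D)) where
  Hom σ τ := Amb σ τ
  id σ := ambId σ
  comp f g := ambComp _ _ _ f g
  id_comp := by
    intro σ τ f
    induction f using TensorProduct.induction_on with
    | zero => exact map_zero _
    | tmul f g => simp [ambId, ambComp_tmul]
    | add f g hf hg => rw [map_add, hf, hg]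
  comp_id := by
    intro σ τ f
    induction f using TensorProduct.induction_on with
    | zero => simp
    | tmul f g => simp [ambId, ambComp_tmul]
    | add f g hf hg => rw [map_add, LinearMap.add_apply, hf, hg]
  assoc := by
    intro σ τ ρ ν f g h
    induction f using TensorProduct.induction_on with
    | zero => simp
    | add f f' hf hf' => simp only [map_add, LinearMap.add_apply, hf, hf']
    | tmul f f' =>
      induction g using TensorProduct.induction_on with
      | zero => simp
      | add f f' hf hf' => simp only [map_add, LinearMap.add_apply, hf, hf']
      | tmul g g' =>
        induction h using TensorProduct.induction_on with
        | zero => simp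
        | add f f' hf hf' => simp only [map_add, hf, hf']
        | tmul h h' => simp [ambComp_tmul]

instance wordPreadditive : Preadditive (List (C ⊕ D)) where
  homGroup σ τ := inferInstanceAs (AddCommGroup (Amb σ τ))
  add_comp σ τ ρ f f' g := LinearMap.map_add₂ (ambComp σ τ ρ) (f : Amb σ τ) (f' : Amb σ τ) g
  comp_add σ τ ρ f g g' := (ambComp σ τ ρ f).map_add g g'

instance wordLinear : Linear ℂ (List (C ⊕ D)) where
  homModule σ τ := inferInstanceAs (Module ℂ (Amb σ τ))
  smul_comp σ τ ρ c f g := LinearMap.map_smul₂ (ambComp σ τ ρ) c (f : Amb σ τ) g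
  comp_smul σ τ ρ f c g := (ambComp σ τ ρ f).map_smul c g

/-- An elementary tensor as a morphism of words. -/
def tmulHom {σ τ : List (C ⊕ D)} (f : tL σ ⟶ tL τ) (g : tR σ ⟶ tR τ) : σ ⟶ τ :=
  (f ⊗ₜ[ℂ] g : Amb σ τ)

theorem tmulHom_comp {σ τ κ : List (C ⊕ D)} (f : tL σ ⟶ tL τ) (g : tR σ ⟶ tR τ)
    (f' : tL τ ⟶ tL κ) (g' : tR τ ⟶ tR κ) :
    tmulHom f g ≫ tmulHom f' g' = tmulHom (f ≫ f') (g ≫ g') := rfl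

theorem tmulHom_id (σ : List (C ⊕ D)) : tmulHom (𝟙 (tL σ)) (𝟙 (tR σ)) = 𝟙 σ := rfl

theorem word_induction {σ τ : List (C ⊕ D)} {P : (σ ⟶ τ) → Prop} (f : σ ⟶ τ)
    (zero : P 0) (tmul : ∀ f g, P (tmulHom f g)) (add : ∀ f g, P f → P g → P (f + g)) : P f :=
  TensorProduct.induction_on (motive := P) f zero tmul add

theorem wordL_lay {σ x κ y : List (C ⊕ D)} (h : σ = x ++ (κ ++ y)) :
    wordL σ = wordL x ++ (wordL κ ++ wordL y) := by
  rw [h, wordL_append, wordL_append]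

theorem wordR_lay {σ x κ y : List (C ⊕ D)} (h : σ = x ++ (κ ++ y)) :
    wordR σ = wordR x ++ (wordR κ ++ wordR y) := by
  rw [h, wordR_append, wordR_append]

/-- `f ↦ 1_x ⊗ f ⊗ 1_y` on two-coloured words. -/
def wlay {σ τ x y κ κ' : List (C ⊕ D)} (hσ : σ = x ++ (κ ++ y)) (hτ : τ = x ++ (κ' ++ y)) :
    (κ ⟶ κ') →ₗ[ℂ] (σ ⟶ τ) :=
  (TensorProduct.map (lay (wordL_lay hσ) (wordL_lay hτ)) (lay (wordR_lay hσ) (wordR_lay hτ)) :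
    Amb κ κ' →ₗ[ℂ] Amb σ τ)

theorem wlay_tmulHom {σ τ x y κ κ' : List (C ⊕ D)} (hσ : σ = x ++ (κ ++ y))
    (hτ : τ = x ++ (κ' ++ y)) (f : tL κ ⟶ tL κ') (g : tR κ ⟶ tR κ') :
    wlay hσ hτ (tmulHom f g) =
      tmulHom (lay (wordL_lay hσ) (wordL_lay hτ) f) (lay (wordR_lay hσ) (wordR_lay hτ) g) := rfl

theorem wlay_id {σ x y κ : List (C ⊕ D)} (hσ : σ = x ++ (κ ++ y)) : wlay hσ hσ (𝟙 κ) = 𝟙 σ := by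
  rw [← tmulHom_id, wlay_tmulHom, lay_id, lay_id, tmulHom_id]

theorem wlay_comp {σ τ ρ x y κ κ' κ'' : List (C ⊕ D)} (hσ : σ = x ++ (κ ++ y))
    (hτ : τ = x ++ (κ' ++ y)) (hρ : ρ = x ++ (κ'' ++ y)) (f : κ ⟶ κ') (g : κ' ⟶ κ'') :
    wlay hσ hρ (f ≫ g) = wlay hσ hτ f ≫ wlay hτ hρ g := by
  induction f using word_induction with
  | zero => simp
  | add f f' hf hf' => simp only [map_add, Preadditive.add_comp, hf, hf']
  | tmul f f' =>
    induction g using word_induction with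
    | zero => simp
    | add f f' hf hf' => simp only [map_add, Preadditive.comp_add, hf, hf']
    | tmul g g' =>
      simp only [wlay_tmulHom, tmulHom_comp]
      rw [lay_comp _ (wordL_lay hτ), lay_comp _ (wordR_lay hτ)]

theorem wlay_nil {κ κ' : List (C ⊕ D)} (h : κ = [] ++ (κ ++ [])) (h' : κ' = [] ++ (κ' ++ []))
    (f : κ ⟶ κ') : wlay h h' f = f := by
  induction f using word_induction with
  | zero => simp
  | add f f' hf hf' => simp only [map_add, hf, hf']
  | tmul f f' =>
    rw [wlay_tmulHom]
    exact congrArg₂ tmulHom (lay_nil _ _ f) (lay_nil _ _ f')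

theorem wlay_wlay {σ τ x y κ κ' x' y' μ μ' a b : List (C ⊕ D)} (hσ : σ = x ++ (κ ++ y))
    (hτ : τ = x ++ (κ' ++ y)) (hκ : κ = x' ++ (μ ++ y')) (hκ' : κ' = x' ++ (μ' ++ y'))
    (ha : a = x ++ x') (hb : b = y' ++ y) (hσ' : σ = a ++ (μ ++ b)) (hτ' : τ = a ++ (μ' ++ b))
    (f : μ ⟶ μ') : wlay hσ hτ (wlay hκ hκ' f) = wlay hσ' hτ' f := by
  induction f using word_induction with
  | zero => simp
  | add f f' hf hf' => simp only [map_add, hf, hf']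
  | tmul f f' =>
    simp only [wlay_tmulHom]
    rw [lay_lay _ _ _ _ (by rw [ha, wordL_append]) (by rw [hb, wordL_append]) (wordL_lay hσ')
      (wordL_lay hτ'), lay_lay _ _ _ _ (by rw [ha, wordR_append]) (by rw [hb, wordR_append])
      (wordR_lay hσ') (wordR_lay hτ')]

theorem wlay_exchange {σ τ ρ ν x κ κ' m μ μ' y x₁ x₂ y₁ y₂ : List (C ⊕ D)}
    (hx₁ : x₁ = x ++ (κ ++ m)) (hx₂ : x₂ = x ++ (κ' ++ m)) (hy₁ : y₁ = m ++ (μ ++ y))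
    (hy₂ : y₂ = m ++ (μ' ++ y))
    (h₁ : σ = x ++ (κ ++ y₁)) (h₂ : τ = x ++ (κ' ++ y₁)) (h₃ : τ = x₂ ++ (μ ++ y))
    (h₄ : ν = x₂ ++ (μ' ++ y)) (h₅ : σ = x₁ ++ (μ ++ y)) (h₆ : ρ = x₁ ++ (μ' ++ y))
    (h₇ : ρ = x ++ (κ ++ y₂)) (h₈ : ν = x ++ (κ' ++ y₂)) (f : κ ⟶ κ') (g : μ ⟶ μ') :
    wlay h₁ h₂ f ≫ wlay h₃ h₄ g = wlay h₅ h₆ g ≫ wlay h₇ h₈ f := by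
  induction f using word_induction with
  | zero => simp
  | add f f' hf hf' => simp only [map_add, Preadditive.add_comp, Preadditive.comp_add, hf, hf']
  | tmul f f' =>
    induction g using word_induction with
    | zero => simp
    | add f f' hf hf' => simp only [map_add, Preadditive.add_comp, Preadditive.comp_add, hf, hf']
    | tmul g g' =>
      simp only [wlay_tmulHom, tmulHom_comp]
      rw [lay_exchange (wordL_lay hx₁) (wordL_lay hx₂) (wordL_lay hy₁) (wordL_lay hy₂) _ _ _ _
        (wordL_lay h₅) (wordL_lay h₆) (wordL_lay h₇) (wordL_lay h₈),
        lay_exchange (wordR_lay hx₁) (wordR_lay hx₂) (wordR_lay hy₁) (wordR_lay hy₂) _ _ _ _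
        (wordR_lay h₅) (wordR_lay h₆) (wordR_lay h₇) (wordR_lay h₈)]

theorem lay_left {M : Type u} [Category.{v} M] [Preadditive M] [Linear ℂ M] [MonoidalCategory M]
    [MonoidalPreadditive M] [MonoidalLinear ℂ M] {σ τ y κ κ' : List M} (h : σ = [] ++ (κ ++ y))
    (h' : τ = [] ++ (κ' ++ y)) (k : σ = κ ++ y) (k' : τ = κ' ++ y) (f : tw κ ⟶ tw κ') :
    lay h h' f = Rw k k' f := by
  subst k k'
  rw [lay_apply, Lw_nil]

theorem lay_right {M : Type u} [Category.{v} M] [Preadditive M] [Linear ℂ M] [MonoidalCategory M]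
    [MonoidalPreadditive M] [MonoidalLinear ℂ M] {σ τ x κ κ' : List M} (h : σ = x ++ (κ ++ []))
    (h' : τ = x ++ (κ' ++ [])) (k : σ = x ++ κ) (k' : τ = x ++ κ') (f : tw κ ⟶ tw κ') :
    lay h h' f = Lw k k' f := by
  have key : ∀ {μ μ' : List M} (p : μ = κ ++ []) (q : μ' = κ' ++ []) (r : σ = x ++ μ)
      (t : τ = x ++ μ'), Lw r t (Rw p q f) = Lw k k' f := by
    intro μ μ' p q r t
    obtain rfl : μ = κ := by simpa using p
    obtain rfl : μ' = κ' := by simpa using q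
    rw [Rw_nil]
  exact key rfl rfl h h'

theorem ambTensor_tmulHom {σ σ' τ τ' : List (C ⊕ D)} (f : tL σ ⟶ tL σ') (f' : tR σ ⟶ tR σ')
    (g : tL τ ⟶ tL τ') (g' : tR τ ⟶ tR τ') :
    (ambTensor σ σ' τ τ' (tmulHom f f') (tmulHom g g') : σ ++ τ ⟶ σ' ++ τ') =
      tmulHom (tensorMap (app (wordL_append σ τ)) (app (wordL_append σ' τ')) f g)
        (tensorMap (app (wordR_append σ τ)) (app (wordR_append σ' τ')) f' g') := rfl

/-- Reduces the tensor product to whiskering followed by composition, so that planarity is preserved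
by it. -/
theorem ambTensor_eq {σ σ' τ τ' : List (C ⊕ D)} (h₁ : σ ++ τ = [] ++ (σ ++ τ))
    (h₂ : σ' ++ τ = [] ++ (σ' ++ τ)) (h₃ : σ' ++ τ = σ' ++ (τ ++ []))
    (h₄ : σ' ++ τ' = σ' ++ (τ' ++ [])) (f : σ ⟶ σ') (g : τ ⟶ τ') :
    (ambTensor σ σ' τ τ' f g : σ ++ τ ⟶ σ' ++ τ') = wlay h₁ h₂ f ≫ wlay h₃ h₄ g := by
  induction f using word_induction with
  | zero =>
    rw [map_zero (wlay h₁ h₂), Limits.zero_comp]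
    exact LinearMap.map_zero₂ (ambTensor σ σ' τ τ') g
  | add f f' hf hf' =>
    rw [map_add (wlay h₁ h₂), Preadditive.add_comp, ← hf, ← hf']
    exact LinearMap.map_add₂ (ambTensor σ σ' τ τ') (f : Amb σ σ') (f' : Amb σ σ') g
  | tmul f f' =>
    induction g using word_induction with
    | zero =>
      rw [map_zero (wlay h₃ h₄), Limits.comp_zero]
      exact map_zero (ambTensor σ σ' τ τ' _)
    | add g g' hf hf' =>
      rw [map_add (wlay h₃ h₄), Preadditive.comp_add, ← hf, ← hf']
      exact map_add (ambTensor σ σ' τ τ' _) (g : Amb τ τ') (g' : Amb τ τ')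
    | tmul g g' =>
      rw [ambTensor_tmulHom, wlay_tmulHom, wlay_tmulHom, tmulHom_comp,
        tensorMap_app _ _ (wordL_append σ' τ), tensorMap_app _ _ (wordR_append σ' τ)]
      exact congrArg₂ tmulHom
        (congrArg₂ _ (lay_left (y := wordL τ) (κ := wordL σ) (κ' := wordL σ') (wordL_lay h₁)
          (wordL_lay h₂) (wordL_append σ τ) (wordL_append σ' τ) f).symm
          (lay_right (x := wordL σ') (κ := wordL τ) (κ' := wordL τ') (wordL_lay h₃)
          (wordL_lay h₄) (wordL_append σ' τ) (wordL_append σ' τ') g).symm)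
        (congrArg₂ _ (lay_left (y := wordR τ) (κ := wordR σ) (κ' := wordR σ') (wordR_lay h₁)
          (wordR_lay h₂) (wordR_append σ τ) (wordR_append σ' τ) f').symm
          (lay_right (x := wordR σ') (κ := wordR τ) (κ' := wordR τ') (wordR_lay h₃)
          (wordR_lay h₄) (wordR_append σ' τ) (wordR_append σ' τ') g').symm)

section Star

variable [StarCategory C] [IsRigidCStarTensorCategory C]
variable [StarCategory D] [IsRigidCStarTensorCategory D]

/-- The adjoint of a morphism of words. -/
def wdag {σ τ : List (C ⊕ D)} (f : σ ⟶ τ) : τ ⟶ σ := ambDag σ τ f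

theorem wdag_tmulHom {σ τ : List (C ⊕ D)} (f : tL σ ⟶ tL τ) (g : tR σ ⟶ tR τ) :
    wdag (tmulHom f g) = tmulHom (dag f) (dag g) := rfl

theorem wdag_add {σ τ : List (C ⊕ D)} (f g : σ ⟶ τ) : wdag (f + g) = wdag f + wdag g :=
  map_add (ambDag σ τ) f g

theorem wdag_zero {σ τ : List (C ⊕ D)} : wdag (0 : σ ⟶ τ) = 0 :=
  map_zero (ambDag σ τ)

theorem wdag_smul {σ τ : List (C ⊕ D)} (c : ℂ) (f : σ ⟶ τ) :
    wdag (c • f) = conj c • wdag f :=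
  map_smulₛₗ (ambDag σ τ) c f

theorem wdag_id (σ : List (C ⊕ D)) : wdag (𝟙 σ) = 𝟙 σ := by
  rw [← tmulHom_id, wdag_tmulHom, dag_id, dag_id]

theorem wdag_wdag {σ τ : List (C ⊕ D)} (f : σ ⟶ τ) : wdag (wdag f) = f := by
  induction f using word_induction with
  | zero => simp [wdag_zero]
  | add f f' hf hf' => simp only [wdag_add, hf, hf']
  | tmul f f' => simp only [wdag_tmulHom, dag_dag]

theorem wdag_comp {σ τ ρ : List (C ⊕ D)} (f : σ ⟶ τ) (g : τ ⟶ ρ) :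
    wdag (f ≫ g) = wdag g ≫ wdag f := by
  induction f using word_induction with
  | zero => simp [wdag_zero]
  | add f f' hf hf' => simp only [wdag_add, Preadditive.add_comp, Preadditive.comp_add, hf, hf']
  | tmul f f' =>
    induction g using word_induction with
    | zero => simp [wdag_zero]
    | add f f' hf hf' => simp only [wdag_add, Preadditive.add_comp, Preadditive.comp_add, hf, hf']
    | tmul g g' => simp only [wdag_tmulHom, tmulHom_comp, dag_comp]

theorem wdag_wlay {σ τ x y κ κ' : List (C ⊕ D)} (hσ : σ = x ++ (κ ++ y))
    (hτ : τ = x ++ (κ' ++ y)) (f : κ ⟶ κ') : wdag (wlay hσ hτ f) = wlay hτ hσ (wdag f) := by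
  induction f using word_induction with
  | zero => simp [wdag_zero]
  | add f f' hf hf' => simp only [map_add, wdag_add, hf, hf']
  | tmul f f' => simp only [wlay_tmulHom, wdag_tmulHom, dag_lay]

end Star

end WordCategory

/-! ## Simple objects of a C*-category -/

section Simple

variable {M : Type u} [Category.{v} M] [Preadditive M] [Linear ℂ M] [MonoidalCategory M]
  [MonoidalPreadditive M] [MonoidalLinear ℂ M] [StarCategory M] [IsRigidCStarTensorCategory M]

theorem dag_zero {X Y : M} : dag (0 : X ⟶ Y) = 0 := by
  have h := dag_smul (0 : ℂ) (0 : X ⟶ Y)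
  simpa using h

/-- This is the C*-identity, the only property of the norms that the argument needs. -/
theorem eq_zero_of_comp_dag {X Y : M} (f : X ⟶ Y) (h : f ≫ dag f = 0) : f = 0 := by
  obtain ⟨⟨N, hN, -, -, h4⟩, -⟩ := IsRigidCStarTensorCategory.cstar (C := M)
  have h1 := (h4 X Y f).1
  rw [h] at h1
  have h0 : (N X X).norm (0 : X ⟶ X) = 0 := by
    have := (hN X X).norm_smul (0 : ℂ) (0 : X ⟶ X)
    simpa using this
  rw [h0] at h1
  exact ((hN X Y).norm_eq_zero_iff f).1 (pow_eq_zero_iff two_ne_zero |>.1 h1.symm)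

/-- Schur's lemma. Both `f ≫ dag f` and `dag f ≫ f` are scalars, equal by associativity and nonzero
by the C*-identity, so a multiple of `dag f` inverts `f`. -/
theorem IsSimpleObj.iso_of_hom {X Y : M} (hX : IsSimpleObj X) (hY : IsSimpleObj Y) (f : X ⟶ Y)
    (hf : f ≠ 0) : Nonempty (X ≅ Y) := by
  obtain ⟨a, ha⟩ := hX.2 (f ≫ dag f)
  obtain ⟨b, hb⟩ := hY.2 (dag f ≫ f)
  have ha0 : a ≠ 0 := fun h => hf (eq_zero_of_comp_dag f (by rw [ha, h, zero_smul]))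
  have hab : a = b := by
    have h1 : (f ≫ dag f) ≫ f = f ≫ dag f ≫ f := Category.assoc _ _ _
    rw [ha, hb] at h1
    simp only [Linear.smul_comp, Category.id_comp, Linear.comp_smul, Category.comp_id] at h1
    exact smul_left_injective ℂ hf h1
  refine ⟨⟨f, a⁻¹ • dag f, ?_, ?_⟩⟩
  · rw [Linear.comp_smul, ha, smul_smul, inv_mul_cancel₀ ha0, one_smul]
  · rw [Linear.smul_comp, hb, ← hab, smul_smul, inv_mul_cancel₀ ha0, one_smul]

theorem IsSimpleObj.of_iso {X Y : M} (hX : IsSimpleObj X) (e : X ≅ Y) : IsSimpleObj Y := by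
  refine ⟨fun h => hX.1 ?_, fun f => ?_⟩
  · calc 𝟙 X = e.hom ≫ 𝟙 Y ≫ e.inv := by simp
      _ = 0 := by simp [h]
  · obtain ⟨c, hc⟩ := hX.2 (e.hom ≫ f ≫ e.inv)
    refine ⟨c, ?_⟩
    calc f = e.inv ≫ (e.hom ≫ f ≫ e.inv) ≫ e.hom := by simp
      _ = c • 𝟙 Y := by rw [hc]; simp

end Simple

/-! ## Planar morphisms of words -/

section Planar

variable {C : Type u₁} [Category.{v₁} C] [Preadditive C] [Linear ℂ C] [MonoidalCategory C]
  [MonoidalPreadditive C] [MonoidalLinear ℂ C] [StarCategory C] [IsRigidCStarTensorCategory C]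
variable {D : Type u₂} [Category.{v₂} D] [Preadditive D] [Linear ℂ D] [MonoidalCategory D]
  [MonoidalPreadditive D] [MonoidalLinear ℂ D] [StarCategory D] [IsRigidCStarTensorCategory D]

/-- All the letters have the same colour. -/
def Mono (x : List (C ⊕ D)) : Prop := ∃ b : Bool, ∀ l ∈ x, l.isLeft = b


/-- The linear span of the composites of morphisms `1 ⊗ u ⊗ 1`, where `u` is a morphism between
words of one colour. -/
inductive Planar : ∀ {σ τ : List (C ⊕ D)}, (σ ⟶ τ) → Prop
  | id (σ : List (C ⊕ D)) : Planar (𝟙 σ)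
  | step {σ ρ τ x y κ κ' : List (C ⊕ D)} (f : σ ⟶ ρ) (hf : Planar f) (hρ : ρ = x ++ (κ ++ y))
      (hτ : τ = x ++ (κ' ++ y)) (hm : Mono (κ ++ κ')) (u : κ ⟶ κ') : Planar (f ≫ wlay hρ hτ u)
  | zero (σ τ : List (C ⊕ D)) : Planar (0 : σ ⟶ τ)
  | add {σ τ : List (C ⊕ D)} (f g : σ ⟶ τ) (hf : Planar f) (hg : Planar g) : Planar (f + g)
  | smul {σ τ : List (C ⊕ D)} (c : ℂ) (f : σ ⟶ τ) (hf : Planar f) : Planar (c • f)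

theorem Planar.wlay {σ τ x y κ κ' : List (C ⊕ D)} (hσ : σ = x ++ (κ ++ y))
    (hτ : τ = x ++ (κ' ++ y)) (hm : Mono (κ ++ κ')) (u : κ ⟶ κ') : Planar (wlay hσ hτ u) := by
  rw [← Category.id_comp (AnnularFreeProduct.wlay hσ hτ u)]
  exact .step _ (.id σ) hσ hτ hm u

theorem Planar.comp {σ ρ τ : List (C ⊕ D)} {f : σ ⟶ ρ} {g : ρ ⟶ τ} (hf : Planar f)
    (hg : Planar g) : Planar (f ≫ g) := by
  induction hg with
  | id => rwa [Category.comp_id]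
  | step g _ hρ hτ hm u ih =>
    rw [← Category.assoc]
    exact .step _ ih hρ hτ hm u
  | zero => rw [Limits.comp_zero]; exact .zero _ _
  | add g g' _ _ ih ih' => rw [Preadditive.comp_add]; exact .add _ _ ih ih'
  | smul c g _ ih => rw [Linear.comp_smul]; exact .smul _ _ ih

/-- Whiskering a composite of layers whiskers each layer, which is again a layer by `wlay_wlay`. -/
theorem Planar.whisker {σ τ κ κ' x y : List (C ⊕ D)} {f : κ ⟶ κ'} (hf : Planar f)
    (hσ : σ = x ++ (κ ++ y)) (hτ : τ = x ++ (κ' ++ y)) :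
    Planar (AnnularFreeProduct.wlay hσ hτ f) := by
  induction hf generalizing σ τ with
  | id =>
    subst hσ hτ
    rw [wlay_id]
    exact .id _
  | @step ρ κ' x' y' μ μ' f _ hρ hτ' hm u ih =>
    rw [wlay_comp hσ (rfl : x ++ (ρ ++ y) = _) hτ, wlay_wlay rfl hτ hρ hτ' rfl rfl
      (by simp [hρ]) (by simp [hτ, hτ'])]
    exact .step _ (ih hσ rfl) _ _ hm u
  | zero => rw [map_zero]; exact .zero _ _
  | add g g' _ _ ih ih' => rw [map_add]; exact .add _ _ (ih hσ hτ) (ih' hσ hτ)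
  | smul c g _ ih => rw [map_smul]; exact .smul _ _ (ih hσ hτ)

theorem Mono.symm {x y : List (C ⊕ D)} (h : Mono (x ++ y)) : Mono (y ++ x) := by
  obtain ⟨b, hb⟩ := h
  exact ⟨b, fun l hl => hb l (by simp only [List.mem_append] at hl ⊢; tauto)⟩

theorem Planar.dag {σ τ : List (C ⊕ D)} {f : σ ⟶ τ} (hf : Planar f) : Planar (wdag f) := by
  induction hf with
  | id => rw [wdag_id]; exact .id _
  | step f _ hρ hτ hm u ih =>
    rw [wdag_comp, wdag_wlay]
    exact (Planar.wlay _ _ hm.symm _).comp ih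
  | zero => rw [wdag_zero]; exact .zero _ _
  | add g g' _ _ ih ih' => rw [wdag_add]; exact .add _ _ ih ih'
  | smul c g _ ih => rw [wdag_smul]; exact .smul _ _ ih

/-! ## Reduced words -/

/-- The letters are from `IC` and `ID`, alternately. -/
def Reduced (IC : Set C) (ID : Set D) (w : List (C ⊕ D)) : Prop :=
  (∀ l ∈ w, Sum.elim (fun c => c ∈ IC) (fun d => d ∈ ID) l) ∧
    w.IsChain (fun l l' => l.isLeft ≠ l'.isLeft)

theorem Reduced.nil {IC : Set C} {ID : Set D} : Reduced IC ID ([] : List (C ⊕ D)) :=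
  ⟨by simp, List.isChain_nil⟩

theorem Reduced.of_append_left {IC : Set C} {ID : Set D} {x y : List (C ⊕ D)}
    (h : Reduced IC ID (x ++ y)) : Reduced IC ID x :=
  ⟨fun l hl => h.1 l (by simp [hl]), (List.isChain_append.1 h.2).1⟩

theorem Reduced.of_append_right {IC : Set C} {ID : Set D} {x y : List (C ⊕ D)}
    (h : Reduced IC ID (x ++ y)) : Reduced IC ID y :=
  ⟨fun l hl => h.1 l (by simp [hl]), (List.isChain_append.1 h.2).2.1⟩

/-- Two letters of the same colour are never adjacent in an alternating word. -/
theorem Reduced.eq_singleton {IC : Set C} {ID : Set D} {x κ y : List (C ⊕ D)}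
    (h : Reduced IC ID (x ++ (κ ++ y))) (hm : Mono κ) (h0 : κ ≠ []) : ∃ l, κ = [l] := by
  obtain ⟨b, hb⟩ := hm
  match κ, h0 with
  | [l], _ => exact ⟨l, rfl⟩
  | l :: l' :: κ, _ =>
    have h1 := (h.of_append_right).of_append_left.2
    rw [List.isChain_cons_cons] at h1
    exact absurd ((hb l (by simp)).trans (hb l' (by simp)).symm) h1.1

section Letters

theorem hom_unit_eq_zero {M : Type u} [Category.{v} M] [Preadditive M] [Linear ℂ M]
    [MonoidalCategory M] [MonoidalPreadditive M] [MonoidalLinear ℂ M] [StarCategory M]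
    [IsRigidCStarTensorCategory M] {I : Set M} (hI : IsNonunitSimpleReps I) {X : M} (hX : X ∈ I)
    (f : 𝟙_ M ⟶ X) : f = 0 := by
  by_contra h
  obtain ⟨e⟩ := IsRigidCStarTensorCategory.unit_simple.iso_of_hom (hI.simple X hX) f h
  exact (hI.nonunit X hX).false e.symm

theorem hom_eq_zero {M : Type u} [Category.{v} M] [Preadditive M] [Linear ℂ M]
    [MonoidalCategory M] [MonoidalPreadditive M] [MonoidalLinear ℂ M] [StarCategory M]
    [IsRigidCStarTensorCategory M] {I : Set M} (hI : IsNonunitSimpleReps I) {X Y : M} (hX : X ∈ I)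
    (hY : Y ∈ I) (hXY : X ≠ Y) (f : X ⟶ Y) : f = 0 := by
  by_contra h
  exact hXY (hI.unique X hX Y hY ((hI.simple X hX).iso_of_hom (hI.simple Y hY) f h))

theorem conj_eq_zero {M : Type u} [Category.{v} M] [Preadditive M] {X Y X' Y' : M} (e : X ≅ X')
    (e' : Y ≅ Y') (h : ∀ f : X ⟶ Y, f = 0) (f : X' ⟶ Y') : f = 0 := by
  have h1 := h (e.hom ≫ f ≫ e'.inv)
  calc f = e.inv ≫ (e.hom ≫ f ≫ e'.inv) ≫ e'.hom := by simp
    _ = 0 := by rw [h1]; simp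

theorem eq_zero_of_left {σ τ : List (C ⊕ D)} (h : ∀ f : tL σ ⟶ tL τ, f = 0) (u : σ ⟶ τ) :
    u = 0 := by
  induction u using word_induction with
  | zero => rfl
  | add f g hf hg => rw [hf, hg, add_zero]
  | tmul f g => rw [h f]; exact TensorProduct.zero_tmul _ _

theorem eq_zero_of_right {σ τ : List (C ⊕ D)} (h : ∀ f : tR σ ⟶ tR τ, f = 0) (u : σ ⟶ τ) :
    u = 0 := by
  induction u using word_induction with
  | zero => rfl
  | add f g hf hg => rw [hf, hg, add_zero]
  | tmul f g => rw [h g]; exact TensorProduct.tmul_zero _ _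

theorem eq_smul_id {σ : List (C ⊕ D)} (h : IsSimpleObj (tL σ)) (h' : IsSimpleObj (tR σ))
    (u : σ ⟶ σ) : ∃ c : ℂ, u = c • 𝟙 σ := by
  induction u using word_induction with
  | zero => exact ⟨0, (zero_smul ℂ _).symm⟩
  | add f g hf hg =>
    obtain ⟨a, rfl⟩ := hf
    obtain ⟨b, rfl⟩ := hg
    exact ⟨a + b, (add_smul _ _ _).symm⟩
  | tmul f g =>
    obtain ⟨a, rfl⟩ := h.2 f
    obtain ⟨b, rfl⟩ := h'.2 g
    refine ⟨a * b, ?_⟩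
    exact TensorProduct.smul_tmul_smul a b (𝟙 (tL σ)) (𝟙 (tR σ))

theorem nil_eq_smul_id (u : ([] : List (C ⊕ D)) ⟶ []) : ∃ c : ℂ, u = c • 𝟙 _ :=
  eq_smul_id IsRigidCStarTensorCategory.unit_simple IsRigidCStarTensorCategory.unit_simple u


theorem letter_eq_smul_id {IC : Set C} (hIC : IsNonunitSimpleReps IC) {ID : Set D}
    (hID : IsNonunitSimpleReps ID) {l : C ⊕ D} (hl : Sum.elim (fun c => c ∈ IC) (fun d => d ∈ ID) l)
    (u : [l] ⟶ [l]) : ∃ c : ℂ, u = c • 𝟙 _ := by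
  match l, hl with
  | .inl c, hl =>
    exact eq_smul_id (σ := [.inl c]) ((hIC.simple c hl).of_iso (ρ_ c).symm)
      IsRigidCStarTensorCategory.unit_simple u
  | .inr d, hl =>
    exact eq_smul_id (σ := [.inr d]) IsRigidCStarTensorCategory.unit_simple
      ((hID.simple d hl).of_iso (ρ_ d).symm) u

theorem nil_letter_eq_zero {IC : Set C} (hIC : IsNonunitSimpleReps IC) {ID : Set D}
    (hID : IsNonunitSimpleReps ID) {l : C ⊕ D} (hl : Sum.elim (fun c => c ∈ IC) (fun d => d ∈ ID) l)
    (u : [] ⟶ [l]) : u = 0 := by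
  match l, hl with
  | .inl c, hl =>
    exact eq_zero_of_left (conj_eq_zero (Iso.refl _) (ρ_ c).symm (hom_unit_eq_zero hIC hl)) u
  | .inr d, hl =>
    exact eq_zero_of_right (conj_eq_zero (Iso.refl _) (ρ_ d).symm (hom_unit_eq_zero hID hl)) u

theorem letter_nil_eq_zero {IC : Set C} (hIC : IsNonunitSimpleReps IC) {ID : Set D}
    (hID : IsNonunitSimpleReps ID) {l : C ⊕ D} (hl : Sum.elim (fun c => c ∈ IC) (fun d => d ∈ ID) l)
    (u : [l] ⟶ []) : u = 0 := by
  rw [← wdag_wdag u, nil_letter_eq_zero hIC hID hl (wdag u), wdag_zero]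

theorem letter_letter_eq_zero {IC : Set C} (hIC : IsNonunitSimpleReps IC) {ID : Set D}
    (hID : IsNonunitSimpleReps ID) {l l' : C ⊕ D}
    (hl : Sum.elim (fun c => c ∈ IC) (fun d => d ∈ ID) l)
    (hl' : Sum.elim (fun c => c ∈ IC) (fun d => d ∈ ID) l') (hm : Mono [l, l']) (hne : l ≠ l')
    (u : [l] ⟶ [l']) : u = 0 := by
  obtain ⟨b, hb⟩ := hm
  match l, l', hl, hl', hb, hne with
  | .inl c, .inl c', hl, hl', _, hne =>
    exact eq_zero_of_left (conj_eq_zero (ρ_ c).symm (ρ_ c').symm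
      (hom_eq_zero hIC hl hl' (fun h => hne (by rw [h])))) u
  | .inr c, .inr c', hl, hl', _, hne =>
    exact eq_zero_of_right (conj_eq_zero (ρ_ c).symm (ρ_ c').symm
      (hom_eq_zero hID hl hl' (fun h => hne (by rw [h])))) u
  | .inl c, .inr c', _, _, hb, _ => simp at hb
  | .inr c, .inl c', _, _, hb, _ => simp at hb

end Letters

end Planar

/-! ## Planar morphisms out of reduced words -/

section Fan

variable {C : Type u₁} [Category.{v₁} C] [Preadditive C] [Linear ℂ C] [MonoidalCategory C]
  [MonoidalPreadditive C] [MonoidalLinear ℂ C] [StarCategory C] [IsRigidCStarTensorCategory C]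
variable {D : Type u₂} [Category.{v₂} D] [Preadditive D] [Linear ℂ D] [MonoidalCategory D]
  [MonoidalPreadditive D] [MonoidalLinear ℂ D] [StarCategory D] [IsRigidCStarTensorCategory D]

theorem wlay_comp_wlay {σ ρ τ x y κ μ κ' x₁ y₁ x₂ y₂ a a' b b' X₁ Y₁ X₂ Y₂ : List (C ⊕ D)}
    (hσ : σ = x ++ (κ ++ y)) (hρ : ρ = x ++ (μ ++ y)) (hτ : τ = x ++ (κ' ++ y))
    (i₁ : κ = x₁ ++ (a ++ y₁)) (i₁' : μ = x₁ ++ (a' ++ y₁)) (i₂ : μ = x₂ ++ (b ++ y₂))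
    (i₂' : κ' = x₂ ++ (b' ++ y₂)) (hX₁ : X₁ = x ++ x₁) (hY₁ : Y₁ = y₁ ++ y)
    (hX₂ : X₂ = x ++ x₂) (hY₂ : Y₂ = y₂ ++ y)
    (g₁ : σ = X₁ ++ (a ++ Y₁)) (g₁' : ρ = X₁ ++ (a' ++ Y₁)) (g₂ : ρ = X₂ ++ (b ++ Y₂))
    (g₂' : τ = X₂ ++ (b' ++ Y₂)) (u : a ⟶ a') (v : b ⟶ b') :
    wlay g₁ g₁' u ≫ wlay g₂ g₂' v = wlay hσ hτ (wlay i₁ i₁' u ≫ wlay i₂ i₂' v) := by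
  rw [wlay_comp hσ hρ hτ, wlay_wlay hσ hρ i₁ i₁' hX₁ hY₁ g₁ g₁',
    wlay_wlay hρ hτ i₂ i₂' hX₂ hY₂ g₂ g₂']

/-- The tensor product of two morphisms of words. -/
def wten {ρ ρ' σ σ' τ τ' : List (C ⊕ D)} (h : ρ = σ ++ τ) (h' : ρ' = σ' ++ τ') (u : σ ⟶ σ')
    (f : τ ⟶ τ') : ρ ⟶ ρ' :=
  wlay (x := []) (y := τ) h (rfl : σ' ++ τ = [] ++ (σ' ++ τ)) u ≫
    wlay (x := σ') (y := []) (by simp) (by simp [h']) f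

/-- A box drawn after a tensor product, and touching only the second factor, is absorbed into that
factor. -/
theorem wten_comp_right {ρ ρ' ρ'' σ σ' τ m y κ κ' x : List (C ⊕ D)} (h : ρ = σ ++ τ)
    {τ' τ'' : List (C ⊕ D)} (h' : ρ' = σ' ++ τ') (h'' : ρ'' = σ' ++ τ'') (u : σ ⟶ σ')
    (f : τ ⟶ τ') (hx : x = σ' ++ m)
    (g : τ' = m ++ (κ ++ y)) (g' : τ'' = m ++ (κ' ++ y)) (k : ρ' = x ++ (κ ++ y))
    (k' : ρ'' = x ++ (κ' ++ y)) (v : κ ⟶ κ') :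
    wten h h' u f ≫ wlay k k' v = wten h h'' u (f ≫ wlay g g' v) := by
  have e : ρ' = σ' ++ (τ' ++ []) := by simp [h']
  rw [wten, wten, Category.assoc, wlay_comp (x := σ') (y := []) _ e _,
    wlay_wlay (x := σ') (y := []) _ _ g g' hx (by simp) k k']

/-- The counterpart for the first factor. The box must first be exchanged with the morphism on the
second factor, which `wten` applies last. -/
theorem wten_comp_left {ρ ρ' ρ'' σ σ' σ'' τ τ' p y κ κ' x : List (C ⊕ D)} (h : ρ = σ ++ τ)
    (h' : ρ' = σ' ++ τ') (h'' : ρ'' = σ'' ++ τ') (u : σ ⟶ σ') (f : τ ⟶ τ') (hy : y = p ++ τ')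
    (g : σ' = x ++ (κ ++ p)) (g' : σ'' = x ++ (κ' ++ p)) (k : ρ' = x ++ (κ ++ y))
    (k' : ρ'' = x ++ (κ' ++ y)) (v : κ ⟶ κ') :
    wten h h' u f ≫ wlay k k' v = wten h h'' (u ≫ wlay g g' v) f := by
  have e₁ : wlay k k' v = wlay (x := []) (y := τ') h' h'' (wlay g g' v) :=
    (wlay_wlay (x := []) (y := τ') h' h'' g g' rfl hy k k' v).symm
  have e₂ := wlay_exchange (x := []) (m := []) (y := []) (x₁ := σ') (x₂ := σ'') (y₁ := τ)
    (y₂ := τ') (σ := σ' ++ τ) (τ := σ'' ++ τ) (ρ := ρ') (ν := ρ'') (by simp) (by simp) (by simp)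
    (by simp) rfl rfl (by simp) (by simp [h'']) (by simp) (by simp [h']) h' h'' (wlay g g' v) f
  rw [wten, wten, Category.assoc, e₁, ← e₂, wlay_comp (x := []) (y := τ) h
    (rfl : σ' ++ τ = [] ++ (σ' ++ τ)) rfl, Category.assoc]

theorem wten_add_right {ρ ρ' σ σ' τ τ' : List (C ⊕ D)} (h : ρ = σ ++ τ) (h' : ρ' = σ' ++ τ')
    (u : σ ⟶ σ') (f g : τ ⟶ τ') : wten h h' u (f + g) = wten h h' u f + wten h h' u g := by
  rw [wten, map_add, Preadditive.comp_add]; rfl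

theorem wten_zero_right {ρ ρ' σ σ' τ τ' : List (C ⊕ D)} (h : ρ = σ ++ τ) (h' : ρ' = σ' ++ τ')
    (u : σ ⟶ σ') : wten h h' u (0 : τ ⟶ τ') = 0 := by
  rw [wten, map_zero, Limits.comp_zero]

theorem wten_zero_left {ρ ρ' σ σ' τ τ' : List (C ⊕ D)} (h : ρ = σ ++ τ) (h' : ρ' = σ' ++ τ')
    (f : τ ⟶ τ') : wten h h' (0 : σ ⟶ σ') f = 0 := by
  rw [wten, map_zero, Limits.zero_comp]

theorem wten_smul_right {ρ ρ' σ σ' τ τ' : List (C ⊕ D)} (h : ρ = σ ++ τ) (h' : ρ' = σ' ++ τ')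
    (u : σ ⟶ σ') (c : ℂ) (f : τ ⟶ τ') : wten h h' u (c • f) = c • wten h h' u f := by
  rw [wten, map_smul, Linear.comp_smul]; rfl

/-- The tensor products of morphisms from the letters of a word to nonempty words of the same
colour. -/
inductive Base : ∀ {w τ : List (C ⊕ D)}, (w ⟶ τ) → Prop
  | nil : Base (𝟙 ([] : List (C ⊕ D)))
  | cons {w τ w' τ' κ : List (C ⊕ D)} {l : C ⊕ D} (u : [l] ⟶ κ) (f : w ⟶ τ) (hf : Base f)
      (hm : Mono (l :: κ)) (hκ : κ ≠ []) (hw : w' = [l] ++ w) (hτ : τ' = κ ++ τ) :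
      Base (wten hw hτ u f)

/-- The linear span of the morphisms that arise from `Base` by the insertion of words of one
colour. -/
inductive Fan : ∀ {w τ : List (C ⊕ D)}, (w ⟶ τ) → Prop
  | base {w τ : List (C ⊕ D)} (f : w ⟶ τ) (hf : Base f) : Fan f
  | ins {w ρ τ x y κ : List (C ⊕ D)} (f : w ⟶ ρ) (hf : Fan f) (hρ : ρ = x ++ ([] ++ y))
      (hτ : τ = x ++ (κ ++ y)) (hm : Mono κ) (hκ : κ ≠ []) (u : [] ⟶ κ) : Fan (f ≫ wlay hρ hτ u)
  | zero (σ τ : List (C ⊕ D)) : Fan (0 : σ ⟶ τ)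
  | add {σ τ : List (C ⊕ D)} (f g : σ ⟶ τ) (hf : Fan f) (hg : Fan g) : Fan (f + g)
  | smul {σ τ : List (C ⊕ D)} (c : ℂ) (f : σ ⟶ τ) (hf : Fan f) : Fan (c • f)

theorem Base.id (w : List (C ⊕ D)) : Base (𝟙 w) := by
  induction w with
  | nil => exact .nil
  | cons l w ih =>
    have h := Base.cons (𝟙 [l]) (𝟙 w) ih ⟨l.isLeft, by simp⟩ (by simp) (rfl : l :: w = [l] ++ w)
      (rfl : l :: w = [l] ++ w)
    rw [wten, wlay_id] at h
    have e : wlay (x := [l]) (y := []) (σ := [l] ++ w) (τ := l :: w) (by simp) (by simp) (𝟙 w) =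
        𝟙 _ := wlay_id (by simp)
    rw [e] at h
    convert h
    exact (Category.id_comp _).symm

theorem Base.head {w τ : List (C ⊕ D)} {f : w ⟶ τ} (hf : Base f) {a : C ⊕ D}
    {τ' : List (C ⊕ D)} (h : τ = a :: τ') :
    ∃ l w', w = l :: w' ∧ l.isLeft = a.isLeft := by
  cases hf with
  | nil => simp at h
  | @cons w τ _ _ κ l u f hf hm hκ hw hτ =>
    refine ⟨l, w, hw, ?_⟩
    obtain ⟨b, hb⟩ := hm
    match κ, hκ with
    | a' :: κ, _ =>
      rw [hτ, List.cons_append, List.cons.injEq] at h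
      rw [hb l (by simp), ← h.1, hb a' (by simp)]

/-- Insertions made in the second factor can be performed after the tensor product, so a new first
letter joins the underlying `Base` morphism. -/
theorem Fan.cons {w τ w' τ' κ : List (C ⊕ D)} {l : C ⊕ D} (u : [l] ⟶ κ) {f : w ⟶ τ}
    (hf : Fan f) (hm : Mono (l :: κ)) (hκ : κ ≠ []) (hw : w' = [l] ++ w) (hτ : τ' = κ ++ τ) :
    Fan (wten hw hτ u f) := by
  induction hf generalizing w' τ' with
  | base f hf => exact .base _ (.cons u f hf hm hκ hw hτ)
  | @ins ρ τ x y κ₀ f _ hρ hτ' hm' hκ' v ih =>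
    rw [← wten_comp_right hw (rfl : κ ++ ρ = κ ++ ρ) hτ u f rfl hρ hτ' (by simp [hρ])
      (by simp [hτ, hτ']) v]
    exact .ins _ (ih hw rfl) _ _ hm' hκ' v
  | zero => rw [wten_zero_right]; exact .zero _ _
  | add g g' _ _ ih ih' => rw [wten_add_right]; exact .add _ _ (ih hw hτ) (ih' hw hτ)
  | smul c g _ ih => rw [wten_smul_right]; exact .smul _ _ (ih hw hτ)

theorem Mono.subset {x y : List (C ⊕ D)} (h : Mono x) (hy : ∀ l ∈ y, l ∈ x) : Mono y := by
  obtain ⟨b, hb⟩ := h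
  exact ⟨b, fun l hl => hb l (hy l hl)⟩

theorem Mono.glue {x n y : List (C ⊕ D)} (h : Mono (x ++ n)) (h' : Mono (n ++ y)) (hn : n ≠ []) :
    Mono (x ++ (n ++ y)) := by
  obtain ⟨b, hb⟩ := h
  obtain ⟨b', hb'⟩ := h'
  obtain ⟨a, n, rfl⟩ := List.exists_cons_of_ne_nil hn
  have e : b = b' := (hb a (by simp)).symm.trans (hb' a (by simp))
  subst e
  refine ⟨b, fun l hl => ?_⟩
  simp only [List.mem_append] at hl
  rcases hl with hl | hl | hl
  · exact hb l (by simp [hl])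
  · exact hb l (List.mem_append.2 (Or.inr hl))
  · exact hb' l (by simp [hl])

section

variable {IC : Set C} {ID : Set D}

/-- The input of the box lies in the image of one letter and is absorbed there, or it lies further
right and the induction applies. It cannot straddle the images of two letters: the box has one
colour, while neighbouring letters of a reduced word differ in colour. -/
theorem Base.comp_wlay (hIC : IsNonunitSimpleReps IC) (hID : IsNonunitSimpleReps ID)
    {w ρ τ x y κ κ' : List (C ⊕ D)} {f : w ⟶ ρ} (hf : Base f)
    (hw : Reduced IC ID w) (hκ : κ ≠ []) (hρ : ρ = x ++ (κ ++ y)) (hτ : τ = x ++ (κ' ++ y))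
    (hm : Mono (κ ++ κ')) (u : κ ⟶ κ') : Fan (f ≫ wlay hρ hτ u) := by
  induction hf generalizing τ x with
  | nil => simp at hρ; exact absurd hρ.2.1 hκ
  | @cons w ρ' w' _ κ₁ l v f hf hm₁ hκ₁ hw' hρ' ih =>
    have hwr : Reduced IC ID w := by
      rw [hw'] at hw
      exact hw.of_append_right
    have right : ∀ m, x = κ₁ ++ m → ρ' = m ++ (κ ++ y) →
        Fan (wten hw' hρ' v f ≫ AnnularFreeProduct.wlay hρ hτ u) := by
      intro m hx hρ''
      rw [wten_comp_right hw' hρ' (by simp [hτ, hx]) v f hx hρ'' rfl hρ hτ u]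
      exact .cons _ (ih hwr hρ'' rfl) hm₁ hκ₁ _ _
    have left : ∀ p, y = p ++ ρ' → κ₁ = x ++ (κ ++ p) →
        Fan (wten hw' hρ' v f ≫ AnnularFreeProduct.wlay hρ hτ u) := by
      intro p h3 hn
      rw [wten_comp_left hw' hρ' (by simp [hτ, h3]) v f h3 hn rfl hρ hτ u]
      -- If the box erases the whole image of `l`, the composite is a morphism from a nonunit simple
      -- object to the unit, hence zero. Otherwise the nonempty image required by `Base` survives.
      by_cases h0 : x ++ (κ' ++ p) = []
      · have key : ∀ (t : List (C ⊕ D)) (_ : t = []) (g : [l] ⟶ t), g = 0 := by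
          rintro t rfl g
          exact letter_nil_eq_zero hIC hID (hw.1 l (by simp [hw'])) g
        rw [key _ h0 (v ≫ _), wten_zero_left]
        exact .zero _ _
      · refine .base _ (.cons _ f hf ?_ h0 _ _)
        obtain ⟨b, hb⟩ := hm₁
        obtain ⟨c, hc⟩ := hm
        obtain ⟨a, κ, rfl⟩ := List.exists_cons_of_ne_nil hκ
        have e : b = c := (hb a (by simp [hn])).symm.trans (hc a (by simp))
        subst e
        refine ⟨b, fun k hk => ?_⟩
        simp only [List.mem_cons, List.mem_append] at hk
        rcases hk with rfl | hk | hk | hk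
        · exact hb _ (by simp)
        · exact hb _ (by simp [hn, hk])
        · exact hc _ (by simp [hk])
        · exact hb _ (by simp [hn, hk])
    have h := hρ'.symm.trans hρ
    rcases List.append_eq_append_iff.1 h with ⟨m, hx, hρ''⟩ | ⟨n, hn, h2⟩
    · exact right m hx hρ''
    · rcases List.append_eq_append_iff.1 h2 with ⟨p, hp, h3⟩ | ⟨p, hp, h3⟩
      · exact left p h3 (by rw [hn, hp])
      · by_cases hn0 : n = []
        · exact right [] (by simp [hn, hn0]) (by simp [h3, hp, hn0])
        by_cases hp0 : p = []
        · subst hp0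
          have hp' : n = κ := by simpa using hp.symm
          have h3' : ρ' = y := by simpa using h3
          subst hp' h3'
          exact left [] (by simp) (by simp [hn])
        -- The box uses the last part of the image of `l` and the beginning of the image of the next
        -- letter, which forces equal colours.
        · exfalso
          obtain ⟨a, p, rfl⟩ := List.exists_cons_of_ne_nil hp0
          obtain ⟨l', w'', rfl, hl'⟩ := hf.head (a := a) (by rw [h3]; rfl)
          obtain ⟨b, n, rfl⟩ := List.exists_cons_of_ne_nil hn0
          obtain ⟨c, hc⟩ := hm
          obtain ⟨c', hc'⟩ := hm₁
          have h1 := hc a (by simp [hp])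
          have h2 := hc b (by simp [hp])
          have h3 := hc' b (by simp [hn])
          have h4 := hc' l (by simp)
          rw [hw'] at hw
          have h5 := hw.2
          simp only [List.singleton_append, List.isChain_cons_cons] at h5
          exact h5.1 (by rw [hl', h1, h4, ← h2, h3])

theorem Fan.comp_insert {w ρ τ x y κ : List (C ⊕ D)} {f : w ⟶ ρ} (hf : Fan f)
    (hρ : ρ = x ++ ([] ++ y)) (hτ : τ = x ++ (κ ++ y)) (hm : Mono κ) (u : [] ⟶ κ) :
    Fan (f ≫ wlay hρ hτ u) := by
  by_cases hκ : κ = []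
  · subst hκ hρ hτ
    obtain ⟨c, rfl⟩ := nil_eq_smul_id u
    rw [map_smul, wlay_id, Linear.comp_smul, Category.comp_id]
    exact .smul _ _ hf
  · exact .ins _ hf hρ hτ hm hκ u

/-- By induction on the insertions. A box disjoint from the last inserted word is exchanged with the
insertion. A box that meets it is combined with it, into one insertion or into one box acting before
that insertion. -/
theorem Fan.comp_wlay (hIC : IsNonunitSimpleReps IC) (hID : IsNonunitSimpleReps ID)
    {w ρ τ x y κ κ' : List (C ⊕ D)} {f : w ⟶ ρ} (hf : Fan f)
    (hw : Reduced IC ID w) (hρ : ρ = x ++ (κ ++ y)) (hτ : τ = x ++ (κ' ++ y))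
    (hm : Mono (κ ++ κ')) (u : κ ⟶ κ') : Fan (f ≫ wlay hρ hτ u) := by
  induction hf generalizing τ x y κ κ' with
  | base f hf =>
    by_cases hκ : κ = []
    · subst hκ
      exact Fan.comp_insert (.base _ hf) hρ hτ (hm.subset (by simp)) u
    exact hf.comp_wlay hIC hID hw hκ hρ hτ hm u
  | zero => rw [Limits.zero_comp]; exact .zero _ _
  | add g g' _ _ ih ih' =>
    rw [Preadditive.add_comp]
    exact .add _ _ (ih hρ hτ hm u) (ih' hρ hτ hm u)
  | smul c g _ ih => rw [Linear.smul_comp]; exact .smul _ _ (ih hρ hτ hm u)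
  | @ins ρ₀ ρ x₀ y₀ κ₀ f hf hρ₀ hρ' hm₀ hκ₀ v ih =>
    by_cases hκ : κ = []
    · subst hκ
      exact Fan.comp_insert (.ins _ hf hρ₀ hρ' hm₀ hκ₀ v) hρ hτ (hm.subset (by simp)) u
    rw [Category.assoc]
    have atRight : ∀ n, x₀ = x ++ (κ ++ n) → y = n ++ (κ₀ ++ y₀) →
        Fan (f ≫ AnnularFreeProduct.wlay hρ₀ hρ' v ≫ AnnularFreeProduct.wlay hρ hτ u) := by
      intro n hx₀ hy
      rw [← wlay_exchange (x := x) (κ := κ) (κ' := κ') (m := n) (y := y₀) (x₁ := x₀)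
        (x₂ := x ++ (κ' ++ n)) (y₁ := n ++ ([] ++ y₀)) (y₂ := y) hx₀ rfl rfl hy
        (by simp [hρ₀, hx₀]) rfl (by simp) (by simp [hτ, hy]) hρ₀ hρ' hρ hτ u v,
        ← Category.assoc]
      exact .ins _ (ih _ _ hm u) _ _ hm₀ hκ₀ v
    have atLeft : ∀ n, x = x₀ ++ (κ₀ ++ n) → y₀ = n ++ (κ ++ y) →
        Fan (f ≫ AnnularFreeProduct.wlay hρ₀ hρ' v ≫ AnnularFreeProduct.wlay hρ hτ u) := by
      intro n hx hy₀
      rw [wlay_exchange (x := x₀) (κ := []) (κ' := κ₀) (m := n) (μ := κ) (μ' := κ') (y := y)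
        (x₁ := x₀ ++ ([] ++ n)) (x₂ := x) (y₁ := y₀) (y₂ := n ++ (κ' ++ y))
        (ρ := (x₀ ++ ([] ++ n)) ++ (κ' ++ y)) rfl hx hy₀ rfl
        hρ₀ hρ' hρ hτ (by simp [hρ₀, hy₀]) rfl (by simp) (by simp [hτ, hx]) v u,
        ← Category.assoc]
      exact .ins _ (ih _ _ hm u) _ _ hm₀ hκ₀ v
    have h := hρ'.symm.trans hρ
    rcases List.append_eq_append_iff.1 h with ⟨m, hx, h2⟩ | ⟨m, hx, h2⟩
    · rcases List.append_eq_append_iff.1 h2 with ⟨n, hn, h3⟩ | ⟨n, hn, h3⟩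
      · exact atLeft n (by rw [hx, hn]) h3
      · rcases List.append_eq_append_iff.1 h3 with ⟨p, hp, h4⟩ | ⟨p, hp, h4⟩
        -- The box acts within the inserted word, so the two make a single insertion.
        · have e : AnnularFreeProduct.wlay hρ₀ hρ' v ≫ AnnularFreeProduct.wlay hρ hτ u =
              AnnularFreeProduct.wlay hρ₀ (show τ = x₀ ++ ((m ++ (κ' ++ p)) ++ y₀) by
                simp [hτ, hx, h4]) (v ≫ AnnularFreeProduct.wlay
                  (show κ₀ = m ++ (κ ++ p) by rw [hn, hp]) rfl u) := by
            rw [wlay_comp _ hρ', wlay_wlay _ _ _ _ hx h4 hρ hτ]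
          rw [e]
          refine hf.comp_insert _ _ ?_ _
          have h5 : Mono ((m ++ p) ++ κ) := hm₀.subset (by simp [hn, hp]; tauto)
          exact (h5.glue hm hκ).subset (by simp; tauto)
        · by_cases hn0 : n = []
          · exact atLeft [] (by simp [hx, hn, hn0]) (by simp [h4, hp, hn0])
          -- The box uses the right end `n` of the inserted word together with the older letters `p`
          -- after it; combined with the insertion it is a box from `p` to `m ++ κ'`.
          have e := wlay_comp_wlay (x := x₀) (y := y) (κ := p) (μ := m ++ (n ++ p)) (κ' := m ++ κ')
            (x₁ := []) (y₁ := p) (a := []) (a' := κ₀) (x₂ := m) (y₂ := []) (b := κ) (b' := κ')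
            (by simp [hρ₀, h4]) (by simp [hρ', hn, h4]) (by simp [hτ, hx]) (by simp)
            (by simp [hn]) (by simp [hp]) (by simp) (by simp) h4 hx (by simp) hρ₀ hρ' hρ hτ v u
          rw [e]
          refine ih _ _ ?_ _
          rw [hn] at hm₀
          rw [hp, List.append_assoc] at hm
          exact (hm₀.glue hm hn0).subset (by simp; tauto)
    · rcases List.append_eq_append_iff.1 h2 with ⟨n, hn, h3⟩ | ⟨n, hn, h3⟩
      · exact atRight n (by rw [hx, hn]) h3
      · rcases List.append_eq_append_iff.1 h3 with ⟨p, hp, h4⟩ | ⟨p, hp, h4⟩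
        -- The box consumes the whole inserted word, leaving a box with the older inputs `m ++ p`.
        · have e := wlay_comp_wlay (x := x) (y := y) (κ := m ++ p) (μ := κ) (κ' := κ')
            (x₁ := m) (y₁ := p) (a := []) (a' := κ₀) (x₂ := []) (y₂ := []) (b := κ) (b' := κ')
            (by simp [hρ₀, hx, h4]) hρ hτ (by simp) (by rw [hn, hp]) (by simp) (by simp)
            hx h4 (by simp) (by simp) hρ₀ hρ' hρ hτ v u
          rw [e]
          exact ih _ _ (hm.subset (by simp [hn, hp]; tauto)) _
        · by_cases hn0 : n = []
          · exact atRight [] (by simp [hx, hn, hn0]) (by simp [h4, hp, hn0])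
          -- The mirror image: the box uses the left end `n` of the inserted word and the older
          -- letters `m` before it.
          have e := wlay_comp_wlay (x := x) (y := y₀) (κ := m) (μ := m ++ (n ++ p)) (κ' := κ' ++ p)
            (x₁ := m) (y₁ := []) (a := []) (a' := κ₀) (x₂ := []) (y₂ := p) (b := κ) (b' := κ')
            (by simp [hρ₀, hx]) (by simp [hρ', hx, hp]) (by simp [hτ, h4]) (by simp)
            (by simp [hp]) (by simp [hn]) (by simp) hx (by simp) (by simp) h4 hρ₀ hρ' hρ hτ v u
          rw [e]
          refine ih _ _ ?_ _
          rw [hp] at hm₀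
          have h5 : Mono ((m ++ κ') ++ n) := hm.subset (by simp [hn]; tauto)
          exact (h5.glue hm₀ hn0).subset (by simp; tauto)

theorem Planar.fan (hIC : IsNonunitSimpleReps IC) (hID : IsNonunitSimpleReps ID)
    {w τ : List (C ⊕ D)} {f : w ⟶ τ} (hf : Planar f) (hw : Reduced IC ID w) : Fan f := by
  induction hf with
  | id => exact .base _ (.id _)
  | step f _ hρ hτ hm u ih => exact ih.comp_wlay hIC hID hw hρ hτ hm u
  | zero => exact .zero _ _
  | add f g _ _ ih ih' => exact .add _ _ ih ih'
  | smul c f _ ih => exact .smul _ _ ih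

end

end Fan

/-! ### Schur's lemma and fusion rules for reduced words -/

section Fusion

variable {C : Type u₁} [Category.{v₁} C] [Preadditive C] [Linear ℂ C] [MonoidalCategory C]
  [MonoidalPreadditive C] [MonoidalLinear ℂ C] [StarCategory C] [IsRigidCStarTensorCategory C]
variable {D : Type u₂} [Category.{v₂} D] [Preadditive D] [Linear ℂ D] [MonoidalCategory D]
  [MonoidalPreadditive D] [MonoidalLinear ℂ D] [StarCategory D] [IsRigidCStarTensorCategory D]

theorem wten_id {ρ σ τ : List (C ⊕ D)} (h : ρ = σ ++ τ) : wten h h (𝟙 σ) (𝟙 τ) = 𝟙 ρ := by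
  subst h
  rw [wten, wlay_id]
  have e : wlay (x := σ) (y := []) (σ := σ ++ τ) (τ := σ ++ τ) (by simp) (by simp) (𝟙 τ) = 𝟙 _ :=
    wlay_id (by simp)
  rw [e]
  exact Category.id_comp _

theorem wten_smul_left {ρ ρ' σ σ' τ τ' : List (C ⊕ D)} (h : ρ = σ ++ τ) (h' : ρ' = σ' ++ τ')
    (c : ℂ) (u : σ ⟶ σ') (f : τ ⟶ τ') : wten h h' (c • u) f = c • wten h h' u f := by
  rw [wten, map_smul, Linear.smul_comp]; rfl

variable {IC : Set C} {ID : Set D}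

/-- A one-coloured part of a reduced word is a single nonunit simple letter, which receives no
nonzero morphism from the unit. -/
theorem insert_eq_zero (hIC : IsNonunitSimpleReps IC) (hID : IsNonunitSimpleReps ID)
    {x κ y : List (C ⊕ D)} (h : Reduced IC ID (x ++ (κ ++ y))) (hm : Mono κ) (hκ : κ ≠ [])
    (u : [] ⟶ κ) : u = 0 := by
  obtain ⟨l, rfl⟩ := h.eq_singleton hm hκ
  exact nil_letter_eq_zero hIC hID (h.1 l (by simp)) u

theorem letter_eq (hIC : IsNonunitSimpleReps IC) (hID : IsNonunitSimpleReps ID)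
    {x κ y : List (C ⊕ D)} {l : C ⊕ D} (h : Reduced IC ID (x ++ (κ ++ y))) (hm : Mono (l :: κ))
    (hκ : κ ≠ []) (hl : Sum.elim (fun c => c ∈ IC) (fun d => d ∈ ID) l) (u : [l] ⟶ κ)
    (hu : u ≠ 0) : κ = [l] := by
  obtain ⟨l', rfl⟩ := h.eq_singleton (hm.subset fun _ h => List.mem_cons_of_mem _ h) hκ
  by_contra hne
  exact hu (letter_letter_eq_zero hIC hID hl (h.1 l' (by simp)) hm
    (fun h => hne (by rw [h])) u)

theorem Base.schur (hIC : IsNonunitSimpleReps IC) (hID : IsNonunitSimpleReps ID)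
    {w τ : List (C ⊕ D)} {f : w ⟶ τ} (hf : Base f) (hw : Reduced IC ID w)
    (hτ : Reduced IC ID τ) : (∃ (e : w = τ) (c : ℂ), f = c • eqToHom e) ∨ f = 0 := by
  induction hf with
  | nil => exact Or.inl ⟨rfl, 1, by simp⟩
  | @cons w τ w' τ' κ l u f hf hm hκ hw' hτ' ih =>
    subst hw' hτ'
    by_cases hu : u = 0
    · right
      rw [hu, wten_zero_left]
    obtain rfl : κ = [l] := letter_eq hIC hID (x := []) (y := τ) hτ hm hκ
      (hw.1 l (by simp)) u hu
    rcases ih hw.of_append_right hτ.of_append_right with ⟨rfl, c, rfl⟩ | rfl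
    · obtain ⟨a, rfl⟩ := letter_eq_smul_id hIC hID (hw.1 l (by simp)) u
      refine Or.inl ⟨rfl, a * c, ?_⟩
      rw [wten_smul_left, wten_smul_right, eqToHom_refl, wten_id, smul_smul]
      rfl
    · right
      rw [wten_zero_right]

/-- An insertion into a reduced target vanishes, and a `Base` morphism into it is a tensor product
of scalars on matching letters. Thus reduced words are simple, and distinct ones have no planar
morphisms between them except zero. -/
theorem Fan.schur (hIC : IsNonunitSimpleReps IC) (hID : IsNonunitSimpleReps ID)
    {w τ : List (C ⊕ D)} {f : w ⟶ τ} (hf : Fan f) (hw : Reduced IC ID w)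
    (hτ : Reduced IC ID τ) : (∃ (e : w = τ) (c : ℂ), f = c • eqToHom e) ∨ f = 0 := by
  induction hf with
  | base f hf => exact hf.schur hIC hID hw hτ
  | ins f _ hρ hτ' hm hκ u =>
    subst hτ'
    right
    rw [insert_eq_zero hIC hID hτ hm hκ u, map_zero, Limits.comp_zero]
  | zero => exact Or.inr rfl
  | add f g _ _ ih ih' =>
    rcases ih hτ with ⟨e, c, rfl⟩ | rfl
    · rcases ih' hτ with ⟨_, c', rfl⟩ | rfl
      · exact Or.inl ⟨e, c + c', (add_smul _ _ _).symm⟩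
      · exact Or.inl ⟨e, c, add_zero _⟩
    · rw [zero_add]
      exact ih' hτ
  | smul c f _ ih =>
    rcases ih hτ with ⟨e, c', rfl⟩ | rfl
    · exact Or.inl ⟨e, c * c', smul_smul _ _ _⟩
    · exact Or.inr (smul_zero c)

/-- There is a nonzero morphism from the unit to `l ⊗ l'`. -/
def DualLetter (l l' : C ⊕ D) : Prop :=
  Mono [l, l'] ∧ ∃ u : ([] : List (C ⊕ D)) ⟶ [l, l'], u ≠ 0

/-- `z` arises from `x` and `y` by cancelling dual letters, and possibly merging two letters of the
same colour, at the place where `x` and `y` meet. -/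
def FusionRel (z x y : List (C ⊕ D)) : Prop :=
  ∃ x₁ e e' y₁, x = x₁ ++ e ∧ y = e' ++ y₁ ∧ List.Forall₂ DualLetter e.reverse e' ∧
    (z = x₁ ++ y₁ ∨ ∃ x₂ c c' s y₂, x₁ = x₂ ++ [c] ∧ y₁ = c' :: y₂ ∧ z = x₂ ++ s :: y₂ ∧
      Mono [c, c', s])

/-- A letter whose image lies on one side of the cut between `x` and `y` is reproduced unchanged. At
most one image can straddle the cut, and as `x` and `y` are reduced it then has one letter on each
side; its source is the merged letter. -/
theorem Base.fusion (hIC : IsNonunitSimpleReps IC) (hID : IsNonunitSimpleReps ID)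
    {z τ x y : List (C ⊕ D)} {f : z ⟶ τ} (hf : Base f) (h0 : f ≠ 0) (hτ : τ = x ++ y)
    (hz : Reduced IC ID z) (hx : Reduced IC ID x) (hy : Reduced IC ID y) :
    z = x ++ y ∨ ∃ x₂ c c' s y₂, x = x₂ ++ [c] ∧ y = c' :: y₂ ∧ z = x₂ ++ s :: y₂ ∧
      Mono [c, c', s] := by
  induction hf generalizing x y with
  | nil => exact Or.inl hτ
  | @cons w τ₀ w' τ' κ l u f hf hm hκ hw' hτ' ih =>
    have hu : u ≠ 0 := fun h => h0 (by rw [h, wten_zero_left])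
    have hf0 : f ≠ 0 := fun h => h0 (by rw [h, wten_zero_right])
    have hl := hz.1 l (by simp [hw'])
    have hzw : Reduced IC ID w := by
      rw [hw'] at hz
      exact hz.of_append_right
    rcases List.append_eq_append_iff.1 (hτ'.symm.trans hτ) with ⟨m, hm', h2⟩ | ⟨n, hn, h2⟩
    · have hκl : κ = [l] := letter_eq hIC hID (x := []) (y := m) (by rwa [hm'] at hx) hm hκ hl u hu
      subst hκl
      rcases ih hf0 h2 hzw (by rw [hm'] at hx; exact hx.of_append_right) hy with
        h | ⟨x₂, c, c', s, y₂, h1, h3, h4, h5⟩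
      · left
        rw [hw', h, hm', List.append_assoc]
      · right
        exact ⟨l :: x₂, c, c', s, y₂, by rw [hm', h1]; rfl, h3, by rw [hw', h4]; rfl, h5⟩
    -- The remaining letters land entirely in the second word, which is the case of an empty first
    -- word.
    · have hw0 : w = τ₀ := by
        rcases ih (x := []) (y := τ₀) hf0 rfl hzw Reduced.nil
          (by rw [h2] at hy; exact hy.of_append_right) with h | ⟨x₂, c, c', s, y₂, h1, -⟩
        · exact h
        · simp at h1
      by_cases hx0 : x = []
      · subst hx0
        have hκn : κ = n := hn
        subst hκn
        have hκl : κ = [l] := letter_eq hIC hID (x := []) (y := τ₀) (by rwa [h2] at hy) hm hκ hl u hu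
        left
        rw [hw', h2, hκl, hw0]
        rfl
      · by_cases hn0 : n = []
        · subst hn0
          have hκx : κ = x := by simpa using hn
          subst hκx
          have hκl : κ = [l] := letter_eq hIC hID (x := []) (y := []) (by simpa using hx) hm hκ hl
            u hu
          left
          rw [hw', h2, hκl, hw0]
          rfl
        · obtain ⟨c, rfl⟩ := Reduced.eq_singleton (x := []) (y := []) (κ := x) (by simpa using hx)
            (hm.subset (by simp [hn]; tauto)) hx0
          obtain ⟨c', rfl⟩ := Reduced.eq_singleton (x := []) (y := τ₀) (κ := n)
            (by rwa [h2] at hy) (hm.subset (by simp [hn]; tauto)) hn0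
          right
          exact ⟨[], c, c', l, τ₀, rfl, h2, by rw [hw', hw0]; rfl, hm.subset (by simp [hn])⟩

/-- The last insertion cannot lie inside `x` or inside `y`, where it would vanish. So it straddles
the cut with one letter on each side, a dual pair. Removing this pair and iterating leaves a `Base`
morphism. -/
theorem Fan.fusion (hIC : IsNonunitSimpleReps IC) (hID : IsNonunitSimpleReps ID)
    {z τ x y : List (C ⊕ D)} {f : z ⟶ τ} (hf : Fan f) (h0 : f ≠ 0) (hτ : τ = x ++ y)
    (hz : Reduced IC ID z) (hx : Reduced IC ID x) (hy : Reduced IC ID y) : FusionRel z x y := by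
  induction hf generalizing x y with
  | base f hf =>
    exact ⟨x, [], [], y, by simp, by simp, by simp, hf.fusion hIC hID h0 hτ hz hx hy⟩
  | zero => exact absurd rfl h0
  | add f g _ _ ih ih' =>
    by_cases hf0 : f = 0
    · exact ih' (fun hg => h0 (by rw [hf0, hg, add_zero])) hτ hx hy
    · exact ih hf0 hτ hx hy
  | smul c f _ ih => exact ih (fun hf => h0 (by rw [hf, smul_zero])) hτ hx hy
  | @ins ρ τ x₀ y₀ κ f hf hρ hτ' hm hκ u ih =>
    have hu : u ≠ 0 := fun h => h0 (by rw [h, map_zero, Limits.comp_zero])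
    have hf0 : f ≠ 0 := fun h => h0 (by rw [h, Limits.zero_comp])
    rcases List.append_eq_append_iff.1 (hτ'.symm.trans hτ) with ⟨m, h1, h2⟩ | ⟨n, h1, h2⟩
    · rcases List.append_eq_append_iff.1 h2 with ⟨p, h3, h4⟩ | ⟨p, h3, h4⟩
      · subst h1 h3
        exact absurd (insert_eq_zero hIC hID hx hm hκ u) hu
      · by_cases hm0 : m = []
        · subst hm0
          have e : κ = p := h3
          subst e
          rw [h4] at hy
          exact absurd (insert_eq_zero hIC hID (x := []) hy hm hκ u) hu
        by_cases hp0 : p = []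
        · subst hp0
          have e : κ = m := by simpa using h3
          subst e
          rw [h1] at hx
          exact absurd (insert_eq_zero hIC hID (x := x₀) (y := []) (by simpa using hx) hm hκ u) hu
        subst h1 h4 h3
        obtain ⟨c, rfl⟩ := Reduced.eq_singleton (x := x₀) (κ := m) (y := []) (by simpa using hx)
          (hm.subset (by simp; tauto)) hm0
        obtain ⟨c', rfl⟩ := Reduced.eq_singleton (x := []) (κ := p) (y := y₀) hy
          (hm.subset (by grind)) hp0
        obtain ⟨x₁, e, e', y₁, rfl, rfl, h5, h6⟩ := ih hf0 hρ hx.of_append_left hy.of_append_right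
        refine ⟨x₁, e ++ [c], c' :: e', y₁, by simp, by simp, ?_, h6⟩
        rw [List.reverse_append]
        exact List.Forall₂.cons ⟨hm, u, hu⟩ h5
    · subst h1
      rw [h2] at hy
      exact absurd (insert_eq_zero hIC hID hy hm hκ u) hu

end Fusion

/-! ## Drawings as sequences of boxes -/

section Path

variable {M : Type u} [Category.{v} M] [Preadditive M] [Linear ℂ M] [MonoidalCategory M]
  [MonoidalPreadditive M] [MonoidalLinear ℂ M]

/-- A morphism between tensor products of words. -/
structure Box (M : Type u) [Category.{v} M] [MonoidalCategory M] where
  /-- The input strings. -/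
  inp : List M
  /-- The output strings. -/
  out : List M
  /-- The morphism. -/
  mor : tw inp ⟶ tw out

/-- All the letters of `x` are labelled by `b`. -/
def label {L : Type*} (b : ℕ) (x : List L) : List (L × ℕ) := x.map (fun c => (c, b))

theorem map_label {L : Type*} (b : ℕ) (x : List L) : (label b x).map Prod.fst = x := by
  simp [label, Function.comp_def]

theorem mem_label {L : Type*} {b : ℕ} {x : List L} {p : L × ℕ} (h : p ∈ label b x) : p.2 = b := by
  simp only [label, List.mem_map] at h
  obtain ⟨c, -, rfl⟩ := h
  rfl

theorem label_map {L : Type*} {b : ℕ} {x : List (L × ℕ)} (h : ∀ p ∈ x, p.2 = b) :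
    label b (x.map Prod.fst) = x := by
  induction x with
  | nil => rfl
  | cons p x ih =>
    obtain ⟨c, d⟩ := p
    have hd : d = b := h (c, d) (by simp)
    have ih' := ih (fun q hq => h q (by simp [hq]))
    simp only [label, List.map_cons, List.cons.injEq] at ih' ⊢
    exact ⟨by rw [hd], ih'⟩

theorem label_block {L : Type*} (x : List (L × ℕ)) (b : ℕ) :
    label b ((block x b).map Prod.fst) = block x b :=
  label_map (fun p hp => by simpa using (List.mem_filter.1 hp).2)

/-- `f` is the composite of the boxes with labels in the given list, drawn one after the other,
which transform the labelled word `z` into the labelled word `z'`. -/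
inductive Path (B : ℕ → Box M) : List ℕ → List (M × ℕ) → List (M × ℕ) →
    ∀ {X Y : List M}, (tw X ⟶ tw Y) → Prop
  | nil {z : List (M × ℕ)} {X : List M} (h : z.map Prod.fst = X) : Path B [] z z (𝟙 (tw X))
  | cons {b : ℕ} {l : List ℕ} {z z₁ z' x y : List (M × ℕ)} {X X₁ Y x' y' : List M}
      (hz : z = x ++ (label b (B b).inp ++ y)) (hz₁ : z₁ = x ++ (label b (B b).out ++ y))
      (hx : x.map Prod.fst = x') (hy : y.map Prod.fst = y') (hX : X = x' ++ ((B b).inp ++ y'))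
      (hX₁ : X₁ = x' ++ ((B b).out ++ y')) {g : tw X₁ ⟶ tw Y} (hg : Path B l z₁ z' g) :
      Path B (b :: l) z z' (lay hX hX₁ (B b).mor ≫ g)

theorem Path.source {B : ℕ → Box M} {l : List ℕ} {z z' : List (M × ℕ)} {X Y : List M}
    {f : tw X ⟶ tw Y} (h : Path B l z z' f) : z.map Prod.fst = X := by
  cases h with
  | nil h => exact h
  | cons hz hz₁ hx hy hX hX₁ hg => rw [hz, hX]; simp [hx, hy, map_label]

theorem Path.append {B : ℕ → Box M} {l l' : List ℕ} {z z' z'' : List (M × ℕ)} {X Y Z : List M}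
    {f : tw X ⟶ tw Y} {g : tw Y ⟶ tw Z} (h : Path B l z z' f) (h' : Path B l' z' z'' g) :
    Path B (l ++ l') z z'' (f ≫ g) := by
  induction h with
  | nil h => rwa [Category.id_comp]
  | cons hz hz₁ hx hy hX hX₁ hg ih =>
    rw [Category.assoc]
    exact .cons hz hz₁ hx hy hX hX₁ (ih h')

theorem Path.single {B : ℕ → Box M} {b : ℕ} {z z₁ x y : List (M × ℕ)} {X X₁ x' y' : List M}
    (hz : z = x ++ (label b (B b).inp ++ y)) (hz₁ : z₁ = x ++ (label b (B b).out ++ y))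
    (hx : x.map Prod.fst = x') (hy : y.map Prod.fst = y') (hX : X = x' ++ ((B b).inp ++ y'))
    (hX₁ : X₁ = x' ++ ((B b).out ++ y')) : Path B [b] z z₁ (lay hX hX₁ (B b).mor) := by
  rw [← Category.comp_id (lay hX hX₁ (B b).mor)]
  exact .cons hz hz₁ hx hy hX hX₁ (.nil (by rw [hz₁, hX₁]; simp [hx, hy, map_label]))

theorem Path.congr {B B' : ℕ → Box M} {l : List ℕ} {z z' : List (M × ℕ)} {X Y : List M}
    {f : tw X ⟶ tw Y} (h : Path B l z z' f) (hB : ∀ b ∈ l, B b = B' b) : Path B' l z z' f := by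
  induction h with
  | nil h => exact .nil h
  | @cons b l z z₁ z' x y X X₁ Y x' y' hz hz₁ hx hy hX hX₁ g hg ih =>
    have e := hB b (by simp)
    have ih' := ih (fun c hc => hB c (by simp [hc]))
    generalize B b = β at *
    subst e
    exact .cons hz hz₁ hx hy hX hX₁ ih'

/-- Add a word on the left and on the right. -/
theorem Path.whisker {B : ℕ → Box M} {l : List ℕ} {z z' : List (M × ℕ)} {X Y : List M}
    {f : tw X ⟶ tw Y} (h : Path B l z z' f) (a c : List (M × ℕ)) {a' c' X' Y' : List M}
    (ha : a.map Prod.fst = a') (hc : c.map Prod.fst = c') (hX : X' = a' ++ (X ++ c'))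
    (hY : Y' = a' ++ (Y ++ c')) : Path B l (a ++ (z ++ c)) (a ++ (z' ++ c)) (lay hX hY f) := by
  induction h generalizing X' with
  | nil h =>
    subst hY hX
    rw [lay_id]
    exact .nil (by simp [ha, hc, h])
  | @cons b l z z₁ z' x y X X₁ Y x' y' hz hz₁ hx hy hX' hX₁ g hg ih =>
    rw [lay_comp hX (rfl : a' ++ (X₁ ++ c') = _) hY,
      lay_lay hX rfl hX' hX₁ rfl rfl (by simp [hX, hX']) (by simp [hX₁])]
    exact .cons (x := a ++ x) (y := y ++ c) (by simp [hz]) rfl (by simp [ha, hx])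
      (by simp [hy, hc]) _ _ (by simpa [hz₁] using ih rfl hY)

/-- The boxes of a diagram. -/
def boxOf {bot top : List (M × ℕ)}
    (f : ∀ b : ℕ, tens Prod.fst (block bot b) ⟶ tens Prod.fst (block top b)) (b : ℕ) : Box M :=
  ⟨(block bot b).map Prod.fst, (block top b).map Prod.fst,
    eqToHom (tw_map _ _).symm ≫ f b ≫ eqToHom (tw_map _ _)⟩

theorem boxOf_mor {bot top : List (M × ℕ)}
    (f : ∀ b : ℕ, tens Prod.fst (block bot b) ⟶ tens Prod.fst (block top b)) (b : ℕ)
    (x y : List (M × ℕ)) {X Y x' y' : List M} (hx : x.map Prod.fst = x')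
    (hy : y.map Prod.fst = y') (hX : X = x' ++ ((boxOf f b).inp ++ y'))
    (hY : Y = x' ++ ((boxOf f b).out ++ y'))
    (p : tens Prod.fst (x ++ (block bot b ++ y)) = tw X)
    (q : tw Y = tens Prod.fst (x ++ (block top b ++ y))) :
    layer Prod.fst x y (f b) = eqToHom p ≫ lay hX hY (boxOf f b).mor ≫ eqToHom q :=
  layer_map Prod.fst x y (f b) hx hy rfl rfl hX hY p q _ _

/-- The set of drawn blocks becomes a duplicate-free list in order of drawing, which, unlike the
set, can be permuted and reversed. -/
theorem Drawn.path {bot top : List (M × ℕ)}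
    {f : ∀ b : ℕ, tens Prod.fst (block bot b) ⟶ tens Prod.fst (block top b)} {S : Finset ℕ}
    {z : List (M × ℕ)} {g : tens Prod.fst bot ⟶ tens Prod.fst z} (h : Drawn bot top f S z g) :
    ∀ {X Y : List M} (_ : bot.map Prod.fst = X) (_ : z.map Prod.fst = Y)
      (p : tw X = tens Prod.fst bot) (q : tens Prod.fst z = tw Y),
      ∃ l : List ℕ, l.Nodup ∧ l.toFinset = S ∧ (∀ b ∈ l, b ∈ (bot ++ top).map Prod.snd) ∧
        Path (boxOf f) l bot z (eqToHom p ≫ g ≫ eqToHom q) := by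
  induction h with
  | start =>
    intro X Y hX hY p q
    subst hX hY
    exact ⟨[], by simp, by simp, by simp, by simpa using Path.nil rfl⟩
  | box S x y b g hg hb hS ih =>
    intro X Y hX hY p q
    obtain ⟨l, h1, h2, h3, h4⟩ := ih hX rfl p (tw_map _ _)
    refine ⟨l ++ [b], ?_, ?_, ?_, ?_⟩
    · have hb' : b ∉ l := fun h => hS (by rw [← h2]; simpa using h)
      rw [List.nodup_append]
      exact ⟨h1, by simp, by rintro c hc d hd rfl; simp at hd; exact hb' (hd ▸ hc)⟩
    · rw [List.toFinset_append, h2]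
      ext c
      simp [or_comm]
    · intro c hc
      simp only [List.mem_append, List.mem_singleton] at hc
      rcases hc with hc | rfl
      · exact h3 c hc
      · exact hb
    · subst hY
      have e := boxOf_mor f b x y (X := (x ++ (block bot b ++ y)).map Prod.fst)
        (Y := (x ++ (block top b ++ y)).map Prod.fst) rfl rfl (by simp [boxOf])
        (by simp [boxOf]) (tw_map _ _) (tw_map _ _).symm
      have h5 := h4.append (Path.single (B := boxOf f) (b := b) (x := x) (y := y)
        (by rw [boxOf, label_block]) (z₁ := x ++ (block top b ++ y)) (by rw [boxOf, label_block])
        rfl rfl (by simp [boxOf]) (X₁ := (x ++ (block top b ++ y)).map Prod.fst) (by simp [boxOf]))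
      rw [e]
      simpa using h5

theorem Path.drawn {bot top : List (M × ℕ)}
    {f : ∀ b : ℕ, tens Prod.fst (block bot b) ⟶ tens Prod.fst (block top b)} {l : List ℕ}
    {z z' : List (M × ℕ)} {X Y : List M} {h : tw X ⟶ tw Y} (hP : Path (boxOf f) l z z' h)
    (hl : l.Nodup) (hlab : ∀ b ∈ l, b ∈ (bot ++ top).map Prod.snd) :
    ∀ {S : Finset ℕ} {g : tens Prod.fst bot ⟶ tens Prod.fst z} (_ : Drawn bot top f S z g)
      (_ : ∀ b ∈ l, b ∉ S) (p : tens Prod.fst z = tw X) (q : tw Y = tens Prod.fst z'),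
      Drawn bot top f (S ∪ l.toFinset) z' (g ≫ eqToHom p ≫ h ≫ eqToHom q) := by
  induction hP with
  | nil h =>
    intro S g hD _ p q
    simpa using hD
  | @cons b l z z₁ z' x y X X₁ Y x' y' hz hz₁ hx hy hX hX₁ g' hg ih =>
    intro S g hD hS p q
    have hz' : z = x ++ (block bot b ++ y) := by rw [hz, boxOf, label_block]
    have hz₁' : z₁ = x ++ (block top b ++ y) := by rw [hz₁, boxOf, label_block]
    subst hz' hz₁'
    rw [List.nodup_cons] at hl
    have hX₁' : tw X₁ = tens Prod.fst (x ++ (block top b ++ y)) := by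
      rw [tw_map, hX₁]
      simp [boxOf, hx, hy]
    have e := boxOf_mor f b x y hx hy hX hX₁ p hX₁'
    have hD' := Drawn.box S x y b g hD (hlab b (by simp)) (hS b (by simp))
    have h1 := ih hl.2 (fun c hc => hlab c (by simp [hc])) hD' (by
      intro c hc hc'
      rw [Finset.mem_insert] at hc'
      rcases hc' with rfl | hc'
      · exact hl.1 hc
      · exact hS c (by simp [hc]) hc') hX₁'.symm q
    rw [e] at h1
    have e2 : S ∪ (b :: l).toFinset = insert b S ∪ l.toFinset := by
      ext c
      simp only [Finset.mem_union, List.mem_toFinset, List.mem_cons, Finset.mem_insert]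
      tauto
    rw [e2]
    simpa using h1

end Path

/-! ## Construction of diagrams -/

section Diagram

variable {M : Type u} [Category.{v} M] [Preadditive M] [Linear ℂ M] [MonoidalCategory M]
  [MonoidalPreadditive M] [MonoidalLinear ℂ M]

theorem block_append {L : Type*} (x y : List (L × ℕ)) (b : ℕ) :
    block (x ++ y) b = block x b ++ block y b :=
  List.filter_append _ _

theorem block_label_self {L : Type*} (x : List L) (b : ℕ) : block (label b x) b = label b x :=
  List.filter_eq_self.2 (fun p hp => by simp [mem_label hp])

theorem block_label_ne {L : Type*} (x : List L) {b c : ℕ} (h : c ≠ b) :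
    block (label b x) c = [] :=
  List.filter_eq_nil_iff.2 (fun p hp => by simp [mem_label hp, h.symm])

theorem block_eq_nil {L : Type*} {x : List (L × ℕ)} {b : ℕ} (h : b ∉ x.map Prod.snd) :
    block x b = [] :=
  List.filter_eq_nil_iff.2 (fun p hp => by
    simp only [decide_eq_true_eq]
    rintro rfl
    exact h (List.mem_map.2 ⟨p, hp, rfl⟩))

theorem mem_map_label {L : Type*} {b c : ℕ} {x : List L} :
    c ∈ (label b x).map Prod.snd ↔ c = b ∧ x ≠ [] := by
  cases x with
  | nil => simp [label]
  | cons a x => simp [label, Function.comp_def]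

/-- `f` is the value of a diagram with one colour. -/
def IsDiagram (bot top : List (M × ℕ)) {X Y : List M} (f : tw X ⟶ tw Y) : Prop :=
  ∃ (B : ℕ → Box M) (l : List ℕ), (∀ b, label b (B b).inp = block bot b) ∧
    (∀ b, label b (B b).out = block top b) ∧ l.Nodup ∧
    (∀ b, b ∈ l ↔ b ∈ (bot ++ top).map Prod.snd) ∧ Path B l bot top f

/-- Allows diagrams to be built from boxes on plain words, the casts to labelled words being made
once at the end. -/
theorem boxOf_eq {bot top : List (M × ℕ)} (B : ℕ → Box M)
    (h : ∀ b, label b (B b).inp = block bot b) (h' : ∀ b, label b (B b).out = block top b) :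
    ∃ f : ∀ b : ℕ, tens Prod.fst (block bot b) ⟶ tens Prod.fst (block top b), boxOf f = B := by
  have key : ∀ b, ∃ f : tens Prod.fst (block bot b) ⟶ tens Prod.fst (block top b),
      (⟨(block bot b).map Prod.fst, (block top b).map Prod.fst,
        eqToHom (tw_map _ _).symm ≫ f ≫ eqToHom (tw_map _ _)⟩ : Box M) = B b := by
    intro b
    have e := congrArg (List.map Prod.fst) (h b)
    have e' := congrArg (List.map Prod.fst) (h' b)
    rw [map_label] at e e'
    generalize B b = β at e e'
    obtain ⟨i, o, m⟩ := β
    dsimp only at e e'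
    subst e e'
    exact ⟨eqToHom (tw_map _ _) ≫ m ≫ eqToHom (tw_map _ _).symm, by simp⟩
  choose f hf using key
  exact ⟨f, funext hf⟩

theorem IsDiagram.isValue {bot top : List (M × ℕ)} {X Y : List M} {f : tw X ⟶ tw Y}
    (h : IsDiagram bot top f) :
    ∃ F : ∀ b : ℕ, tens Prod.fst (block bot b) ⟶ tens Prod.fst (block top b),
      ∀ (p : tens Prod.fst bot = tw X) (q : tw Y = tens Prod.fst top),
        IsValue bot top F (eqToHom p ≫ f ≫ eqToHom q) := by
  obtain ⟨B, l, h1, h2, h3, h4, h5⟩ := h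
  obtain ⟨F, rfl⟩ := boxOf_eq B h1 h2
  refine ⟨F, fun p q => ?_⟩
  have h6 := h5.drawn h3 (fun b hb => (h4 b).1 hb) (Drawn.start (f := F)) (by simp) p q
  have e : (∅ ∪ l.toFinset) = ((bot ++ top).map Prod.snd).toFinset := by
    ext b
    simp only [Finset.empty_union, List.mem_toFinset, h4 b]
  rw [e, Category.id_comp] at h6
  exact h6

theorem IsDiagram.cast {bot top : List (M × ℕ)} {X X' Y Y' : List M} {f : tw X ⟶ tw Y}
    (h : IsDiagram bot top f) (hX : X' = X) (hY : Y = Y') (f' : tw X' ⟶ tw Y')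
    (hf : f' = eqToHom (congrArg tw hX) ≫ f ≫ eqToHom (congrArg tw hY)) :
    IsDiagram bot top f' := by
  subst hX hY hf
  simpa using h

theorem lay_eqToHom {σ τ x y κ κ' : List M} (hσ : σ = x ++ (κ ++ y)) (hτ : τ = x ++ (κ' ++ y))
    (h : κ = κ') : lay hσ hτ (eqToHom (congrArg tw h)) =
      eqToHom (congrArg tw (by rw [hσ, hτ, h])) := by
  subst h hσ hτ
  simp [lay_id]

theorem IsDiagram.nil : IsDiagram [] [] (𝟙 (tw ([] : List M))) :=
  ⟨fun _ => ⟨[], [], 𝟙 _⟩, [], by simp [label, block], by simp [label, block], by simp, by simp,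
    .nil rfl⟩

theorem update_box {bot top bot' top' : List (M × ℕ)} {B : ℕ → Box M} {b : ℕ} {κ κ' : List M}
    (u : tw κ ⟶ tw κ') (h1 : ∀ c, label c (B c).inp = block bot c)
    (h2 : ∀ c, label c (B c).out = block top c)
    (h3 : ∀ c, c ≠ b → block bot' c = block bot c) (h4 : ∀ c, c ≠ b → block top' c = block top c)
    (h5 : block bot' b = label b κ) (h6 : block top' b = label b κ') :
    (∀ c, label c (Function.update B b ⟨κ, κ', u⟩ c).inp = block bot' c) ∧
      (∀ c, label c (Function.update B b ⟨κ, κ', u⟩ c).out = block top' c) := by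
  constructor <;> intro c <;> by_cases hc : c = b
  · subst hc; simp [h5]
  · simp [hc, h3 c hc, h1]
  · subst hc; simp [h6]
  · simp [hc, h4 c hc, h2]

theorem Path.update {B : ℕ → Box M} {l : List ℕ} {z z' : List (M × ℕ)} {X Y : List M}
    {f : tw X ⟶ tw Y} (h : Path B l z z' f) {b : ℕ} (hb : b ∉ l) (β : Box M) :
    Path (Function.update B b β) l z z' f :=
  h.congr (fun c hc => by rw [Function.update_of_ne]; rintro rfl; exact hb hc)

/-- Adds a leftmost block with a fresh label. The condition `hu` concerns the colour in which the
block has no letters: no box exists there, so the morphism must be the canonical identification. -/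
theorem IsDiagram.cons {bot top : List (M × ℕ)} {X Y κ κ' X' X₁ Y' : List M} {f : tw X ⟶ tw Y}
    (h : IsDiagram bot top f) {b : ℕ} (hb : b ∉ (bot ++ top).map Prod.snd)
    (hX' : X' = [] ++ (κ ++ X)) (hX₁ : X₁ = [] ++ (κ' ++ X)) (hX₂ : X₁ = κ' ++ (X ++ []))
    (hY' : Y' = κ' ++ (Y ++ [])) (u : tw κ ⟶ tw κ')
    (hu : κ = [] → κ' = [] → ∃ e : κ = κ', u = eqToHom (congrArg tw e)) :
    IsDiagram (label b κ ++ bot) (label b κ' ++ top) (lay hX' hX₁ u ≫ lay hX₂ hY' f) := by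
  obtain ⟨B, l, h1, h2, h3, h4, h5⟩ := h
  -- A label without letters names no block and must not enter the list of boxes.
  by_cases h0 : κ = [] ∧ κ' = []
  · obtain ⟨rfl, rfl⟩ := h0
    obtain ⟨-, rfl⟩ := hu rfl rfl
    rw [lay_eqToHom _ _ rfl]
    have h6 := h5.whisker [] [] (a' := []) (c' := []) rfl rfl hX₂ hY'
    simp only [List.nil_append, List.append_nil] at h6
    have h7 : IsDiagram bot top (lay hX₂ hY' f) := ⟨B, l, h1, h2, h3, h4, h6⟩
    exact h7.cast (by rw [hX', hX₁]) rfl _ (by simp)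
  · rw [List.map_append, List.mem_append, not_or] at hb
    have hbl : b ∉ l := by rw [h4]; simpa using hb
    obtain ⟨g1, g2⟩ := update_box (bot := bot) (top := top) (bot' := label b κ ++ bot)
      (top' := label b κ' ++ top) u h1 h2
      (fun c hc => by rw [block_append, block_label_ne _ hc, List.nil_append])
      (fun c hc => by rw [block_append, block_label_ne _ hc, List.nil_append])
      (by rw [block_append, block_label_self, block_eq_nil hb.1, List.append_nil])
      (by rw [block_append, block_label_self, block_eq_nil hb.2, List.append_nil])
    refine ⟨_, b :: l, g1, g2, List.nodup_cons.2 ⟨hbl, h3⟩, ?_, ?_⟩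
    · intro c
      have h6 := h4 c
      simp only [List.map_append, List.mem_append, List.mem_cons, mem_map_label] at h6 ⊢
      tauto
    · have h6 := (h5.update hbl ⟨κ, κ', u⟩).whisker (label b κ') [] (map_label b κ') rfl hX₂ hY'
      simp only [List.append_nil] at h6
      have e : Function.update B b ⟨κ, κ', u⟩ b = ⟨κ, κ', u⟩ := Function.update_self _ _ _
      generalize Function.update B b ⟨κ, κ', u⟩ = B' at *
      have key : ∀ (β : Box M) (_ : B' b = β) (hX' : X' = [] ++ (β.inp ++ X))
          (hX₁ : X₁ = [] ++ (β.out ++ X)) (_ : Path B' l (label b β.out ++ bot)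
            (label b κ' ++ top) (lay hX₂ hY' f)),
          Path B' (b :: l) (label b β.inp ++ bot) (label b κ' ++ top)
            (lay hX' hX₁ β.mor ≫ lay hX₂ hY' f) := by
        rintro β rfl hX' hX₁ h
        exact .cons (x := []) rfl rfl rfl h5.source hX' hX₁ h
      exact key _ e hX' hX₁ h6

theorem IsDiagram.insert_top {bot x y : List (M × ℕ)} {X Y κ x' y' Y' : List M}
    {f : tw X ⟶ tw Y} (h : IsDiagram bot (x ++ y) f) {b : ℕ}
    (hb : b ∉ (bot ++ (x ++ y)).map Prod.snd) (hx : x.map Prod.fst = x')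
    (hy : y.map Prod.fst = y') {ε : List M} (hε : ε = [])
    (hY : Y = x' ++ (ε ++ y')) (hY' : Y' = x' ++ (κ ++ y')) (u : tw ε ⟶ tw κ)
    (hu : κ = [] → ∃ e : ε = κ, u = eqToHom (congrArg tw e)) :
    IsDiagram bot (x ++ (label b κ ++ y)) (f ≫ lay hY hY' u) := by
  subst hε
  by_cases h0 : κ = []
  · subst h0
    obtain ⟨-, rfl⟩ := hu rfl
    rw [lay_eqToHom _ _ rfl]
    exact h.cast rfl (by rw [hY, hY']) _ (by simp)
  · obtain ⟨B, l, h1, h2, h3, h4, h5⟩ := h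
    simp only [List.map_append, List.mem_append, not_or] at hb
    have hbl : b ∉ l := by rw [h4]; simpa using hb
    obtain ⟨g1, g2⟩ := update_box (bot := bot) (top := x ++ y) (bot' := bot)
      (top' := x ++ (label b κ ++ y)) u h1 h2
      (fun c hc => rfl)
      (fun c hc => by simp only [block_append, block_label_ne _ hc, List.nil_append])
      (block_eq_nil hb.1)
      (by simp only [block_append, block_label_self, block_eq_nil hb.2.1, block_eq_nil hb.2.2,
        List.append_nil, List.nil_append])
    refine ⟨_, l ++ [b], g1, g2, ?_, ?_, ?_⟩
    · rw [List.nodup_append]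
      exact ⟨h3, by simp, by rintro c hc d hd rfl; simp at hd; exact hbl (hd ▸ hc)⟩
    · intro c
      have h6 := h4 c
      simp only [List.map_append, List.mem_append, List.mem_singleton, mem_map_label] at h6 ⊢
      tauto
    · refine (h5.update hbl ⟨[], κ, u⟩).append ?_
      have e : Function.update B b ⟨[], κ, u⟩ b = ⟨[], κ, u⟩ := Function.update_self _ _ _
      generalize Function.update B b ⟨[], κ, u⟩ = B' at *
      have key : ∀ (β : Box M) (_ : B' b = β) (hY : Y = x' ++ (β.inp ++ y'))
          (hY' : Y' = x' ++ (β.out ++ y')),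
          Path B' [b] (x ++ (label b β.inp ++ y)) (x ++ (label b β.out ++ y))
            (lay hY hY' β.mor) := by
        rintro β rfl hY hY'
        exact Path.single rfl rfl hx hy hY hY'
      exact key _ e hY hY'

theorem IsDiagram.insert_bot {x y top : List (M × ℕ)} {X Y κ x' y' X' : List M}
    {f : tw X ⟶ tw Y} (h : IsDiagram (x ++ y) top f) {b : ℕ}
    (hb : b ∉ ((x ++ y) ++ top).map Prod.snd) (hx : x.map Prod.fst = x')
    (hy : y.map Prod.fst = y') {ε : List M} (hε : ε = [])
    (hX : X = x' ++ (ε ++ y')) (hX' : X' = x' ++ (κ ++ y')) (u : tw κ ⟶ tw ε)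
    (hu : κ = [] → ∃ e : κ = ε, u = eqToHom (congrArg tw e)) :
    IsDiagram (x ++ (label b κ ++ y)) top (lay hX' hX u ≫ f) := by
  subst hε
  by_cases h0 : κ = []
  · subst h0
    obtain ⟨-, rfl⟩ := hu rfl
    rw [lay_eqToHom _ _ rfl]
    exact h.cast (by rw [hX, hX']) rfl _ (by simp)
  · obtain ⟨B, l, h1, h2, h3, h4, h5⟩ := h
    simp only [List.map_append, List.mem_append, not_or] at hb
    have hbl : b ∉ l := by rw [h4]; simpa [and_assoc] using hb
    obtain ⟨g1, g2⟩ := update_box (bot := x ++ y) (top := top) (bot' := x ++ (label b κ ++ y))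
      (top' := top) u h1 h2
      (fun c hc => by simp only [block_append, block_label_ne _ hc, List.nil_append])
      (fun c hc => rfl)
      (by simp only [block_append, block_label_self, block_eq_nil hb.1.1, block_eq_nil hb.1.2,
        List.append_nil, List.nil_append])
      (block_eq_nil hb.2)
    refine ⟨_, b :: l, g1, g2, List.nodup_cons.2 ⟨hbl, h3⟩, ?_, ?_⟩
    · intro c
      have h6 := h4 c
      simp only [List.map_append, List.mem_append, List.mem_cons, mem_map_label] at h6 ⊢
      tauto
    · have h6 := h5.update hbl ⟨κ, [], u⟩
      have e : Function.update B b ⟨κ, [], u⟩ b = ⟨κ, [], u⟩ := Function.update_self _ _ _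
      generalize Function.update B b ⟨κ, [], u⟩ = B' at *
      have key : ∀ (β : Box M) (_ : B' b = β) (hX' : X' = x' ++ (β.inp ++ y'))
          (hX : X = x' ++ (β.out ++ y')) (_ : Path B' l (x ++ (label b β.out ++ y)) top f),
          Path B' (b :: l) (x ++ (label b β.inp ++ y)) top (lay hX' hX β.mor ≫ f) := by
        rintro β rfl hX' hX h
        exact .cons rfl rfl hx hy hX' hX h
      exact key _ e hX' hX h6

end Diagram

/-! ## Non-crossing words -/

/-- One never meets two different labels in the order `a, b, a, b`. -/
def NonCrossing (l : List ℕ) : Prop := ∀ a b : ℕ, [a, b, a, b].Sublist l → a = b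

theorem cons_sublist_append {α : Type*} {b : α} {r p q : List α} (h : (b :: r).Sublist (p ++ q))
    (hb : b ∉ p) : (b :: r).Sublist q := by
  induction p with
  | nil => exact h
  | cons a p ih =>
    rw [List.cons_append] at h
    cases h with
    | cons _ h => exact ih h (fun h' => hb (by simp [h']))
    | cons_cons _ h => exact absurd (by simp) hb

theorem append_sublist_append {α : Type*} {b : α} {r p q : List α}
    (h : (r ++ [b]).Sublist (p ++ q)) (hb : b ∉ q) : (r ++ [b]).Sublist p := by
  have h1 := h.reverse
  rw [List.reverse_append, List.reverse_append] at h1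
  have h2 := cons_sublist_append h1 (by simpa using hb)
  have h3 := h2.reverse
  simpa using h3

theorem sublist_of_notMem {l p m q : List ℕ} (h : l.Sublist (p ++ (m ++ q)))
    (hm : ∀ c ∈ l, c ∉ m) : l.Sublist (p ++ q) := by
  obtain ⟨l₁, l₂, rfl, h1, h2⟩ := List.sublist_append_iff.1 h
  obtain ⟨l₃, l₄, rfl, h3, h4⟩ := List.sublist_append_iff.1 h2
  have e : l₃ = [] := by
    cases l₃ with
    | nil => rfl
    | cons c l₃ => exact absurd (h3.subset (by simp)) (hm c (by simp))
  subst e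
  exact h1.append (by simpa using h4)

theorem not_sandwich {b c : ℕ} {p m q : List ℕ} (hp : b ∉ p) (hq : b ∉ q) (hm : ∀ d ∈ m, d = b)
    (h : [b, c, b].Sublist (p ++ (m ++ q))) : c = b := by
  have h1 := cons_sublist_append h hp
  have h2 := append_sublist_append (r := [b, c]) h1 hq
  exact hm c (h2.subset (by simp))

/-- A run of a fresh label has no other label between its letters, so this label takes no part in an
alternating pattern. -/
theorem NonCrossing.insert {p m q : List ℕ} {b : ℕ} (h : NonCrossing (p ++ q)) (hp : b ∉ p)
    (hq : b ∉ q) (hm : ∀ d ∈ m, d = b) : NonCrossing (p ++ (m ++ q)) := by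
  intro a c hac
  by_cases ha : a = b
  · subst ha
    exact (not_sandwich hp hq hm ((List.take_sublist 3 _).trans hac)).symm
  by_cases hc : c = b
  · subst hc
    exact not_sandwich hp hq hm ((List.drop_sublist 1 _).trans hac)
  refine h a c (sublist_of_notMem hac ?_)
  intro d hd hd'
  have := hm d hd'
  subst this
  simp at hd
  tauto

/-- Around the boundary of the rectangle the two outer runs are adjacent and form one cyclic run of
the fresh label. -/
theorem NonCrossing.wrap {p m q : List ℕ} {b : ℕ} (h : NonCrossing m) (hb : b ∉ m)
    (hp : ∀ d ∈ p, d = b) (hq : ∀ d ∈ q, d = b) : NonCrossing (p ++ (m ++ q)) := by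
  intro a c hac
  by_cases ha : a = b
  · subst ha
    by_contra hne
    have hcq : c ∉ q := fun h => hne (hq c h).symm
    rw [← List.append_assoc] at hac
    have h1 := append_sublist_append (r := [a, c, a]) hac hcq
    have h2 : [a, c, a].Sublist (p ++ m) := (List.take_sublist 3 [a, c, a, c]).trans h1
    have h3 := append_sublist_append (r := [a, c]) h2 hb
    exact hne (hp c (h3.subset (by simp))).symm
  by_cases hc : c = b
  · subst hc
    have hap : a ∉ p := fun h => ha (hp a h)
    have haq : a ∉ q := fun h => ha (hq a h)
    have h1 := cons_sublist_append hac hap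
    have h2 : [a, c, a].Sublist (m ++ q) := (List.take_sublist 3 [a, c, a, c]).trans h1
    have h3 := append_sublist_append (r := [a, c]) h2 haq
    exact absurd (h3.subset (by simp)) hb
  · refine h a c ?_
    have h1 : [a, c, a, c].Sublist (m ++ q) := cons_sublist_append hac (fun h => ha (hp a h))
    exact append_sublist_append (r := [a, c, a]) h1 (fun h => hc (hq c h))

section Labels

variable {C : Type u₁} {D : Type u₂}

theorem labL_append (x y : List ((C ⊕ D) × ℕ)) : labL (x ++ y) = labL x ++ labL y :=
  List.filterMap_append

theorem labR_append (x y : List ((C ⊕ D) × ℕ)) : labR (x ++ y) = labR x ++ labR y :=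
  List.filterMap_append

theorem labL_label (b : ℕ) (x : List (C ⊕ D)) : labL (label b x) = label b (wordL x) := by
  induction x with
  | nil => rfl
  | cons a x ih =>
    obtain c | d := a <;> simpa [labL, wordL, label, List.filterMap_cons] using ih

theorem labR_label (b : ℕ) (x : List (C ⊕ D)) : labR (label b x) = label b (wordR x) := by
  induction x with
  | nil => rfl
  | cons a x ih =>
    obtain c | d := a <;> simpa [labR, wordR, label, List.filterMap_cons] using ih

theorem mem_labL {x : List ((C ⊕ D) × ℕ)} {c : C} {b : ℕ} :
    (c, b) ∈ labL x ↔ (Sum.inl c, b) ∈ x := by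
  induction x with
  | nil => simp [labL]
  | cons a x ih =>
    obtain ⟨c' | d, n⟩ := a <;> simp [labL, List.filterMap_cons] at ih ⊢ <;> simp [ih]

theorem mem_labR {x : List ((C ⊕ D) × ℕ)} {d : D} {b : ℕ} :
    (d, b) ∈ labR x ↔ (Sum.inr d, b) ∈ x := by
  induction x with
  | nil => simp [labR]
  | cons a x ih =>
    obtain ⟨c' | d, n⟩ := a <;> simp [labR, List.filterMap_cons] at ih ⊢ <;> simp [ih]

theorem notMem_labL {x : List ((C ⊕ D) × ℕ)} {b : ℕ} (h : b ∉ x.map Prod.snd) :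
    b ∉ (labL x).map Prod.snd := by
  intro h'
  obtain ⟨⟨c, b'⟩, h1, rfl⟩ := List.mem_map.1 h'
  exact h (List.mem_map.2 ⟨_, mem_labL.1 h1, rfl⟩)

theorem notMem_labR {x : List ((C ⊕ D) × ℕ)} {b : ℕ} (h : b ∉ x.map Prod.snd) :
    b ∉ (labR x).map Prod.snd := by
  intro h'
  obtain ⟨⟨c, b'⟩, h1, rfl⟩ := List.mem_map.1 h'
  exact h (List.mem_map.2 ⟨_, mem_labR.1 h1, rfl⟩)

/-- Letters with the same label have the same colour. -/
def Monochrome (x : List ((C ⊕ D) × ℕ)) : Prop :=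
  ∀ p ∈ x, ∀ q ∈ x, p.2 = q.2 → p.1.isLeft = q.1.isLeft

theorem Monochrome.insert {x y : List ((C ⊕ D) × ℕ)} {κ : List (C ⊕ D)} {b : ℕ}
    (h : Monochrome x) (hκ : Mono κ) (hb : b ∉ x.map Prod.snd)
    (hy : ∀ p ∈ y, p ∈ x ∨ p ∈ label b κ) : Monochrome y := by
  obtain ⟨e, he⟩ := hκ
  have h1 : ∀ p ∈ label b κ, p.2 = b ∧ p.1.isLeft = e := by
    intro p hp
    refine ⟨mem_label hp, he _ ?_⟩
    rw [← map_label b κ]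
    exact List.mem_map_of_mem hp
  have h2 : ∀ p ∈ x, p.2 ≠ b := fun p hp hpb => hb (hpb ▸ List.mem_map_of_mem hp)
  intro p hp q hq hpq
  rcases hy p hp with hp | hp <;> rcases hy q hq with hq | hq
  · exact h p hp q hq hpq
  · exact absurd (hpq.trans (h1 q hq).1) (h2 p hp)
  · exact absurd (hpq.symm.trans (h1 p hp).1) (h2 q hq)
  · rw [(h1 p hp).2, (h1 q hq).2]

end Labels

/-! ### Values of explicitly constructed non-crossing partitions -/

section Realizable

variable {C : Type u₁} [Category.{v₁} C] [Preadditive C] [Linear ℂ C] [MonoidalCategory C]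
  [MonoidalPreadditive C] [MonoidalLinear ℂ C] [StarCategory C] [IsRigidCStarTensorCategory C]
variable {D : Type u₂} [Category.{v₂} D] [Preadditive D] [Linear ℂ D] [MonoidalCategory D]
  [MonoidalPreadditive D] [MonoidalLinear ℂ D] [StarCategory D] [IsRigidCStarTensorCategory D]

/-- `f` and `g` are the values of the two parts of a non-crossing partition. -/
def IsReal {σ τ : List (C ⊕ D)} (f : tL σ ⟶ tL τ) (g : tR σ ⟶ tR τ) : Prop :=
  ∃ bot top : List ((C ⊕ D) × ℕ), bot.map Prod.fst = σ ∧ top.map Prod.fst = τ ∧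
    Monochrome (bot ++ top) ∧ NonCrossing ((bot ++ top.reverse).map Prod.snd) ∧
    IsDiagram (labL bot) (labL top) f ∧ IsDiagram (labR bot) (labR top) g

/-- The linear span of the values of non-crossing partitions. -/
def realHom (σ τ : List (C ⊕ D)) : Submodule ℂ (σ ⟶ τ) :=
  Submodule.span ℂ {z | ∃ (f : tL σ ⟶ tL τ) (g : tR σ ⟶ tR τ), IsReal f g ∧ z = tmulHom f g}

theorem realHom_le (σ τ : List (C ⊕ D)) {z : σ ⟶ τ} (hz : z ∈ realHom σ τ) : z ∈ ncpHom σ τ := by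
  have key : realHom σ τ ≤ (ncpHom σ τ : Submodule ℂ (Amb σ τ)) := by
    refine Submodule.span_le.2 ?_
    rintro _ ⟨f, g, ⟨bot, top, hb, ht, hm, hn, hf, hg⟩, rfl⟩
    obtain ⟨F, hF⟩ := hf.isValue
    obtain ⟨G, hG⟩ := hg.isValue
    refine Submodule.subset_span ⟨⟨bot, top, hb, ht, hm, hn, F, G⟩, f, g,
      ⟨_, hF (tL_eq hb).symm (tL_eq ht), ?_⟩, ⟨_, hG (tR_eq hb).symm (tR_eq ht), ?_⟩, rfl⟩
    · simp
    · simp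
  exact key hz

theorem exists_fresh (x : List ((C ⊕ D) × ℕ)) : ∃ b : ℕ, b ∉ x.map Prod.snd := by
  obtain ⟨b, hb⟩ := Infinite.exists_notMem_finset (x.map Prod.snd).toFinset
  exact ⟨b, by simpa using hb⟩

theorem eq_of_mem_map_label {b d : ℕ} {κ : List (C ⊕ D)} (h : d ∈ (label b κ).map Prod.snd) :
    d = b := (mem_map_label.1 h).1

/-- A leftmost block sits at both ends of the boundary word, which runs along the bottom and returns
along the top. This is why `NonCrossing.wrap` applies. -/
theorem IsReal.cons {σ τ κ κ' ρ ρ₁ ρ' : List (C ⊕ D)} {f : tL σ ⟶ tL τ} {g : tR σ ⟶ tR τ}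
    (h : IsReal f g) (hm : Mono (κ ++ κ')) (h₁ : ρ = [] ++ (κ ++ σ)) (h₂ : ρ₁ = [] ++ (κ' ++ σ))
    (h₃ : ρ₁ = κ' ++ (σ ++ [])) (h₄ : ρ' = κ' ++ (τ ++ [])) (u : tL κ ⟶ tL κ')
    (v : tR κ ⟶ tR κ')
    (hu : wordL κ = [] → wordL κ' = [] → ∃ e : wordL κ = wordL κ', u = eqToHom (congrArg tw e))
    (hv : wordR κ = [] → wordR κ' = [] → ∃ e : wordR κ = wordR κ', v = eqToHom (congrArg tw e)) :
    IsReal (lay (wordL_lay h₁) (wordL_lay h₂) u ≫ lay (wordL_lay h₃) (wordL_lay h₄) f)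
      (lay (wordR_lay h₁) (wordR_lay h₂) v ≫ lay (wordR_lay h₃) (wordR_lay h₄) g) := by
  obtain ⟨bot, top, hb, ht, hm', hn, hf, hg⟩ := h
  obtain ⟨b, hfresh⟩ := exists_fresh (bot ++ top)
  refine ⟨label b κ ++ bot, label b κ' ++ top, by simp [map_label, hb, h₁],
    by simp [map_label, ht, h₄], ?_, ?_, ?_, ?_⟩
  · refine hm'.insert hm hfresh (fun p hp => ?_)
    simp only [label, List.map_append, List.mem_append] at hp ⊢
    tauto
  · have e : ((label b κ ++ bot ++ (label b κ' ++ top).reverse).map Prod.snd) =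
        (label b κ).map Prod.snd ++ ((bot ++ top.reverse).map Prod.snd ++
          ((label b κ').map Prod.snd).reverse) := by simp
    rw [e]
    refine hn.wrap (b := b) ?_ (fun d hd => eq_of_mem_map_label hd)
      (fun d hd => eq_of_mem_map_label (List.mem_reverse.1 hd))
    simp only [List.map_append, List.mem_append, List.map_reverse, List.mem_reverse] at hfresh ⊢
    exact hfresh
  · have h5 := hf.cons (b := b) (by rw [← labL_append]; exact notMem_labL hfresh)
      (wordL_lay h₁) (wordL_lay h₂) (wordL_lay h₃) (wordL_lay h₄) u hu
    rwa [labL_append, labL_append, labL_label, labL_label]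
  · have h5 := hg.cons (b := b) (by rw [← labR_append]; exact notMem_labR hfresh)
      (wordR_lay h₁) (wordR_lay h₂) (wordR_lay h₃) (wordR_lay h₄) v hv
    rwa [labR_append, labR_append, labR_label, labR_label]

/-- A block with top letters only is a single run of the boundary word, so `NonCrossing.insert`
applies wherever it is placed. -/
theorem IsReal.insert_top {σ ρ τ x y κ : List (C ⊕ D)} {f : tL σ ⟶ tL ρ} {g : tR σ ⟶ tR ρ}
    (h : IsReal f g) (hm : Mono κ) (hρ : ρ = x ++ ([] ++ y)) (hτ : τ = x ++ (κ ++ y))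
    (u : tL ([] : List (C ⊕ D)) ⟶ tL κ) (v : tR ([] : List (C ⊕ D)) ⟶ tR κ)
    (hu : wordL κ = [] → ∃ e : wordL [] = wordL κ, u = eqToHom (congrArg tw e))
    (hv : wordR κ = [] → ∃ e : wordR [] = wordR κ, v = eqToHom (congrArg tw e)) :
    IsReal (f ≫ lay (wordL_lay hρ) (wordL_lay hτ) u) (g ≫ lay (wordR_lay hρ) (wordR_lay hτ) v) := by
  obtain ⟨bot, top, hb, ht, hm', hn, hf, hg⟩ := h
  obtain ⟨b, hfresh⟩ := exists_fresh (bot ++ top)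
  obtain ⟨x', y', rfl, hx, hy⟩ := List.map_eq_append_iff.1 (ht.trans hρ)
  rw [List.nil_append] at hy
  have hfresh' := hfresh
  simp only [List.map_append, List.mem_append, not_or] at hfresh
  refine ⟨bot, x' ++ (label b κ ++ y'), hb, by simp [map_label, hx, hy, hτ], ?_, ?_, ?_, ?_⟩
  · refine hm'.insert hm hfresh' (fun p hp => ?_)
    simp only [List.mem_append] at hp ⊢
    tauto
  · have e : ((bot ++ (x' ++ (label b κ ++ y')).reverse).map Prod.snd) =
        (bot.map Prod.snd ++ (y'.map Prod.snd).reverse) ++ (((label b κ).map Prod.snd).reverse ++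
          (x'.map Prod.snd).reverse) := by simp
    rw [e]
    refine NonCrossing.insert (b := b) ?_ ?_ ?_
      (fun d hd => eq_of_mem_map_label (List.mem_reverse.1 hd))
    · simpa using hn
    · simp only [List.mem_append, List.mem_reverse]
      tauto
    · simp only [List.mem_reverse]
      tauto
  · have h5 := hf
    rw [labL_append] at h5
    have h6 := h5.insert_top (b := b) (by
      rw [← labL_append, ← labL_append]; exact notMem_labL hfresh')
      (by rw [map_labL, hx]) (by rw [map_labL, hy]; rfl) rfl (wordL_lay hρ) (wordL_lay hτ) u hu
    rwa [labL_append, labL_append, labL_label]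
  · have h5 := hg
    rw [labR_append] at h5
    have h6 := h5.insert_top (b := b) (by
      rw [← labR_append, ← labR_append]; exact notMem_labR hfresh')
      (by rw [map_labR, hx]) (by rw [map_labR, hy]; rfl) rfl (wordR_lay hρ) (wordR_lay hτ) v hv
    rwa [labR_append, labR_append, labR_label]

theorem IsReal.insert_bot {σ ρ τ x y κ : List (C ⊕ D)} {f : tL ρ ⟶ tL σ} {g : tR ρ ⟶ tR σ}
    (h : IsReal f g) (hm : Mono κ) (hρ : ρ = x ++ ([] ++ y)) (hτ : τ = x ++ (κ ++ y))
    (u : tL κ ⟶ tL ([] : List (C ⊕ D))) (v : tR κ ⟶ tR ([] : List (C ⊕ D)))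
    (hu : wordL κ = [] → ∃ e : wordL κ = wordL [], u = eqToHom (congrArg tw e))
    (hv : wordR κ = [] → ∃ e : wordR κ = wordR [], v = eqToHom (congrArg tw e)) :
    IsReal (lay (wordL_lay hτ) (wordL_lay hρ) u ≫ f) (lay (wordR_lay hτ) (wordR_lay hρ) v ≫ g) := by
  obtain ⟨bot, top, hb, ht, hm', hn, hf, hg⟩ := h
  obtain ⟨b, hfresh⟩ := exists_fresh (bot ++ top)
  obtain ⟨x', y', rfl, hx, hy⟩ := List.map_eq_append_iff.1 (hb.trans hρ)
  rw [List.nil_append] at hy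
  have hfresh' := hfresh
  simp only [List.map_append, List.mem_append, not_or] at hfresh
  refine ⟨x' ++ (label b κ ++ y'), top, by simp [map_label, hx, hy, hτ], ht, ?_, ?_, ?_, ?_⟩
  · refine hm'.insert hm hfresh' (fun p hp => ?_)
    simp only [List.mem_append] at hp ⊢
    tauto
  · have e : ((x' ++ (label b κ ++ y') ++ top.reverse).map Prod.snd) =
        x'.map Prod.snd ++ ((label b κ).map Prod.snd ++
          (y'.map Prod.snd ++ (top.map Prod.snd).reverse)) := by simp
    rw [e]
    refine NonCrossing.insert (b := b) ?_ ?_ ?_ (fun d hd => eq_of_mem_map_label hd)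
    · simpa using hn
    · tauto
    · simp only [List.mem_append, List.mem_reverse]
      tauto
  · have h5 := hf
    rw [labL_append] at h5
    have h6 := h5.insert_bot (b := b) (by
      rw [← labL_append, ← labL_append]; exact notMem_labL hfresh')
      (by rw [map_labL, hx]) (by rw [map_labL, hy]; rfl) rfl (wordL_lay hρ) (wordL_lay hτ) u hu
    rwa [labL_append, labL_append, labL_label]
  · have h5 := hg
    rw [labR_append] at h5
    have h6 := h5.insert_bot (b := b) (by
      rw [← labR_append, ← labR_append]; exact notMem_labR hfresh')
      (by rw [map_labR, hx]) (by rw [map_labR, hy]; rfl) rfl (wordR_lay hρ) (wordR_lay hτ) v hv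
    rwa [labR_append, labR_append, labR_label]

theorem unit_word_scalar {M : Type u} [Category.{v} M] [Preadditive M] [Linear ℂ M]
    [MonoidalCategory M] [MonoidalPreadditive M] [MonoidalLinear ℂ M] [StarCategory M]
    [IsRigidCStarTensorCategory M] {X Y : List M} (hX : X = []) (hY : Y = []) (f : tw X ⟶ tw Y) :
    ∃ c : ℂ, f = c • eqToHom (congrArg tw (hX.trans hY.symm)) := by
  subst hX hY
  exact IsRigidCStarTensorCategory.unit_simple.2 f

theorem wordL_eq_nil {κ : List (C ⊕ D)} : wordL κ = [] ↔ ∀ l ∈ κ, l.isLeft = false := by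
  rw [wordL, List.filterMap_eq_nil_iff]
  refine forall₂_congr fun l _ => ?_
  cases l <;> simp

theorem wordR_eq_nil {κ : List (C ⊕ D)} : wordR κ = [] ↔ ∀ l ∈ κ, l.isLeft = true := by
  rw [wordR, List.filterMap_eq_nil_iff]
  refine forall₂_congr fun l _ => ?_
  cases l <;> simp

/-- For words of one colour the other tensor component is an endomorphism of the unit, hence a
scalar. Moving this scalar across the tensor sign makes that component the canonical identification,
as the constructions of diagrams require. -/
theorem mono_induction {κ κ' : List (C ⊕ D)} (hm : Mono (κ ++ κ')) (h0 : κ ++ κ' ≠ [])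
    {P : (κ ⟶ κ') → Prop} (zero : P 0) (add : ∀ f g, P f → P g → P (f + g))
    (tmul : ∀ (u : tL κ ⟶ tL κ') (v : tR κ ⟶ tR κ'),
      (wordL κ = [] → wordL κ' = [] → ∃ e : wordL κ = wordL κ', u = eqToHom (congrArg tw e)) →
      (wordR κ = [] → wordR κ' = [] → ∃ e : wordR κ = wordR κ', v = eqToHom (congrArg tw e)) →
      P (tmulHom u v)) (f : κ ⟶ κ') : P f := by
  obtain ⟨l, hl⟩ := List.exists_mem_of_ne_nil _ h0
  obtain ⟨b, hb⟩ := hm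
  have h1 : wordL κ = [] → wordL κ' = [] → b = false := by
    intro h h'
    rw [wordL_eq_nil] at h h'
    rw [← hb l hl]
    rcases List.mem_append.1 hl with hl | hl
    · exact h l hl
    · exact h' l hl
  have h2 : wordR κ = [] → wordR κ' = [] → b = true := by
    intro h h'
    rw [wordR_eq_nil] at h h'
    rw [← hb l hl]
    rcases List.mem_append.1 hl with hl | hl
    · exact h l hl
    · exact h' l hl
  induction f using word_induction with
  | zero => exact zero
  | add f g hf hg => exact add f g hf hg
  | tmul u v =>
    cases b with
    | true =>
      have hR : wordR κ = [] := wordR_eq_nil.2 (fun l hl => hb l (by simp [hl]))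
      have hR' : wordR κ' = [] := wordR_eq_nil.2 (fun l hl => hb l (by simp [hl]))
      obtain ⟨c, hc⟩ := unit_word_scalar hR hR' v
      have e : tmulHom u v = tmulHom (c • u) (eqToHom (congrArg tw (hR.trans hR'.symm))) := by
        rw [hc]
        exact (TensorProduct.smul_tmul c u _).symm
      rw [e]
      exact tmul _ _ (fun h h' => absurd (h1 h h') (by simp)) (fun _ _ => ⟨hR.trans hR'.symm, rfl⟩)
    | false =>
      have hL : wordL κ = [] := wordL_eq_nil.2 (fun l hl => hb l (by simp [hl]))
      have hL' : wordL κ' = [] := wordL_eq_nil.2 (fun l hl => hb l (by simp [hl]))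
      obtain ⟨c, hc⟩ := unit_word_scalar hL hL' u
      have e : tmulHom u v = tmulHom (eqToHom (congrArg tw (hL.trans hL'.symm))) (c • v) := by
        rw [hc]
        exact TensorProduct.smul_tmul c _ v
      rw [e]
      exact tmul _ _ (fun _ _ => ⟨hL.trans hL'.symm, rfl⟩) (fun h h' => absurd (h2 h h') (by simp))

end Realizable

/-! ### Gluing two normal forms along a reduced source -/

section RealHom

variable {C : Type u₁} [Category.{v₁} C] [Preadditive C] [Linear ℂ C] [MonoidalCategory C]
  [MonoidalPreadditive C] [MonoidalLinear ℂ C] [StarCategory C] [IsRigidCStarTensorCategory C]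
variable {D : Type u₂} [Category.{v₂} D] [Preadditive D] [Linear ℂ D] [MonoidalCategory D]
  [MonoidalPreadditive D] [MonoidalLinear ℂ D] [StarCategory D] [IsRigidCStarTensorCategory D]

theorem realHom.cons {σ τ κ κ' ρ ρ' : List (C ⊕ D)} {z : σ ⟶ τ} (hz : z ∈ realHom σ τ)
    (hm : Mono (κ ++ κ')) (h0 : κ ++ κ' ≠ []) (h : ρ = κ ++ σ) (h' : ρ' = κ' ++ τ)
    (u : κ ⟶ κ') : wten h h' u z ∈ realHom ρ ρ' := by
  induction hz using Submodule.span_induction with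
  | zero => rw [wten_zero_right]; exact zero_mem _
  | add x y _ _ hx hy => rw [wten_add_right]; exact add_mem hx hy
  | smul c x _ hx => rw [wten_smul_right]; exact Submodule.smul_mem _ c hx
  | mem z hz =>
    obtain ⟨f, g, hr, rfl⟩ := hz
    refine mono_induction (P := fun u => wten h h' u (tmulHom f g) ∈ realHom ρ ρ') hm h0 ?_ (fun a b ha hb => ?_) (fun a b ha hb => ?_) u
    · rw [wten_zero_left]; exact zero_mem _
    · have e : wten h h' (a + b) (tmulHom f g) =
          wten h h' a (tmulHom f g) + wten h h' b (tmulHom f g) := by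
        rw [wten, map_add, Preadditive.add_comp]; rfl
      rw [e]
      exact add_mem ha hb
    · exact Submodule.subset_span ⟨_, _, hr.cons hm h rfl (by simp) (by simp [h']) a b ha hb, rfl⟩

theorem realHom.insert_top {σ ρ τ x y κ : List (C ⊕ D)} {z : σ ⟶ ρ} (hz : z ∈ realHom σ ρ)
    (hm : Mono κ) (h0 : κ ≠ []) (hρ : ρ = x ++ ([] ++ y)) (hτ : τ = x ++ (κ ++ y)) (u : [] ⟶ κ) :
    z ≫ wlay hρ hτ u ∈ realHom σ τ := by
  induction hz using Submodule.span_induction with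
  | zero => rw [Limits.zero_comp]; exact zero_mem _
  | add x y _ _ hx hy => rw [Preadditive.add_comp]; exact add_mem hx hy
  | smul c x _ hx => rw [Linear.smul_comp]; exact Submodule.smul_mem _ c hx
  | mem z hz =>
    obtain ⟨f, g, hr, rfl⟩ := hz
    refine mono_induction (P := fun u => tmulHom f g ≫ wlay hρ hτ u ∈ realHom σ τ)
      (κ := []) hm h0 ?_ (fun a b ha hb => ?_) (fun a b ha hb => ?_) u
    · rw [map_zero, Limits.comp_zero]; exact zero_mem _
    · rw [map_add, Preadditive.comp_add]
      exact add_mem ha hb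
    · exact Submodule.subset_span ⟨_, _, hr.insert_top hm hρ hτ a b (ha rfl) (hb rfl), rfl⟩

theorem realHom.insert_bot {σ ρ τ x y κ : List (C ⊕ D)} {z : ρ ⟶ σ} (hz : z ∈ realHom ρ σ)
    (hm : Mono κ) (h0 : κ ≠ []) (hρ : ρ = x ++ ([] ++ y)) (hτ : τ = x ++ (κ ++ y)) (u : κ ⟶ []) :
    wlay hτ hρ u ≫ z ∈ realHom τ σ := by
  induction hz using Submodule.span_induction with
  | zero => rw [Limits.comp_zero]; exact zero_mem _
  | add x y _ _ hx hy => rw [Preadditive.comp_add]; exact add_mem hx hy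
  | smul c x _ hx => rw [Linear.comp_smul]; exact Submodule.smul_mem _ c hx
  | mem z hz =>
    obtain ⟨f, g, hr, rfl⟩ := hz
    refine mono_induction (P := fun u => wlay hτ hρ u ≫ tmulHom f g ∈ realHom τ σ)
      (κ' := []) (by simpa using hm) (by simpa using h0) ?_
      (fun a b ha hb => ?_) (fun a b ha hb => ?_) u
    · rw [map_zero, Limits.zero_comp]; exact zero_mem _
    · rw [map_add, Preadditive.add_comp]
      exact add_mem ha hb
    · exact Submodule.subset_span
        ⟨_, _, hr.insert_bot hm hρ hτ a b (fun h => ha h rfl) (fun h => hb h rfl), rfl⟩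

theorem id_nil_mem_realHom : 𝟙 ([] : List (C ⊕ D)) ∈ realHom ([] : List (C ⊕ D)) [] := by
  refine Submodule.subset_span ⟨𝟙 _, 𝟙 _, ⟨[], [], rfl, rfl, ?_, ?_, ?_, ?_⟩, rfl⟩
  · intro p hp
    simp at hp
  · intro a b h
    simp at h
  · exact IsDiagram.nil
  · exact IsDiagram.nil

theorem wten_comp {ρ ρ' ρ'' σ σ' σ'' τ τ' τ'' : List (C ⊕ D)} (h : ρ = σ ++ τ) (h' : ρ' = σ' ++ τ')
    (h'' : ρ'' = σ'' ++ τ'') (u : σ ⟶ σ') (f : τ ⟶ τ') (u' : σ' ⟶ σ'') (f' : τ' ⟶ τ'') :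
    wten h h' u f ≫ wten h' h'' u' f' = wten h h'' (u ≫ u') (f ≫ f') := by
  rw [wten.eq_def h' h'', ← Category.assoc,
    wten_comp_left (x := []) (p := []) h h' rfl u f rfl (by simp) (by simp), wlay_nil,
    wten_comp_right (m := []) (y := []) h rfl h'' _ f (by simp) (by simp) (by simp), wlay_nil]

theorem wdag_wten {ρ ρ' σ σ' τ τ' : List (C ⊕ D)} (h : ρ = σ ++ τ) (h' : ρ' = σ' ++ τ')
    (u : σ ⟶ σ') (f : τ ⟶ τ') : wdag (wten h h' u f) = wten h' h (wdag u) (wdag f) := by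
  rw [wten, wdag_comp, wdag_wlay, wdag_wlay, wten]
  exact (wlay_exchange (x := []) (m := []) (y := []) (by simp) (by simp) (by simp) (by simp)
    _ _ _ _ _ _ _ _ _ _).symm

/-- Letter by letter, `wdag u ≫ u'` is one block joining the two images of that letter. The product
is a row of such blocks side by side. -/
theorem Base.wdag_comp_mem {w σ τ : List (C ⊕ D)} {f : w ⟶ σ} {g : w ⟶ τ} (hf : Base f)
    (hg : Base g) : wdag f ≫ g ∈ realHom σ τ := by
  induction hf generalizing τ with
  | nil =>
    -- The empty source is made a variable with an equation so that `Base` can be analysed by cases.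
    have key : ∀ (w τ : List (C ⊕ D)) (g : w ⟶ τ), Base g → ∀ h : w = [],
        eqToHom h.symm ≫ g ∈ realHom [] τ := by
      intro w τ g hg h
      cases hg with
      | nil =>
        rw [eqToHom_refl, Category.comp_id]
        exact id_nil_mem_realHom
      | cons _ _ _ _ _ hw => simp [hw] at h
    rw [wdag_id]
    exact key _ _ g hg rfl
  | @cons w σ w' σ' κ l u f hf hm hκ hw' hσ' ih =>
    cases hg with
    | nil => simp at hw'
    | @cons w₂ τ _ τ' κ' l' u' f' hf' hm' hκ' hw₂ hτ' =>
      have e := hw'.symm.trans hw₂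
      simp only [List.singleton_append, List.cons.injEq] at e
      obtain ⟨rfl, rfl⟩ := e
      rw [wdag_wten, wten_comp]
      refine realHom.cons (ih hf') ?_ (by simp [hκ]) _ _ _
      obtain ⟨b, hb⟩ := hm
      obtain ⟨b', hb'⟩ := hm'
      have e : b = b' := (hb l (by simp)).symm.trans (hb' l (by simp))
      subst e
      refine ⟨b, fun k hk => ?_⟩
      rcases List.mem_append.1 hk with hk | hk
      · exact hb k (by simp [hk])
      · exact hb' k (by simp [hk])

/-- Insertions in `g` contribute blocks with top letters only, and insertions in `f`, after taking
adjoints, blocks with bottom letters only. -/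
theorem Fan.wdag_comp_mem {w σ τ : List (C ⊕ D)} {f : w ⟶ σ} {g : w ⟶ τ} (hf : Fan f)
    (hg : Fan g) : wdag f ≫ g ∈ realHom σ τ := by
  induction hf with
  | zero => rw [wdag_zero, Limits.zero_comp]; exact zero_mem _
  | add f f' _ _ h h' => rw [wdag_add, Preadditive.add_comp]; exact add_mem h h'
  | smul c f _ h => rw [wdag_smul, Linear.smul_comp]; exact Submodule.smul_mem _ _ h
  | ins f _ hρ hτ hm hκ u h =>
    rw [wdag_comp, wdag_wlay, Category.assoc]
    exact realHom.insert_bot h hm hκ _ _ _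
  | base f hf =>
    induction hg with
    | base g hg => exact hf.wdag_comp_mem hg
    | zero => rw [Limits.comp_zero]; exact zero_mem _
    | add g g' _ _ h h' => rw [Preadditive.comp_add]; exact add_mem h h'
    | smul c g _ h => rw [Linear.comp_smul]; exact Submodule.smul_mem _ _ h
    | ins g _ hρ hτ hm hκ u h =>
      rw [← Category.assoc]
      exact realHom.insert_top h hm hκ _ _ _

end RealHom

/-! ### Decomposition of words into reduced words -/

section Thru

variable {C : Type u₁} [Category.{v₁} C] [Preadditive C] [Linear ℂ C] [MonoidalCategory C]
  [MonoidalPreadditive C] [MonoidalLinear ℂ C] [StarCategory C] [IsRigidCStarTensorCategory C]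
variable {D : Type u₂} [Category.{v₂} D] [Preadditive D] [Linear ℂ D] [MonoidalCategory D]
  [MonoidalPreadditive D] [MonoidalLinear ℂ D] [StarCategory D] [IsRigidCStarTensorCategory D]
variable (IC : Set C) (ID : Set D)

/-- The sums of planar morphisms which factor through reduced words. -/
inductive Thru : ∀ {σ τ : List (C ⊕ D)}, (σ ⟶ τ) → Prop
  | comp {σ w τ : List (C ⊕ D)} (f : σ ⟶ w) (g : w ⟶ τ) (hf : Planar f) (hg : Planar g)
      (hw : Reduced IC ID w) : Thru (f ≫ g)
  | zero (σ τ : List (C ⊕ D)) : Thru (0 : σ ⟶ τ)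
  | add {σ τ : List (C ⊕ D)} (f g : σ ⟶ τ) (hf : Thru f) (hg : Thru g) : Thru (f + g)

variable {IC ID}

theorem Thru.comp_planar {σ ρ τ : List (C ⊕ D)} {f : σ ⟶ ρ} {g : ρ ⟶ τ} (hf : Thru IC ID f)
    (hg : Planar g) : Thru IC ID (f ≫ g) := by
  induction hf with
  | comp f f' hf hf' hw => rw [Category.assoc]; exact .comp _ _ hf (hf'.comp hg) hw
  | zero => rw [Limits.zero_comp]; exact .zero _ _
  | add f f' _ _ ih ih' => rw [Preadditive.add_comp]; exact .add _ _ (ih hg) (ih' hg)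

theorem Thru.planar_comp {σ ρ τ : List (C ⊕ D)} {f : σ ⟶ ρ} {g : ρ ⟶ τ} (hf : Planar f)
    (hg : Thru IC ID g) : Thru IC ID (f ≫ g) := by
  induction hg with
  | comp g g' hg hg' hw => rw [← Category.assoc]; exact .comp _ _ (hf.comp hg) hg' hw
  | zero => rw [Limits.comp_zero]; exact .zero _ _
  | add g g' _ _ ih ih' => rw [Preadditive.comp_add]; exact .add _ _ ih ih'

theorem Thru.id_of_reduced {w : List (C ⊕ D)} (hw : Reduced IC ID w) : Thru IC ID (𝟙 w) := by
  have h := Thru.comp (𝟙 w) (𝟙 w) (.id _) (.id _) hw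
  rwa [Category.comp_id] at h

/-- Every object is a sum of units and of representatives of the other simple objects. -/
theorem id_mem_closure {M : Type u} [Category.{v} M] [Preadditive M] [Linear ℂ M]
    [MonoidalCategory M] [MonoidalPreadditive M] [MonoidalLinear ℂ M] [StarCategory M]
    [IsRigidCStarTensorCategory M] {I : Set M} (hI : IsNonunitSimpleReps I) (X : M) :
    𝟙 X ∈ AddSubmonoid.closure {g : X ⟶ X | ∃ (t : List M) (p : X ⟶ tw t) (i : tw t ⟶ X),
      (t = [] ∨ ∃ Y ∈ I, t = [Y]) ∧ g = p ≫ i} := by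
  obtain ⟨n, S, Z, hS, ⟨i, -, -, hi⟩, ⟨e⟩⟩ :=
    (IsRigidCStarTensorCategory.semisimple (C := M)).decomposition X
  have h : 𝟙 X = ∑ k, (e.hom ≫ dag (i k)) ≫ (i k ≫ e.inv) := by
    calc 𝟙 X = e.hom ≫ 𝟙 Z ≫ e.inv := by simp
      _ = _ := by
        rw [← hi, Preadditive.sum_comp, Preadditive.comp_sum]
        simp only [Category.assoc]
  rw [h]
  refine sum_mem fun k _ => AddSubmonoid.subset_closure ?_
  by_cases hu : IsEmpty (S k ≅ 𝟙_ M)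
  · obtain ⟨Y, hY, ⟨a⟩⟩ := hI.complete (S k) (hS k) hu
    have a' : S k ≅ tw [Y] := a ≪≫ (ρ_ Y).symm
    exact ⟨[Y], (e.hom ≫ dag (i k)) ≫ a'.hom, a'.inv ≫ i k ≫ e.inv, Or.inr ⟨Y, hY, rfl⟩,
      by simp⟩
  · rw [not_isEmpty_iff] at hu
    obtain ⟨a⟩ := hu
    have a' : S k ≅ tw ([] : List M) := a
    exact ⟨[], (e.hom ≫ dag (i k)) ≫ a'.hom, a'.inv ≫ i k ≫ e.inv, Or.inl rfl, by simp⟩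

theorem tmulHom_comp_id {κ t : List (C ⊕ D)} (h : wordR κ = wordR t) (p : tL κ ⟶ tL t)
    (i : tL t ⟶ tL κ) : tmulHom (p ≫ i) (𝟙 (tR κ)) =
      tmulHom p (eqToHom (congrArg tw h)) ≫ tmulHom i (eqToHom (congrArg tw h.symm)) := by
  rw [tmulHom_comp]
  simp

theorem tmulHom_id_comp {κ t : List (C ⊕ D)} (h : wordL κ = wordL t) (p : tR κ ⟶ tR t)
    (i : tR t ⟶ tR κ) : tmulHom (𝟙 (tL κ)) (p ≫ i) =
      tmulHom (eqToHom (congrArg tw h)) p ≫ tmulHom (eqToHom (congrArg tw h.symm)) i := by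
  rw [tmulHom_comp]
  simp

theorem Thru.wlay_comp {κ t x y : List (C ⊕ D)} (h : Thru IC ID (𝟙 (x ++ (t ++ y))))
    (hm : Mono (κ ++ t)) (p : κ ⟶ t) (i : t ⟶ κ) :
    Thru IC ID (wlay (rfl : x ++ (κ ++ y) = _) rfl (p ≫ i)) := by
  rw [AnnularFreeProduct.wlay_comp rfl (rfl : x ++ (t ++ y) = _) rfl]
  have h1 := (h.planar_comp (Planar.wlay rfl rfl hm p)).comp_planar
    (Planar.wlay (rfl : x ++ (t ++ y) = _) rfl hm.symm i)
  rwa [Category.comp_id] at h1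

/-- The tensor product of the letters of `κ` decomposes into units and simple letters of the same
colour, so it suffices to treat `κ` replaced by the empty word or by one such letter. -/
theorem Thru.id_of_mono (hIC : IsNonunitSimpleReps IC) (hID : IsNonunitSimpleReps ID)
    {x κ y : List (C ⊕ D)} {b : Bool} (hκ : ∀ l ∈ κ, l.isLeft = b)
    (h : ∀ l : C ⊕ D, Sum.elim (fun c => c ∈ IC) (fun d => d ∈ ID) l → l.isLeft = b →
      Thru IC ID (𝟙 (x ++ ([l] ++ y))))
    (h' : Thru IC ID (𝟙 (x ++ ([] ++ y)))) : Thru IC ID (𝟙 (x ++ (κ ++ y))) := by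
  rw [← wlay_id (rfl : x ++ (κ ++ y) = _), ← tmulHom_id]
  cases b with
  | true =>
    have hR : wordR κ = [] := wordR_eq_nil.2 hκ
    have key := id_mem_closure hIC (tL κ)
    generalize 𝟙 (tL κ) = φ at key ⊢
    induction key using AddSubmonoid.closure_induction with
    | zero =>
      have e : tmulHom (0 : tL κ ⟶ tL κ) (𝟙 (tR κ)) = 0 := TensorProduct.zero_tmul _ _
      rw [e, map_zero]
      exact .zero _ _
    | add f g _ _ hf hg =>
      have e : tmulHom (f + g) (𝟙 (tR κ)) = tmulHom f (𝟙 (tR κ)) + tmulHom g (𝟙 (tR κ)) :=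
        TensorProduct.add_tmul _ _ _
      rw [e, map_add]
      exact .add _ _ hf hg
    | mem f hf =>
      obtain ⟨t, p, i, rfl | ⟨Y, hY, rfl⟩, rfl⟩ := hf
      · rw [show tmulHom (p ≫ i) (𝟙 (tR κ)) = _ from tmulHom_comp_id (t := []) hR p i]
        exact h'.wlay_comp ⟨true, by simpa using hκ⟩ _ _
      · rw [show tmulHom (p ≫ i) (𝟙 (tR κ)) = _ from tmulHom_comp_id (t := [.inl Y]) hR p i]
        refine (h (.inl Y) hY rfl).wlay_comp ⟨true, fun l hl => ?_⟩ _ _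
        rcases List.mem_append.1 hl with hl | hl
        · exact hκ l hl
        · rw [List.mem_singleton.1 hl]; rfl
  | false =>
    have hL : wordL κ = [] := wordL_eq_nil.2 hκ
    have key := id_mem_closure hID (tR κ)
    generalize 𝟙 (tR κ) = φ at key ⊢
    induction key using AddSubmonoid.closure_induction with
    | zero =>
      have e : tmulHom (𝟙 (tL κ)) (0 : tR κ ⟶ tR κ) = 0 := TensorProduct.tmul_zero _ _
      rw [e, map_zero]
      exact .zero _ _
    | add f g _ _ hf hg =>
      have e : tmulHom (𝟙 (tL κ)) (f + g) = tmulHom (𝟙 (tL κ)) f + tmulHom (𝟙 (tL κ)) g :=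
        TensorProduct.tmul_add _ _ _
      rw [e, map_add]
      exact .add _ _ hf hg
    | mem f hf =>
      obtain ⟨t, p, i, rfl | ⟨Y, hY, rfl⟩, rfl⟩ := hf
      · rw [show tmulHom (𝟙 (tL κ)) (p ≫ i) = _ from tmulHom_id_comp (t := []) hL p i]
        exact h'.wlay_comp ⟨false, by simpa using hκ⟩ _ _
      · rw [show tmulHom (𝟙 (tL κ)) (p ≫ i) = _ from tmulHom_id_comp (t := [.inr Y]) hL p i]
        refine (h (.inr Y) hY rfl).wlay_comp ⟨false, fun l hl => ?_⟩ _ _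
        rcases List.mem_append.1 hl with hl | hl
        · exact hκ l hl
        · rw [List.mem_singleton.1 hl]; rfl

theorem Reduced.cons {l : C ⊕ D} {w : List (C ⊕ D)} (hw : Reduced IC ID w)
    (hl : Sum.elim (fun c => c ∈ IC) (fun d => d ∈ ID) l)
    (h : ∀ l' ∈ w.head?, l.isLeft ≠ l'.isLeft) : Reduced IC ID (l :: w) := by
  refine ⟨fun k hk => ?_, List.isChain_cons.2 ⟨h, hw.2⟩⟩
  rcases List.mem_cons.1 hk with rfl | hk
  · exact hl
  · exact hw.1 k hk

/-- If the colours at the junction differ, `l` alone is decomposed. If they agree, `l` is first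
merged with the first letter of `w`. In both cases each summand is reduced. -/
theorem Thru.id_cons (hIC : IsNonunitSimpleReps IC) (hID : IsNonunitSimpleReps ID) (l : C ⊕ D)
    {w : List (C ⊕ D)} (hw : Reduced IC ID w) : Thru IC ID (𝟙 (l :: w)) := by
  by_cases h : ∀ l' ∈ w.head?, l.isLeft ≠ l'.isLeft
  · refine Thru.id_of_mono hIC hID (x := []) (κ := [l]) (y := w) (b := l.isLeft) (by simp)
      (fun s hs hsl => .id_of_reduced (hw.cons hs ?_)) (.id_of_reduced hw)
    rwa [hsl]
  · push Not at h
    obtain ⟨l', hl', hll'⟩ := h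
    obtain ⟨w, rfl⟩ : ∃ w', w = l' :: w' := by
      cases w with
      | nil => simp at hl'
      | cons a w => exact ⟨w, by simpa using hl'⟩
    refine Thru.id_of_mono hIC hID (x := []) (κ := [l, l']) (y := w) (b := l.isLeft)
      (by simp [hll']) (fun s hs hsl => .id_of_reduced (Reduced.cons ?_ hs ?_))
      (.id_of_reduced ?_)
    · exact Reduced.of_append_right (x := [l']) hw
    · rw [hsl, hll']
      exact (List.isChain_cons.1 hw.2).1
    · exact Reduced.of_append_right (x := [l']) hw

theorem Thru.cons (hIC : IsNonunitSimpleReps IC) (hID : IsNonunitSimpleReps ID) (l : C ⊕ D)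
    {σ τ : List (C ⊕ D)} {f : σ ⟶ τ} (hf : Thru IC ID f) (h : l :: σ = [l] ++ (σ ++ []))
    (h' : l :: τ = [l] ++ (τ ++ [])) : Thru IC ID (wlay h h' f) := by
  induction hf with
  | @comp w τ f g hf hg hw =>
    rw [AnnularFreeProduct.wlay_comp h (show l :: w = [l] ++ (w ++ []) by simp) h']
    have h1 := ((Thru.id_cons hIC hID l hw).planar_comp (hf.whisker h (by simp))).comp_planar
      (hg.whisker (show l :: w = [l] ++ (w ++ []) by simp) h')
    rwa [Category.comp_id] at h1
  | zero => rw [map_zero]; exact .zero _ _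
  | add f g _ _ ih ih' => rw [map_add]; exact .add _ _ (ih h') (ih' h')

theorem Thru.id (hIC : IsNonunitSimpleReps IC) (hID : IsNonunitSimpleReps ID)
    (σ : List (C ⊕ D)) : Thru IC ID (𝟙 σ) := by
  induction σ with
  | nil => exact .id_of_reduced .nil
  | cons l σ ih =>
    have h := ih.cons hIC hID l (by simp) (by simp)
    rwa [wlay_id] at h

theorem Thru.exists_ne_zero {σ τ σ' τ' : List (C ⊕ D)} {f : σ ⟶ τ} (hf : Thru IC ID f)
    {p : σ' ⟶ σ} {q : τ ⟶ τ'} (h0 : p ≫ f ≫ q ≠ 0) :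
    ∃ (w : List (C ⊕ D)) (a : σ ⟶ w) (b : w ⟶ τ), Reduced IC ID w ∧ Planar a ∧ Planar b ∧
      p ≫ (a ≫ b) ≫ q ≠ 0 := by
  induction hf with
  | @comp w τ f g hf hg hw => exact ⟨w, f, g, hw, hf, hg, h0⟩
  | zero => exact absurd (by rw [Limits.zero_comp, Limits.comp_zero]) h0
  | add f g _ _ ih ih' =>
    by_cases hf0 : p ≫ f ≫ q = 0
    · exact ih' (fun hg => h0 (by
        rw [Preadditive.add_comp, Preadditive.comp_add, hf0, hg, add_zero]))
    · exact ih hf0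

/-- After factoring through a reduced word `w`, the two halves become a pair of planar morphisms out
of `w`, one of them by taking its adjoint, and both have normal forms. -/
theorem Planar.mem_realHom (hIC : IsNonunitSimpleReps IC) (hID : IsNonunitSimpleReps ID)
    {σ τ : List (C ⊕ D)} {f : σ ⟶ τ} (hf : Planar f) : f ∈ realHom σ τ := by
  have h := (Thru.id hIC hID σ).comp_planar hf
  rw [Category.id_comp] at h
  clear hf
  induction h with
  | comp f g hf hg hw =>
    rw [← wdag_wdag f]
    exact (hf.dag.fan hIC hID hw).wdag_comp_mem (hg.fan hIC hID hw)
  | zero => exact zero_mem _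
  | add f g _ _ ih ih' => exact add_mem ih ih'

end Thru

/-! ## Drawing a box first -/

section Front

/-- Two runs in one word without common letters lie on different sides of each other, except that an
empty run may sit strictly inside the other one. -/
theorem run_cases {L : Type*} {x₀ s y₀ x r y : List L} (h : x₀ ++ (s ++ y₀) = x ++ (r ++ y))
    (hd : ∀ p ∈ s, p ∉ r) (hr : r ≠ []) :
    (∃ m, x = x₀ ++ (s ++ m) ∧ y₀ = m ++ (r ++ y)) ∨
      (∃ m, x₀ = x ++ (r ++ m) ∧ y = m ++ (s ++ y₀)) ∨
      (s = [] ∧ ∃ r₁ r₂, r₁ ≠ [] ∧ r₂ ≠ [] ∧ r = r₁ ++ r₂ ∧ x₀ = x ++ r₁ ∧ y₀ = r₂ ++ y) := by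
  rcases List.append_eq_append_iff.1 h with ⟨a, h1, h2⟩ | ⟨a, h1, h2⟩
  · rcases List.append_eq_append_iff.1 h2 with ⟨b, h3, h4⟩ | ⟨b, h3, h4⟩
    · exact Or.inl ⟨b, by rw [h1, h3], h4⟩
    · cases b with
      | nil => exact Or.inl ⟨[], by simp [h1, h3], by simpa using h4.symm⟩
      | cons p b =>
        obtain ⟨q, r, rfl⟩ := List.exists_cons_of_ne_nil hr
        simp only [List.cons_append, List.cons.injEq] at h4
        exact absurd (by simp [h4.1]) (hd p (by simp [h3]))
  · rcases List.append_eq_append_iff.1 h2 with ⟨b, h3, h4⟩ | ⟨b, h3, h4⟩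
    · exact Or.inr (Or.inl ⟨b, by rw [h1, h3], h4⟩)
    · cases s with
      | nil =>
        by_cases ha : a = []
        · subst ha
          exact Or.inl ⟨[], by simp [h1], by simpa [h3] using h4⟩
        by_cases hb : b = []
        · subst hb
          exact Or.inr (Or.inl ⟨[], by simp [h1, h3], by simpa using h4.symm⟩)
        · exact Or.inr (Or.inr ⟨rfl, a, b, ha, hb, h3, h1, h4⟩)
      | cons p s =>
        cases b with
        | nil => exact Or.inr (Or.inl ⟨[], by simp [h1, h3], by simpa using h4.symm⟩)
        | cons q b =>
          simp only [List.cons_append, List.cons.injEq] at h4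
          exact absurd (by simp [h3, h4.1]) (hd p (by simp))

variable {M : Type u} [Category.{v} M] [Preadditive M] [Linear ℂ M] [MonoidalCategory M]
  [MonoidalPreadditive M] [MonoidalLinear ℂ M]

theorem label_eq_nil {L : Type*} {b : ℕ} {x : List L} : label b x = [] ↔ x = [] := by
  simp [label]

theorem notMem_of_block_eq_nil {L : Type*} {x : List (L × ℕ)} {b : ℕ} (h : block x b = []) :
    b ∉ x.map Prod.snd := by
  intro hb
  obtain ⟨p, hp, rfl⟩ := List.mem_map.1 hb
  simpa using List.filter_eq_nil_iff.1 h p hp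

theorem block_run {L : Type*} {x y : List (L × ℕ)} {κ : List L} {b : ℕ}
    (h : block (x ++ (label b κ ++ y)) b = label b κ) :
    b ∉ x.map Prod.snd ∧ b ∉ y.map Prod.snd := by
  rw [block_append, block_append, block_label_self] at h
  have h1 := congrArg List.length h
  simp only [List.length_append] at h1
  exact ⟨notMem_of_block_eq_nil (List.length_eq_zero_iff.1 (by omega)),
    notMem_of_block_eq_nil (List.length_eq_zero_iff.1 (by omega))⟩

theorem block_replace {L : Type*} (x y : List (L × ℕ)) (κ κ' : List L) {b c : ℕ} (h : c ≠ b) :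
    block (x ++ (label b κ ++ y)) c = block (x ++ (label b κ' ++ y)) c := by
  simp only [block_append, block_label_ne _ h]

/-- Strings labelled `c` are touched by no remaining box, so they would still separate the inputs of
`b` when `b` is drawn, although these must then be adjacent. -/
theorem Path.not_separated {B : ℕ → Box M} {l : List ℕ} {z z' : List (M × ℕ)} {X Y : List M}
    {f : tw X ⟶ tw Y} (h : Path B l z z' f) {b c : ℕ} (hb : b ∈ l) (hc : c ∉ l)
    (hz : block z b = label b (B b).inp) : ¬ [b, c, b].Sublist (z.map Prod.snd) := by
  induction h with
  | nil h => simp at hb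
  | @cons e l z z₁ z' x y X X₁ Y x' y' hz0 hz₁ hx hy hX hX₁ g hg ih =>
    intro hs
    have hce : c ≠ e := fun h => hc (by simp [h])
    by_cases he : b = e
    · subst he
      rw [hz0] at hz hs
      obtain ⟨h1, h2⟩ := block_run hz
      rw [List.map_append, List.map_append] at hs
      exact hce (not_sandwich h1 h2 (fun d hd => (mem_map_label.1 hd).1) hs)
    · refine ih ((List.mem_cons.1 hb).resolve_left he) (fun h => hc (by simp [h])) ?_ ?_
      · rw [← hz, hz0, hz₁]
        exact block_replace _ _ _ _ he
      · rw [hz0, List.map_append, List.map_append] at hs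
        have h1 := sublist_of_notMem hs (fun d hd hd' => by
          have := (mem_map_label.1 hd').1
          subst this
          simp only [List.mem_cons, List.not_mem_nil, or_false] at hd
          rcases hd with h | h | h
          · exact he h.symm
          · exact hce h.symm
          · exact he h.symm)
        refine h1.trans ?_
        rw [hz₁, List.map_append, List.map_append]
        exact (List.Sublist.refl _).append (List.sublist_append_right _ _)

/-- A box whose inputs are adjacent can be drawn first. -/
theorem Path.front {B : ℕ → Box M} {l : List ℕ} {z z' : List (M × ℕ)} {X Y : List M}
    {f : tw X ⟶ tw Y} (h : Path B l z z' f) (hl : l.Nodup)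
    (hne : ∀ c ∈ l, (B c).inp ≠ [] ∨ (B c).out ≠ []) {b : ℕ} (hb : b ∈ l)
    {x y : List (M × ℕ)} (hz : z = x ++ (label b (B b).inp ++ y))
    (hbl : block z b = label b (B b).inp) (h0 : (B b).inp ≠ []) {x' y' X₁ : List M}
    (hx : x.map Prod.fst = x') (hy : y.map Prod.fst = y') (hX : X = x' ++ ((B b).inp ++ y'))
    (hX₁ : X₁ = x' ++ ((B b).out ++ y')) :
    ∃ f' : tw X₁ ⟶ tw Y, f = lay hX hX₁ (B b).mor ≫ f' ∧
      Path B (l.erase b) (x ++ (label b (B b).out ++ y)) z' f' := by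
  induction h generalizing x y x' y' X₁ with
  | nil h => simp at hb
  | @cons e l z z₁ z' x₀ y₀ X X₂ Y x₀' y₀' hz0 hz₁ hx₀ hy₀ hX₀ hX₂ g hg ih =>
    rw [List.nodup_cons] at hl
    by_cases he : b = e
    · subst he
      rw [List.erase_cons_head]
      have h1 := hz0.symm.trans hz
      have hbl' := hbl
      rw [hz] at hbl
      rw [hz0] at hbl'
      obtain ⟨h2, h3⟩ := block_run hbl
      obtain ⟨h4, h5⟩ := block_run hbl'
      -- All letters with label `b` form this one nonempty run, so its position is determined.
      have key : x₀ = x ∧ y₀ = y := by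
        rcases List.append_eq_append_iff.1 h1 with ⟨a, h6, h7⟩ | ⟨a, h6, h7⟩
        · cases a with
          | nil => simpa [h6] using h7
          | cons p a =>
            obtain ⟨m, κ, hκ⟩ := List.exists_cons_of_ne_nil h0
            rw [hκ] at h7
            simp only [label, List.map_cons, List.cons_append, List.cons.injEq] at h7
            exact absurd (by simp [h6, ← h7.1]) h2
        · cases a with
          | nil => simpa [h6, eq_comm] using h7
          | cons p a =>
            obtain ⟨m, κ, hκ⟩ := List.exists_cons_of_ne_nil h0
            rw [hκ] at h7
            simp only [label, List.map_cons, List.cons_append, List.cons.injEq] at h7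
            exact absurd (by simp [h6, ← h7.1]) h4
      obtain ⟨rfl, rfl⟩ := key
      subst hx hy hx₀ hy₀ hX₁ hX₂
      refine ⟨g, rfl, ?_⟩
      rwa [← hz₁]
    · have hb' : b ∈ l := (List.mem_cons.1 hb).resolve_left he
      have hel : ¬ e ∈ l := hl.1
      have hbl₁ : block z₁ b = label b (B b).inp := by
        rw [← hbl, hz0, hz₁]
        exact block_replace _ _ _ _ he
      have ih' := @ih hl.2 (fun c hc => hne c (by simp [hc])) hb'
      rw [List.erase_cons_tail (by simpa using fun h => he h.symm)]
      rcases run_cases (hz0.symm.trans hz) (fun p hp hp' => he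
        ((mem_label hp').symm.trans (mem_label hp))) (by rwa [Ne, label_eq_nil]) with
        ⟨m, h1, h2⟩ | ⟨m, h1, h2⟩ | ⟨h1, r₁, r₂, h2, h3, h4, h5, h6⟩
      · have ex : x' = x₀' ++ ((B e).inp ++ m.map Prod.fst) := by
          rw [← hx, h1]; simp [hx₀, map_label]
        have ey : y₀' = m.map Prod.fst ++ ((B b).inp ++ y') := by
          rw [← hy₀, h2]; simp [hy, map_label]
        obtain ⟨f'', hf, hP⟩ := ih' (x := x₀ ++ (label e (B e).out ++ m)) (y := y)
          (x' := x₀' ++ ((B e).out ++ m.map Prod.fst)) (y' := y')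
          (X₁ := (x₀' ++ ((B e).out ++ m.map Prod.fst)) ++ ((B b).out ++ y'))
          (by simp [hz₁, h2]) hbl₁ (by simp [hx₀, map_label]) hy (by simp [hX₂, ey]) rfl
        refine ⟨lay (x := x₀') (y := m.map Prod.fst ++ ((B b).out ++ y')) (by simp [hX₁, ex])
          (by simp) (B e).mor ≫ f'', ?_, ?_⟩
        · rw [hf, ← Category.assoc, ← Category.assoc]
          congr 1
          exact lay_exchange ex rfl ey rfl _ _ _ _ _ _ _ _ _ _
        · exact .cons (x := x₀) (y := m ++ (label b (B b).out ++ y)) (by simp [h1]) rfl hx₀ (by simp [hy, map_label]) _ _ (by simpa using hP)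
      · have ex : x₀' = x' ++ ((B b).inp ++ m.map Prod.fst) := by
          rw [← hx₀, h1]; simp [hx, map_label]
        have ey : y' = m.map Prod.fst ++ ((B e).inp ++ y₀') := by
          rw [← hy, h2]; simp [hy₀, map_label]
        obtain ⟨f'', hf, hP⟩ := ih' (x := x) (y := m ++ (label e (B e).out ++ y₀))
          (x' := x') (y' := m.map Prod.fst ++ ((B e).out ++ y₀'))
          (X₁ := x' ++ ((B b).out ++ (m.map Prod.fst ++ ((B e).out ++ y₀'))))
          (by simp [hz₁, h1]) hbl₁ hx (by simp [hy₀, map_label]) (by simp [hX₂, ex]) rfl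
        refine ⟨lay (x := x' ++ ((B b).out ++ m.map Prod.fst)) (y := y₀') (by simp [hX₁, ey])
          (by simp) (B e).mor ≫ f'', ?_, ?_⟩
        · rw [hf, ← Category.assoc, ← Category.assoc]
          congr 1
          exact (lay_exchange ex rfl ey rfl _ _ _ _ _ _ _ _ _ _).symm
        · exact .cons (x := x ++ (label b (B b).out ++ m)) (y := y₀) (by simp [h2]) rfl
            (by simp [hx, map_label]) hy₀ _ _ (by simpa using hP)
      -- Box `e` has no inputs and would be created between two inputs of `b`. Its outputs exist and
      -- are never used again, so they would separate these inputs for good.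
      · exfalso
        refine hg.not_separated hb' hel hbl₁ ?_
        have hout : (B e).out ≠ [] :=
          (hne e (by simp)).resolve_left (fun h => h (label_eq_nil.1 h1))
        have e1 : b ∈ r₁.map Prod.snd := by
          obtain ⟨p, hp⟩ := List.exists_mem_of_ne_nil _ h2
          exact List.mem_map.2 ⟨p, hp, mem_label (x := (B b).inp) (by rw [h4]; simp [hp])⟩
        have e2 : b ∈ r₂.map Prod.snd := by
          obtain ⟨p, hp⟩ := List.exists_mem_of_ne_nil _ h3
          exact List.mem_map.2 ⟨p, hp, mem_label (x := (B b).inp) (by rw [h4]; simp [hp])⟩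
        have e3 : e ∈ (label e (B e).out).map Prod.snd := mem_map_label.2 ⟨rfl, hout⟩
        rw [hz₁, h5, h6]
        simp only [List.map_append, List.append_assoc]
        refine List.Sublist.trans ?_ (List.sublist_append_right _ _)
        exact (List.singleton_sublist.2 e1).append ((List.singleton_sublist.2 e3).append
          ((List.singleton_sublist.2 e2).trans (List.sublist_append_left _ _)))

/-- The adjoint of a box. -/
def Box.dag [StarCategory M] (β : Box M) : Box M := ⟨β.out, β.inp, StarCategory.dag β.mor⟩

theorem Path.dag [StarCategory M] [IsRigidCStarTensorCategory M] {B : ℕ → Box M} {l : List ℕ}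
    {z z' : List (M × ℕ)} {X Y : List M} {f : tw X ⟶ tw Y} (h : Path B l z z' f) :
    Path (fun b => (B b).dag) l.reverse z' z (StarCategory.dag f) := by
  induction h with
  | nil h =>
    rw [dag_id]
    exact .nil h
  | cons hz hz₁ hx hy hX hX₁ hg ih =>
    rw [dag_comp, List.reverse_cons, dag_lay]
    exact ih.append (.single hz₁ hz hx hy hX₁ hX)

end Front

/-! ## The values of non-crossing partitions are planar -/

section Runs

/-- The letter `e` is at the first position where some label satisfying `A` occurs for the last
time. All such labels seen earlier therefore still occur at `e` or after it. -/
theorem exists_last_label {L : Type*} (A : ℕ → Prop) {z : List (L × ℕ)}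
    (hz : ∃ b, A b ∧ b ∈ z.map Prod.snd) :
    ∃ p e q, z = p ++ e :: q ∧ A e.2 ∧ e.2 ∉ q.map Prod.snd ∧
      ∀ c ∈ p.map Prod.snd, A c → c ∈ (e :: q).map Prod.snd := by
  induction z with
  | nil => simp at hz
  | cons e z ih =>
    by_cases he : A e.2 ∧ e.2 ∉ z.map Prod.snd
    · exact ⟨[], e, z, rfl, he.1, he.2, by simp⟩
    · have h : ∃ b, A b ∧ b ∈ z.map Prod.snd := by
        obtain ⟨b, hb, hbz⟩ := hz
        rw [List.map_cons, List.mem_cons] at hbz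
        rcases hbz with rfl | hbz
        · exact ⟨_, hb, by_contra fun h => he ⟨hb, h⟩⟩
        · exact ⟨b, hb, hbz⟩
      obtain ⟨p, e', q, rfl, h1, h2, h3⟩ := ih h
      refine ⟨e :: p, e', q, rfl, h1, h2, fun c hc hAc => ?_⟩
      rw [List.map_cons, List.mem_cons] at hc
      rcases hc with rfl | hc
      · have h4 : e.2 ∈ (p ++ e' :: q).map Prod.snd := by_contra fun h => he ⟨hAc, h⟩
        rw [List.map_append, List.mem_append] at h4
        exact h4.elim (fun h => h3 _ h hAc) id
      · exact h3 c hc hAc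

theorem split_first_label {L : Type*} (b : ℕ) {p : List (L × ℕ)}
    (h : ∀ c, c ≠ b → ¬ [b, c].Sublist (p.map Prod.snd)) :
    ∃ x r, p = x ++ r ∧ b ∉ x.map Prod.snd ∧ ∀ q ∈ r, q.2 = b := by
  induction p with
  | nil => exact ⟨[], [], rfl, by simp, by simp⟩
  | cons e p ih =>
    by_cases he : e.2 = b
    · refine ⟨[], e :: p, rfl, by simp, fun q hq => ?_⟩
      rcases List.mem_cons.1 hq with rfl | hq
      · exact he
      · by_contra hne
        refine h _ hne ?_
        rw [List.map_cons, he]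
        exact (List.singleton_sublist.2 (List.mem_map_of_mem hq)).cons_cons _
    · obtain ⟨x, r, rfl, h1, h2⟩ := ih (fun c hc hs => h c hc (hs.cons _))
      exact ⟨e :: x, r, rfl, by simpa [Ne.symm he] using h1, h2⟩

/-- A label of a given kind whose letters are adjacent. -/
theorem exists_run {L : Type*} (A : ℕ → Prop) {z : List (L × ℕ)}
    (hz : ∃ b, A b ∧ b ∈ z.map Prod.snd)
    (h : ∀ b c, A b → b ≠ c → [b, c, b].Sublist (z.map Prod.snd) →
      A c ∧ ¬ [b, c, b, c].Sublist (z.map Prod.snd)) :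
    ∃ b x r y, A b ∧ z = x ++ (r ++ y) ∧ r ≠ [] ∧ (∀ p ∈ r, p.2 = b) ∧ b ∉ x.map Prod.snd ∧
      b ∉ y.map Prod.snd := by
  obtain ⟨p, e, q, rfl, h1, h2, h3⟩ := exists_last_label A hz
  -- A label `c` between two letters labelled `e.2` satisfies `A` and so occurs again after `e`,
  -- giving the forbidden alternating pattern.
  obtain ⟨x, r, rfl, h4, h5⟩ := split_first_label e.2 (p := p) (fun c hc hs => by
    have hs1 : [e.2, c, e.2].Sublist ((p ++ e :: q).map Prod.snd) := by
      rw [List.map_append, List.map_cons]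
      exact List.Sublist.append (l₁ := [e.2, c]) (r₁ := [e.2]) hs (by simp)
    obtain ⟨hA, hn⟩ := h _ c h1 (Ne.symm hc) hs1
    have hcq : c ∈ q.map Prod.snd := by
      have := h3 c (hs.subset (by simp)) hA
      rw [List.map_cons, List.mem_cons] at this
      exact this.resolve_left hc
    refine hn ?_
    rw [List.map_append, List.map_cons]
    exact List.Sublist.append (l₁ := [e.2, c]) (r₁ := [e.2, c]) hs ((List.singleton_sublist.2 hcq).cons_cons _))
  refine ⟨e.2, x, r ++ [e], q, h1, by simp, by simp, fun p hp => ?_, h4, h2⟩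
  rcases List.mem_append.1 hp with hp | hp
  · exact h5 p hp
  · rw [List.mem_singleton.1 hp]

/-- A pattern without equal neighbours uses at most one letter of a constant run, so any nonempty
run serves as well. -/
theorem chain_sublist_replace {b : ℕ} {p r r' q s : List ℕ} (hs : s.IsChain (· ≠ ·))
    (hr : r ≠ []) (hb : ∀ d ∈ r, d = b) (hb' : ∀ d ∈ r', d = b)
    (h : s.Sublist (p ++ (r' ++ q))) : s.Sublist (p ++ (r ++ q)) := by
  obtain ⟨s₁, s₂, rfl, h1, h2⟩ := List.sublist_append_iff.1 h
  obtain ⟨s₂, s₃, rfl, h3, h4⟩ := List.sublist_append_iff.1 h2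
  refine h1.append (List.Sublist.append ?_ h4)
  have hc : s₂.IsChain (· ≠ ·) := (List.isChain_append.1 (List.isChain_append.1 hs).2.1).1
  have h5 : ∀ d ∈ s₂, d = b := fun d hd => hb' d (h3.subset hd)
  match s₂, hc, h5 with
  | [], _, _ => exact List.nil_sublist _
  | [d], _, h5 =>
    obtain ⟨e, r, rfl⟩ := List.exists_cons_of_ne_nil hr
    rw [h5 d (by simp), hb e (by simp)]
    simp
  | d :: d' :: s, hc, h5 =>
    rw [List.isChain_cons_cons] at hc
    exact absurd ((h5 d (by simp)).trans (h5 d' (by simp)).symm) hc.1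

theorem NonCrossing.replace {b : ℕ} {p r r' q : List ℕ} (h : NonCrossing (p ++ (r ++ q)))
    (hr : r ≠ []) (hb : ∀ d ∈ r, d = b) (hb' : ∀ d ∈ r', d = b) :
    NonCrossing (p ++ (r' ++ q)) := by
  intro a c hac
  by_contra hne
  exact hne (h a c (chain_sublist_replace (by simp [hne, Ne.symm hne]) hr hb hb' hac))

theorem NonCrossing.sublist {l l' : List ℕ} (h : NonCrossing l) (hl : l'.Sublist l) :
    NonCrossing l' :=
  fun a b hab => h a b (hab.trans hl)

theorem NonCrossing.reverse {l : List ℕ} (h : NonCrossing l) : NonCrossing l.reverse := by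
  intro a b hab
  have h1 := hab.reverse
  rw [List.reverse_reverse] at h1
  exact (h b a h1).symm

variable {C : Type u₁} {D : Type u₂}

/-- When no boxes remain, the parts of each colour agree, and only the interleaving of the colours
could differ. At the first difference the two leading letters would occur in opposite orders in `z`
and `z'`, producing a crossing between blocks of different colours. -/
theorem eq_of_nonCrossing {z z' : List ((C ⊕ D) × ℕ)} (hL : labL z = labL z')
    (hR : labR z = labR z') (hm : Monochrome (z ++ z'))
    (hn : NonCrossing ((z ++ z'.reverse).map Prod.snd)) : z = z' := by
  have cross : ∀ {p q : (C ⊕ D) × ℕ} {z z' : List ((C ⊕ D) × ℕ)}, Monochrome (p :: z ++ q :: z') →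
      NonCrossing ((p :: z ++ (q :: z').reverse).map Prod.snd) → p ∈ z' → q ∈ z →
      p.1.isLeft = q.1.isLeft := by
    intro p q z z' hm hn hp hq
    refine hm p (by simp) q (by simp) (hn p.2 q.2 ?_)
    rw [List.map_append, List.map_cons, List.reverse_cons, List.map_append]
    have h1 : [p.2, q.2].Sublist (p.2 :: z.map Prod.snd) :=
      (List.singleton_sublist.2 (List.mem_map_of_mem hq)).cons_cons _
    have h2 : [p.2, q.2].Sublist (z'.reverse.map Prod.snd ++ [q].map Prod.snd) :=
      List.Sublist.append (l₁ := [p.2]) (r₁ := [q.2])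
        (List.singleton_sublist.2 (List.mem_map_of_mem (by simpa using hp))) (List.Sublist.refl _)
    exact h1.append h2
  induction z generalizing z' with
  | nil =>
    cases z' with
    | nil => rfl
    | cons q z' => obtain ⟨c | d, b⟩ := q <;> simp [labL, labR] at hL hR
  | cons p z ih =>
    cases z' with
    | nil => obtain ⟨c | d, b⟩ := p <;> simp [labL, labR] at hL hR
    | cons q z' =>
      have tail : labL z = labL z' → labR z = labR z' → z = z' := fun h h' =>
        ih h h' (fun a ha b hb => hm a (by simp at ha ⊢; tauto) b (by simp at hb ⊢; tauto))
          (hn.sublist (List.Sublist.map _ (List.Sublist.append (List.sublist_cons_self _ _)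
            (by rw [List.reverse_cons]; exact List.sublist_append_left _ _))))
      obtain ⟨c | d, a⟩ := p <;> obtain ⟨c' | d', b⟩ := q
      · have e : labL ((Sum.inl c, a) :: z) = (c, a) :: labL z := rfl
        have e' : labL ((Sum.inl c', b) :: z') = (c', b) :: labL z' := rfl
        rw [e, e', List.cons.injEq, Prod.mk.injEq] at hL
        rw [tail hL.2 hR, hL.1.1, hL.1.2]
      · have hp : (c, a) ∈ labL ((Sum.inr d', b) :: z' : List ((C ⊕ D) × ℕ)) := by
          rw [← hL]; exact List.mem_cons_self
        have hq : (d', b) ∈ labR ((Sum.inl c, a) :: z : List ((C ⊕ D) × ℕ)) := by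
          rw [hR]; exact List.mem_cons_self
        have h1 := cross hm hn (by simpa using mem_labL.1 hp) (by simpa using mem_labR.1 hq)
        simp at h1
      · have hp : (d, a) ∈ labR ((Sum.inl c', b) :: z' : List ((C ⊕ D) × ℕ)) := by
          rw [← hR]; exact List.mem_cons_self
        have hq : (c', b) ∈ labL ((Sum.inr d, a) :: z : List ((C ⊕ D) × ℕ)) := by
          rw [hL]; exact List.mem_cons_self
        have h1 := cross hm hn (by simpa using mem_labR.1 hp) (by simpa using mem_labL.1 hq)
        simp at h1
      · have e : labR ((Sum.inr d, a) :: z) = (d, a) :: labR z := rfl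
        have e' : labR ((Sum.inr d', b) :: z') = (d', b) :: labR z' := rfl
        rw [e, e', List.cons.injEq, Prod.mk.injEq] at hR
        rw [tail hL hR.2, hR.1.1, hR.1.2]

end Runs

/-! ### Bookkeeping for the boxes not yet drawn -/

section Active

variable {M : Type u} [Category.{v} M] [Preadditive M] [Linear ℂ M] [MonoidalCategory M]
  [MonoidalPreadditive M] [MonoidalLinear ℂ M]

/-- The boxes in the list `l` remain to be drawn, between the words `z` and `z'`. -/
structure Active (B : ℕ → Box M) (l : List ℕ) (z z' : List (M × ℕ)) : Prop where
  nodup : l.Nodup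
  inp : ∀ b ∈ l, block z b = label b (B b).inp
  out : ∀ b ∈ l, block z' b = label b (B b).out
  ne : ∀ b ∈ l, (B b).inp ≠ [] ∨ (B b).out ≠ []
  rest : ∀ b, b ∉ l → block z b = block z' b

theorem Active.step {B : ℕ → Box M} {l : List ℕ} {z z' x y : List (M × ℕ)} (h : Active B l z z')
    {b : ℕ} (hb : b ∈ l) (hz : z = x ++ (label b (B b).inp ++ y)) :
    Active B (l.erase b) (x ++ (label b (B b).out ++ y)) z' := by
  have hz' := h.inp b hb
  have key : ∀ c, c ≠ b → block (x ++ (label b (B b).out ++ y)) c = block z c := by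
    intro c hc
    rw [hz]
    exact block_replace _ _ _ _ hc
  refine ⟨h.nodup.erase _, fun c hc => ?_, fun c hc => h.out c (List.mem_of_mem_erase hc),
    fun c hc => h.ne c (List.mem_of_mem_erase hc), fun c hc => ?_⟩
  · rw [h.nodup.mem_erase_iff] at hc
    rw [key c hc.1, h.inp c hc.2]
  · by_cases hcb : c = b
    · subst hcb
      rw [hz] at hz'
      obtain ⟨h1, h2⟩ := block_run hz'
      rw [block_append, block_append, block_eq_nil h1, block_eq_nil h2, block_label_self,
        h.out c hb]
      simp
    · rw [key c hcb, h.rest c (fun h' => hc ((h.nodup.mem_erase_iff).2 ⟨hcb, h'⟩))]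

theorem Active.dag [StarCategory M] {B : ℕ → Box M} {l : List ℕ} {z z' : List (M × ℕ)}
    (h : Active B l z z') : Active (fun b => (B b).dag) l.reverse z' z :=
  ⟨List.nodup_reverse.2 h.nodup, fun b hb => h.out b (by simpa using hb),
    fun b hb => h.inp b (by simpa using hb), fun b hb => (h.ne b (by simpa using hb)).symm,
    fun b hb => (h.rest b (by simpa using hb)).symm⟩

theorem Path.eq_of_nil {B : ℕ → Box M} {z z' : List (M × ℕ)} {X Y : List M} {f : tw X ⟶ tw Y}
    (h : Path B [] z z' f) : z = z' ∧ ∃ e : X = Y, f = eqToHom (congrArg tw e) := by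
  cases h with
  | nil h => exact ⟨rfl, rfl, rfl⟩

theorem Path.eqToHom_comp {B : ℕ → Box M} {l : List ℕ} {z z' : List (M × ℕ)} {X X' Y : List M}
    {f : tw X ⟶ tw Y} (h : Path B l z z' f) (e : X' = X) :
    Path B l z z' (eqToHom (congrArg tw e) ≫ f) := by
  subst e
  simpa using h

theorem lay_conj_eqToHom {σ τ x y κ κ' μ μ' : List M} (hκ : κ = μ) (hκ' : μ' = κ')
    (h : σ = x ++ (κ ++ y)) (h' : τ = x ++ (κ' ++ y)) (k : σ = x ++ (μ ++ y))
    (k' : τ = x ++ (μ' ++ y)) (f : tw μ ⟶ tw μ') :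
    lay h h' (eqToHom (congrArg tw hκ) ≫ f ≫ eqToHom (congrArg tw hκ')) = lay k k' f := by
  subst hκ hκ'
  simp

end Active

/-! ### Peeling boxes off a two-coloured diagram -/

section Strip

variable {C : Type u₁} [Category.{v₁} C] [Preadditive C] [Linear ℂ C] [MonoidalCategory C]
  [MonoidalPreadditive C] [MonoidalLinear ℂ C] [StarCategory C] [IsRigidCStarTensorCategory C]
variable {D : Type u₂} [Category.{v₂} D] [Preadditive D] [Linear ℂ D] [MonoidalCategory D]
  [MonoidalPreadditive D] [MonoidalLinear ℂ D] [StarCategory D] [IsRigidCStarTensorCategory D]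

/-- A two-coloured diagram between the labelled words `z` and `z'`: the boxes in the lists `lL` and
`lR` remain to be drawn. -/
structure Strip (BL : ℕ → Box C) (BR : ℕ → Box D) (lL lR : List ℕ) (z z' : List ((C ⊕ D) × ℕ))
    {σ τ : List (C ⊕ D)} (f : tL σ ⟶ tL τ) (g : tR σ ⟶ tR τ) : Prop where
  bot_eq : z.map Prod.fst = σ
  top_eq : z'.map Prod.fst = τ
  monochrome : Monochrome (z ++ z')
  nonCrossing : NonCrossing ((z ++ z'.reverse).map Prod.snd)
  pathL : Path BL lL (labL z) (labL z') f
  pathR : Path BR lR (labR z) (labR z') g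
  activeL : Active BL lL (labL z) (labL z')
  activeR : Active BR lR (labR z) (labR z')

theorem label_injective {L : Type*} {b : ℕ} {x y : List L} (h : label b x = label b y) : x = y := by
  rw [← map_label b x, h, map_label]

theorem mem_labL_of_mem_label {z : List ((C ⊕ D) × ℕ)} {b : ℕ} {κ : List C} {c : C}
    (h : block (labL z) b = label b κ) (hc : c ∈ κ) : (Sum.inl c, b) ∈ z := by
  refine mem_labL.1 (List.mem_of_mem_filter (p := fun p => decide (p.2 = b)) ?_)
  change _ ∈ block (labL z) b
  rw [h]
  exact List.mem_map_of_mem hc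

theorem mem_labR_of_mem_label {z : List ((C ⊕ D) × ℕ)} {b : ℕ} {κ : List D} {d : D}
    (h : block (labR z) b = label b κ) (hd : d ∈ κ) : (Sum.inr d, b) ∈ z := by
  refine mem_labR.1 (List.mem_of_mem_filter (p := fun p => decide (p.2 = b)) ?_)
  change _ ∈ block (labR z) b
  rw [h]
  exact List.mem_map_of_mem hd

theorem wordL_map_inl (κ : List C) : wordL (κ.map Sum.inl : List (C ⊕ D)) = κ := by
  induction κ with
  | nil => rfl
  | cons c κ ih => simpa [wordL] using ih

theorem wordR_map_inl (κ : List C) : wordR (κ.map Sum.inl : List (C ⊕ D)) = [] :=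
  wordR_eq_nil.2 (by simp)

theorem wordR_map_inr (κ : List D) : wordR (κ.map Sum.inr : List (C ⊕ D)) = κ := by
  induction κ with
  | nil => rfl
  | cons c κ ih => simpa [wordR] using ih

theorem wordL_map_inr (κ : List D) : wordL (κ.map Sum.inr : List (C ⊕ D)) = [] :=
  wordL_eq_nil.2 (by simp)

theorem Monochrome.isLeft_eq {x : List ((C ⊕ D) × ℕ)} (h : Monochrome x) {l l' : C ⊕ D} {b : ℕ}
    (hl : (l, b) ∈ x) (hl' : (l', b) ∈ x) : l.isLeft = l'.isLeft :=
  h _ hl _ hl' rfl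

/-- Adjacency in the two-coloured word makes the box a planar layer, and implies adjacency in the
`C`-word, where `Path.front` draws the box first. The `D`-part changes only by a cast. The smaller
diagram stays non-crossing because one run of `b` is replaced by another. -/
theorem Strip.stepL {BL : ℕ → Box C} {BR : ℕ → Box D} {lL lR : List ℕ}
    {z z' : List ((C ⊕ D) × ℕ)} {σ τ : List (C ⊕ D)} {f : tL σ ⟶ tL τ} {g : tR σ ⟶ tR τ}
    (h : Strip BL BR lL lR z z' f g) {b : ℕ} (hb : b ∈ lL) {x r y : List ((C ⊕ D) × ℕ)}
    (hz : z = x ++ (r ++ y)) (hr : r ≠ []) (hrb : ∀ p ∈ r, p.2 = b) (hx : b ∉ x.map Prod.snd)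
    (hy : b ∉ y.map Prod.snd) :
    ∃ (ρ : List (C ⊕ D)) (u : σ ⟶ ρ) (f' : tL ρ ⟶ tL τ) (g' : tR ρ ⟶ tR τ)
      (z₁ : List ((C ⊕ D) × ℕ)), Planar u ∧ tmulHom f g = u ≫ tmulHom f' g' ∧
        Strip BL BR (lL.erase b) lR z₁ z' f' g' := by
  have hr' := label_map hrb
  generalize r.map Prod.fst = κ at hr'
  subst hr'
  have hκ0 : κ ≠ [] := fun h => hr (label_eq_nil.2 h)
  have hκ : ∀ l ∈ κ, l.isLeft = true := by
    have hl : ∀ l ∈ κ, (l, b) ∈ z ++ z' := by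
      intro l hl
      simp only [hz, List.mem_append]
      exact Or.inl (Or.inr (Or.inl (List.mem_map_of_mem hl)))
    have key : ∃ c : C, (Sum.inl c, b) ∈ z ++ z' := by
      rcases h.activeL.ne b hb with h1 | h1
      · obtain ⟨c, hc⟩ := List.exists_mem_of_ne_nil _ h1
        exact ⟨c, List.mem_append_left _ (mem_labL_of_mem_label (h.activeL.inp b hb) hc)⟩
      · obtain ⟨c, hc⟩ := List.exists_mem_of_ne_nil _ h1
        exact ⟨c, List.mem_append_right _ (mem_labL_of_mem_label (h.activeL.out b hb) hc)⟩
    obtain ⟨c, hc⟩ := key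
    exact fun l hl' => h.monochrome.isLeft_eq (hl l hl') hc
  have hzL : labL z = labL x ++ (label b (wordL κ) ++ labL y) := by
    rw [hz, labL_append, labL_append, labL_label]
  have hinp : wordL κ = (BL b).inp := by
    refine label_injective (b := b) ?_
    rw [← h.activeL.inp b hb, hzL, block_append, block_append, block_label_self,
      block_eq_nil (notMem_labL hx), block_eq_nil (notMem_labL hy)]
    simp
  have hout : wordL ((BL b).out.map Sum.inl : List (C ⊕ D)) = (BL b).out := wordL_map_inl _
  have hκR : wordR κ = [] := wordR_eq_nil.2 hκ
  have hoR : wordR ((BL b).out.map Sum.inl : List (C ⊕ D)) = [] := wordR_map_inl _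
  have hol : ∀ l ∈ ((BL b).out.map Sum.inl : List (C ⊕ D)), l.isLeft = true ∧
      (l, b) ∈ z' := by
    intro l hl
    obtain ⟨c, hc, rfl⟩ := List.mem_map.1 hl
    exact ⟨rfl, mem_labL_of_mem_label (h.activeL.out b hb) hc⟩
  generalize ((BL b).out.map Sum.inl : List (C ⊕ D)) = κ' at hout hoR hol
  rw [hinp] at hzL
  have hσ : σ = x.map Prod.fst ++ (κ ++ y.map Prod.fst) := by
    rw [← h.bot_eq, hz]
    simp [map_label]
  obtain ⟨ρ, hρ⟩ : ∃ ρ, ρ = x.map Prod.fst ++ (κ' ++ y.map Prod.fst) := ⟨_, rfl⟩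
  have hσL := wordL_lay hσ
  have hρL := wordL_lay hρ
  have hR : wordR ρ = wordR σ := by rw [wordR_lay hσ, wordR_lay hρ, hκR, hoR]
  obtain ⟨f', hf', hP⟩ := h.pathL.front (X₁ := wordL ρ) h.activeL.nodup h.activeL.ne hb hzL (h.activeL.inp b hb)
    (by rw [← hinp]; intro h0; obtain ⟨l, hl⟩ := List.exists_mem_of_ne_nil _ hκ0; exact absurd ((wordL_eq_nil.1 h0 l hl).symm.trans (hκ l hl)) (by simp))
    (map_labL x) (map_labL y) (by rw [← hinp]; exact hσL) (by rw [← hout]; exact hρL)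
  obtain ⟨z₁, hz₁⟩ : ∃ z₁, z₁ = x ++ (label b κ' ++ y) := ⟨_, rfl⟩
  have hz₁L : labL z₁ = labL x ++ (label b (BL b).out ++ labL y) := by
    rw [hz₁, labL_append, labL_append, labL_label, hout]
  have hz₁R : labR z₁ = labR z := by
    rw [hz₁, hz, labR_append, labR_append, labR_label, labR_append, labR_append, labR_label,
      hκR, hoR]
  have hm : Mono (κ ++ κ') := ⟨true, fun l hl => by
    rcases List.mem_append.1 hl with hl | hl
    · exact hκ l hl
    · exact (hol l hl).1⟩
  refine ⟨ρ, wlay hσ hρ (tmulHom (eqToHom (congrArg tw hinp) ≫ (BL b).mor ≫ eqToHom (congrArg tw hout.symm))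
      (eqToHom (congrArg tw (hκR.trans hoR.symm)))), f', eqToHom (congrArg tw hR) ≫ g, z₁, .wlay _ _ hm _, ?_, ?_, h.top_eq, ?_, ?_, by rwa [hz₁L],
    by rw [hz₁R]; exact h.pathR.eqToHom_comp hR, by rw [hz₁L]; exact h.activeL.step hb hzL,
    by rw [hz₁R]; exact h.activeR⟩
  · rw [wlay_tmulHom, tmulHom_comp, lay_conj_eqToHom hinp hout.symm _ _ (by rw [← hinp]; exact hσL)
      (by rw [← hout]; exact hρL), ← hf', lay_eqToHom _ _ (hκR.trans hoR.symm)]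
    simp
  · rw [hz₁, hρ]
    simp [map_label]
  · intro p hp q hq hpq
    have key : ∀ p ∈ z₁ ++ z', p ∈ z ++ z' := by
      intro p hp
      rw [hz₁] at hp
      rw [hz]
      simp only [List.mem_append] at hp ⊢
      rcases hp with (hp | hp | hp) | hp
      · exact Or.inl (Or.inl hp)
      · obtain ⟨l, hl, rfl⟩ := List.mem_map.1 hp
        exact Or.inr (hol l hl).2
      · exact Or.inl (Or.inr (Or.inr hp))
      · exact Or.inr hp
    exact h.monochrome p (key p hp) q (key q hq) hpq
  · have hn := h.nonCrossing
    rw [hz] at hn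
    rw [hz₁]
    simp only [List.append_assoc, List.map_append] at hn ⊢
    refine hn.replace (b := b) (by simpa using hr) ?_ ?_
    · exact fun d hd => (mem_map_label.1 hd).1
    · exact fun d hd => (mem_map_label.1 hd).1

theorem Strip.stepR {BL : ℕ → Box C} {BR : ℕ → Box D} {lL lR : List ℕ}
    {z z' : List ((C ⊕ D) × ℕ)} {σ τ : List (C ⊕ D)} {f : tL σ ⟶ tL τ} {g : tR σ ⟶ tR τ}
    (h : Strip BL BR lL lR z z' f g) {b : ℕ} (hb : b ∈ lR) {x r y : List ((C ⊕ D) × ℕ)}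
    (hz : z = x ++ (r ++ y)) (hr : r ≠ []) (hrb : ∀ p ∈ r, p.2 = b) (hx : b ∉ x.map Prod.snd)
    (hy : b ∉ y.map Prod.snd) :
    ∃ (ρ : List (C ⊕ D)) (u : σ ⟶ ρ) (f' : tL ρ ⟶ tL τ) (g' : tR ρ ⟶ tR τ)
      (z₁ : List ((C ⊕ D) × ℕ)), Planar u ∧ tmulHom f g = u ≫ tmulHom f' g' ∧
        Strip BL BR lL (lR.erase b) z₁ z' f' g' := by
  have hr' := label_map hrb
  generalize r.map Prod.fst = κ at hr'
  subst hr'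
  have hκ0 : κ ≠ [] := fun h => hr (label_eq_nil.2 h)
  have hκ : ∀ l ∈ κ, l.isLeft = false := by
    have hl : ∀ l ∈ κ, (l, b) ∈ z ++ z' := by
      intro l hl
      simp only [hz, List.mem_append]
      exact Or.inl (Or.inr (Or.inl (List.mem_map_of_mem hl)))
    have key : ∃ c : D, (Sum.inr c, b) ∈ z ++ z' := by
      rcases h.activeR.ne b hb with h1 | h1
      · obtain ⟨c, hc⟩ := List.exists_mem_of_ne_nil _ h1
        exact ⟨c, List.mem_append_left _ (mem_labR_of_mem_label (h.activeR.inp b hb) hc)⟩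
      · obtain ⟨c, hc⟩ := List.exists_mem_of_ne_nil _ h1
        exact ⟨c, List.mem_append_right _ (mem_labR_of_mem_label (h.activeR.out b hb) hc)⟩
    obtain ⟨c, hc⟩ := key
    exact fun l hl' => h.monochrome.isLeft_eq (hl l hl') hc
  have hzL : labR z = labR x ++ (label b (wordR κ) ++ labR y) := by
    rw [hz, labR_append, labR_append, labR_label]
  have hinp : wordR κ = (BR b).inp := by
    refine label_injective (b := b) ?_
    rw [← h.activeR.inp b hb, hzL, block_append, block_append, block_label_self,
      block_eq_nil (notMem_labR hx), block_eq_nil (notMem_labR hy)]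
    simp
  have hout : wordR ((BR b).out.map Sum.inr : List (C ⊕ D)) = (BR b).out := wordR_map_inr _
  have hκR : wordL κ = [] := wordL_eq_nil.2 hκ
  have hoR : wordL ((BR b).out.map Sum.inr : List (C ⊕ D)) = [] := wordL_map_inr _
  have hol : ∀ l ∈ ((BR b).out.map Sum.inr : List (C ⊕ D)), l.isLeft = false ∧
      (l, b) ∈ z' := by
    intro l hl
    obtain ⟨c, hc, rfl⟩ := List.mem_map.1 hl
    exact ⟨rfl, mem_labR_of_mem_label (h.activeR.out b hb) hc⟩
  generalize ((BR b).out.map Sum.inr : List (C ⊕ D)) = κ' at hout hoR hol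
  rw [hinp] at hzL
  have hσ : σ = x.map Prod.fst ++ (κ ++ y.map Prod.fst) := by
    rw [← h.bot_eq, hz]
    simp [map_label]
  obtain ⟨ρ, hρ⟩ : ∃ ρ, ρ = x.map Prod.fst ++ (κ' ++ y.map Prod.fst) := ⟨_, rfl⟩
  have hσL := wordR_lay hσ
  have hρL := wordR_lay hρ
  have hR : wordL ρ = wordL σ := by rw [wordL_lay hσ, wordL_lay hρ, hκR, hoR]
  obtain ⟨f', hf', hP⟩ := h.pathR.front (X₁ := wordR ρ) h.activeR.nodup h.activeR.ne hb hzL (h.activeR.inp b hb)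
    (by rw [← hinp]; intro h0; obtain ⟨l, hl⟩ := List.exists_mem_of_ne_nil _ hκ0; exact absurd ((wordR_eq_nil.1 h0 l hl).symm.trans (hκ l hl)) (by simp))
    (map_labR x) (map_labR y) (by rw [← hinp]; exact hσL) (by rw [← hout]; exact hρL)
  obtain ⟨z₁, hz₁⟩ : ∃ z₁, z₁ = x ++ (label b κ' ++ y) := ⟨_, rfl⟩
  have hz₁L : labR z₁ = labR x ++ (label b (BR b).out ++ labR y) := by
    rw [hz₁, labR_append, labR_append, labR_label, hout]
  have hz₁R : labL z₁ = labL z := by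
    rw [hz₁, hz, labL_append, labL_append, labL_label, labL_append, labL_append, labL_label,
      hκR, hoR]
  have hm : Mono (κ ++ κ') := ⟨false, fun l hl => by
    rcases List.mem_append.1 hl with hl | hl
    · exact hκ l hl
    · exact (hol l hl).1⟩
  refine ⟨ρ, wlay hσ hρ (tmulHom (eqToHom (congrArg tw (hκR.trans hoR.symm)))
      (eqToHom (congrArg tw hinp) ≫ (BR b).mor ≫ eqToHom (congrArg tw hout.symm))), eqToHom (congrArg tw hR) ≫ f, f', z₁, .wlay _ _ hm _, ?_, ?_, h.top_eq, ?_, ?_, by rw [hz₁R]; exact h.pathL.eqToHom_comp hR,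
    by rwa [hz₁L], by rw [hz₁R]; exact h.activeL,
    by rw [hz₁L]; exact h.activeR.step hb hzL⟩
  · rw [wlay_tmulHom, tmulHom_comp, lay_conj_eqToHom hinp hout.symm _ _ (by rw [← hinp]; exact hσL)
      (by rw [← hout]; exact hρL), ← hf', lay_eqToHom _ _ (hκR.trans hoR.symm)]
    simp
  · rw [hz₁, hρ]
    simp [map_label]
  · intro p hp q hq hpq
    have key : ∀ p ∈ z₁ ++ z', p ∈ z ++ z' := by
      intro p hp
      rw [hz₁] at hp
      rw [hz]
      simp only [List.mem_append] at hp ⊢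
      rcases hp with (hp | hp | hp) | hp
      · exact Or.inl (Or.inl hp)
      · obtain ⟨l, hl, rfl⟩ := List.mem_map.1 hp
        exact Or.inr (hol l hl).2
      · exact Or.inl (Or.inr (Or.inr hp))
      · exact Or.inr hp
    exact h.monochrome p (key p hp) q (key q hq) hpq
  · have hn := h.nonCrossing
    rw [hz] at hn
    rw [hz₁]
    simp only [List.append_assoc, List.map_append] at hn ⊢
    refine hn.replace (b := b) (by simpa using hr) ?_ ?_
    · exact fun d hd => (mem_map_label.1 hd).1
    · exact fun d hd => (mem_map_label.1 hd).1

/-- Among the undrawn blocks occurring in `z` one has adjacent letters. The selection argument needs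
every label between two letters of an undrawn block to be undrawn as well, which non-crossing
provides. -/
theorem Strip.exists_run {BL : ℕ → Box C} {BR : ℕ → Box D} {lL lR : List ℕ}
    {z z' : List ((C ⊕ D) × ℕ)} {σ τ : List (C ⊕ D)} {f : tL σ ⟶ tL τ} {g : tR σ ⟶ tR τ}
    (h : Strip BL BR lL lR z z' f g) (hz : ∃ b, (b ∈ lL ∨ b ∈ lR) ∧ b ∈ z.map Prod.snd) :
    ∃ b x r y, (b ∈ lL ∨ b ∈ lR) ∧ z = x ++ (r ++ y) ∧ r ≠ [] ∧ (∀ p ∈ r, p.2 = b) ∧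
      b ∉ x.map Prod.snd ∧ b ∉ y.map Prod.snd := by
  refine AnnularFreeProduct.exists_run _ hz (fun b c hb hbc hs => ?_)
  have hn := h.nonCrossing
  rw [List.map_append] at hn
  refine ⟨?_, fun h4 => hbc (hn b c (h4.trans (List.sublist_append_left _ _)))⟩
  by_contra hc
  rw [not_or] at hc
  -- A finished block runs straight up to the top word, so its letter there completes the crossing.
  have hc' : c ∈ z'.map Prod.snd := by
    obtain ⟨⟨l, c'⟩, hl, rfl⟩ := List.mem_map.1 (hs.subset (show c ∈ [b, c, b] by simp))
    rcases l with l | l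
    · have h1 : (l, c') ∈ block (labL z) c' := List.mem_filter.2 ⟨mem_labL.2 hl, by simp⟩
      rw [h.activeL.rest _ hc.1] at h1
      exact List.mem_map.2 ⟨_, mem_labL.1 (List.mem_of_mem_filter h1), rfl⟩
    · have h1 : (l, c') ∈ block (labR z) c' := List.mem_filter.2 ⟨mem_labR.2 hl, by simp⟩
      rw [h.activeR.rest _ hc.2] at h1
      exact List.mem_map.2 ⟨_, mem_labR.1 (List.mem_of_mem_filter h1), rfl⟩
  refine hbc (hn b c ?_)
  refine List.Sublist.append (l₁ := [b, c, b]) (r₁ := [c]) hs (List.singleton_sublist.2 ?_)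
  simpa using hc'

/-- Boxes with letters in the current word are drawn until none is left. Induction is on the number
of remaining boxes, and those that survive have no inputs. -/
theorem Strip.reduce {BL : ℕ → Box C} {BR : ℕ → Box D} {τ : List (C ⊕ D)}
    {z' : List ((C ⊕ D) × ℕ)} (n : ℕ) : ∀ {lL lR : List ℕ} {z : List ((C ⊕ D) × ℕ)}
    {σ : List (C ⊕ D)} {f : tL σ ⟶ tL τ} {g : tR σ ⟶ tR τ}
    (_ : Strip BL BR lL lR z z' f g) (_ : lL.length + lR.length = n),
    ∃ (lL' lR' : List ℕ) (ρ : List (C ⊕ D)) (u : σ ⟶ ρ) (f' : tL ρ ⟶ tL τ) (g' : tR ρ ⟶ tR τ)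
      (z₁ : List ((C ⊕ D) × ℕ)), Planar u ∧ tmulHom f g = u ≫ tmulHom f' g' ∧
        Strip BL BR lL' lR' z₁ z' f' g' ∧ lL' ⊆ lL ∧ lR' ⊆ lR ∧
        ∀ b, b ∈ lL' ∨ b ∈ lR' → b ∉ z₁.map Prod.snd := by
  induction n with
  | zero =>
    intro lL lR z σ f g h hn
    obtain ⟨rfl, rfl⟩ : lL = [] ∧ lR = [] := by
      constructor <;> rw [← List.length_eq_zero_iff] <;> omega
    exact ⟨_, _, σ, 𝟙 σ, f, g, z, .id _, (Category.id_comp _).symm, h, by simp, by simp, by simp⟩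
  | succ n ih =>
    intro lL lR z σ f g h hn
    by_cases hz : ∃ b, (b ∈ lL ∨ b ∈ lR) ∧ b ∈ z.map Prod.snd
    · obtain ⟨b, x, r, y, hb, h1, h2, h3, h4, h5⟩ := h.exists_run hz
      rcases hb with hb | hb
      · obtain ⟨ρ, u, f', g', z₁, h6, h7, h8⟩ := h.stepL hb h1 h2 h3 h4 h5
        obtain ⟨lL', lR', ρ', u', f'', g'', z₂, k1, k2, k3, k4, k5, k6⟩ := ih h8
          (by rw [List.length_erase_of_mem hb]; have := List.length_pos_of_mem hb; omega)
        exact ⟨lL', lR', ρ', u ≫ u', f'', g'', z₂, h6.comp k1, by rw [h7, k2, Category.assoc], k3,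
          fun c hc => List.mem_of_mem_erase (k4 hc), k5, k6⟩
      · obtain ⟨ρ, u, f', g', z₁, h6, h7, h8⟩ := h.stepR hb h1 h2 h3 h4 h5
        obtain ⟨lL', lR', ρ', u', f'', g'', z₂, k1, k2, k3, k4, k5, k6⟩ := ih h8
          (by rw [List.length_erase_of_mem hb]; have := List.length_pos_of_mem hb; omega)
        exact ⟨lL', lR', ρ', u ≫ u', f'', g'', z₂, h6.comp k1, by rw [h7, k2, Category.assoc], k3,
          k4, fun c hc => List.mem_of_mem_erase (k5 hc), k6⟩
    · exact ⟨lL, lR, σ, 𝟙 σ, f, g, z, .id _, (Category.id_comp _).symm, h, fun _ => id,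
        fun _ => id, fun b hb hbz => hz ⟨b, hb, hbz⟩⟩

theorem Strip.inp_eq_nilL {BL : ℕ → Box C} {BR : ℕ → Box D} {lL lR : List ℕ}
    {z z' : List ((C ⊕ D) × ℕ)} {σ τ : List (C ⊕ D)} {f : tL σ ⟶ tL τ} {g : tR σ ⟶ tR τ}
    (h : Strip BL BR lL lR z z' f g) {b : ℕ} (hb : b ∈ lL) (hz : b ∉ z.map Prod.snd) :
    (BL b).inp = [] := by
  have h1 := h.activeL.inp b hb
  rw [block_eq_nil (notMem_labL hz)] at h1
  exact label_eq_nil.1 h1.symm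

theorem Strip.inp_eq_nilR {BL : ℕ → Box C} {BR : ℕ → Box D} {lL lR : List ℕ}
    {z z' : List ((C ⊕ D) × ℕ)} {σ τ : List (C ⊕ D)} {f : tL σ ⟶ tL τ} {g : tR σ ⟶ tR τ}
    (h : Strip BL BR lL lR z z' f g) {b : ℕ} (hb : b ∈ lR) (hz : b ∉ z.map Prod.snd) :
    (BR b).inp = [] := by
  have h1 := h.activeR.inp b hb
  rw [block_eq_nil (notMem_labR hz)] at h1
  exact label_eq_nil.1 h1.symm

theorem Strip.planar_of_inp_ne_nil {BL : ℕ → Box C} {BR : ℕ → Box D} {lL lR : List ℕ}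
    {z z' : List ((C ⊕ D) × ℕ)} {σ τ : List (C ⊕ D)} {f : tL σ ⟶ tL τ} {g : tR σ ⟶ tR τ}
    (h : Strip BL BR lL lR z z' f g) (hL : ∀ b ∈ lL, (BL b).inp ≠ [])
    (hR : ∀ b ∈ lR, (BR b).inp ≠ []) : Planar (tmulHom f g) := by
  obtain ⟨lL', lR', ρ, u, f', g', z₁, h1, h2, h3, h4, h5, h6⟩ := h.reduce _ rfl
  obtain rfl : lL' = [] := List.eq_nil_iff_forall_not_mem.2
    (fun b hb => hL b (h4 hb) (h3.inp_eq_nilL hb (h6 b (Or.inl hb))))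
  obtain rfl : lR' = [] := List.eq_nil_iff_forall_not_mem.2
    (fun b hb => hR b (h5 hb) (h3.inp_eq_nilR hb (h6 b (Or.inr hb))))
  obtain ⟨e1, e2, rfl⟩ := h3.pathL.eq_of_nil
  obtain ⟨e3, e4, rfl⟩ := h3.pathR.eq_of_nil
  have e := eq_of_nonCrossing e1 e3 h3.monochrome h3.nonCrossing
  obtain rfl : ρ = τ := by rw [← h3.bot_eq, ← h3.top_eq, e]
  rw [h2]
  refine h1.comp ?_
  rw [eqToHom_refl, eqToHom_refl]
  exact .id _

theorem Strip.dag {BL : ℕ → Box C} {BR : ℕ → Box D} {lL lR : List ℕ}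
    {z z' : List ((C ⊕ D) × ℕ)} {σ τ : List (C ⊕ D)} {f : tL σ ⟶ tL τ} {g : tR σ ⟶ tR τ}
    (h : Strip BL BR lL lR z z' f g) : Strip (fun b => (BL b).dag) (fun b => (BR b).dag) lL.reverse
      lR.reverse z' z (StarCategory.dag f) (StarCategory.dag g) where
  bot_eq := h.top_eq
  top_eq := h.bot_eq
  monochrome p hp q hq := h.monochrome p (by simp at hp ⊢; tauto) q (by simp at hq ⊢; tauto)
  nonCrossing := by simpa using h.nonCrossing.reverse
  pathL := h.pathL.dag
  pathR := h.pathR.dag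
  activeL := h.activeL.dag
  activeR := h.activeR.dag

/-- After `Strip.reduce` the remaining boxes have outputs but no inputs. In the adjoint diagram they
all have inputs, so a second reduction draws every one of them. -/
theorem Strip.planar {BL : ℕ → Box C} {BR : ℕ → Box D} {lL lR : List ℕ}
    {z z' : List ((C ⊕ D) × ℕ)} {σ τ : List (C ⊕ D)} {f : tL σ ⟶ tL τ} {g : tR σ ⟶ tR τ}
    (h : Strip BL BR lL lR z z' f g) : Planar (tmulHom f g) := by
  obtain ⟨lL', lR', ρ, u, f', g', z₁, h1, h2, h3, h4, h5, h6⟩ := h.reduce _ rfl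
  rw [h2]
  refine h1.comp ?_
  rw [← wdag_wdag (tmulHom f' g'), wdag_tmulHom]
  refine Planar.dag (h3.dag.planar_of_inp_ne_nil (fun b hb => ?_) (fun b hb => ?_))
  · have hb' : b ∈ lL' := by simpa using hb
    exact (h3.activeL.ne b hb').resolve_left
      (fun h0 => h0 (h3.inp_eq_nilL hb' (h6 b (Or.inl hb'))))
  · have hb' : b ∈ lR' := by simpa using hb
    exact (h3.activeR.ne b hb').resolve_left
      (fun h0 => h0 (h3.inp_eq_nilR hb' (h6 b (Or.inr hb'))))

theorem IsValue.path {M : Type u} [Category.{v} M] [Preadditive M] [Linear ℂ M]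
    [MonoidalCategory M] [MonoidalPreadditive M] [MonoidalLinear ℂ M] {bot top : List (M × ℕ)}
    {f : ∀ b : ℕ, tens Prod.fst (block bot b) ⟶ tens Prod.fst (block top b)}
    {g : tens Prod.fst bot ⟶ tens Prod.fst top} (h : IsValue bot top f g) {X Y : List M}
    (hX : bot.map Prod.fst = X) (hY : top.map Prod.fst = Y)
    (p : tw X = tens Prod.fst bot) (q : tens Prod.fst top = tw Y) :
    ∃ (B : ℕ → Box M) (l : List ℕ), Active B l bot top ∧
      Path B l bot top (eqToHom p ≫ g ≫ eqToHom q) := by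
  obtain ⟨l, h1, h2, h3, h4⟩ := Drawn.path h hX hY p q
  have hl : ∀ b, b ∈ l ↔ b ∈ (bot ++ top).map Prod.snd := by
    intro b
    rw [← List.mem_toFinset, h2, List.mem_toFinset]
  refine ⟨boxOf f, l, ⟨h1, fun b _ => (label_block bot b).symm, fun b _ => (label_block top b).symm,
    fun b hb => ?_, fun b hb => ?_⟩, h4⟩
  · by_contra hne
    rw [not_or, not_not, not_not] at hne
    have e1 : block bot b = [] := List.map_eq_nil_iff.1 hne.1
    have e2 : block top b = [] := List.map_eq_nil_iff.1 hne.2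
    have h5 := (hl b).1 hb
    rw [List.map_append, List.mem_append] at h5
    exact h5.elim (notMem_of_block_eq_nil e1) (notMem_of_block_eq_nil e2)
  · rw [hl, List.map_append, List.mem_append, not_or] at hb
    rw [block_eq_nil hb.1, block_eq_nil hb.2]

theorem planar_of_mem_ncpHom {σ τ : List (C ⊕ D)} {z : σ ⟶ τ} (hz : z ∈ ncpHom σ τ) :
    Planar z := by
  induction hz using Submodule.span_induction with
  | zero => exact .zero _ _
  | add x y _ _ hx hy => exact .add _ _ hx hy
  | smul c x _ hx => exact .smul _ _ hx
  | mem z hz =>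
    obtain ⟨T, f, g, ⟨f', hf, rfl⟩, ⟨g', hg, rfl⟩, rfl⟩ := hz
    obtain ⟨BL, lL, h1, h2⟩ := hf.path (X := wordL σ) (Y := wordL τ)
      (by rw [map_labL, T.bot_eq]) (by rw [map_labL, T.top_eq]) (tL_eq T.bot_eq)
      (tL_eq T.top_eq).symm
    obtain ⟨BR, lR, h3, h4⟩ := hg.path (X := wordR σ) (Y := wordR τ)
      (by rw [map_labR, T.bot_eq]) (by rw [map_labR, T.top_eq]) (tR_eq T.bot_eq)
      (tR_eq T.top_eq).symm
    exact Strip.planar (BL := BL) (BR := BR) (lL := lL) (lR := lR) (z := T.bot) (z' := T.top)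
      ⟨T.bot_eq, T.top_eq, T.monochrome, T.noncrossing, h2, h4, h1, h3⟩

theorem mem_ncpHom_iff {IC : Set C} {ID : Set D} (hIC : IsNonunitSimpleReps IC)
    (hID : IsNonunitSimpleReps ID) {σ τ : List (C ⊕ D)} {z : σ ⟶ τ} :
    z ∈ ncpHom σ τ ↔ Planar z :=
  ⟨planar_of_mem_ncpHom, fun h => realHom_le σ τ (h.mem_realHom hIC hID)⟩

end Strip

/-! ## Conjugacy of words from fusion -/

section Conjugacy

variable {L : Type*}

/-- The classical conjugacy equation for words. If `a` is at least as long as `w₂`, then `w₂` is a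
prefix that can be stripped off, giving the same equation for a shorter word; otherwise the rotation
can be read off. -/
theorem exists_rotation_of_append_eq {a w₁ w₂ : List L} (h : a ++ w₁ = w₂ ++ a) :
    ∃ u v, w₁ = u ++ v ∧ w₂ = v ++ u := by
  induction hn : a.length using Nat.strong_induction_on generalizing a with
  | _ n ih =>
    rcases List.append_eq_append_iff.1 h with ⟨m, h1, h2⟩ | ⟨m, h1, h2⟩
    · exact ⟨m, a, h2, h1⟩
    · by_cases h0 : w₂ = []
      · subst h0
        exact ⟨[], [], by simpa using h, rfl⟩
      · have hlt : m.length < n := by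
          have h3 := congrArg List.length h1
          rw [List.length_append, hn] at h3
          have := List.length_pos_of_ne_nil h0
          omega
        exact ih _ hlt (h2.symm.trans h1) rfl

variable (col : L → Bool)

/-- The colour of the first letter. -/
def firstCol (x : List L) : Option Bool := x.head?.map col

/-- The colour of the last letter. -/
def lastCol (x : List L) : Option Bool := x.getLast?.map col

variable {col}

theorem firstCol_append (x y : List L) :
    firstCol col (x ++ y) = (firstCol col x).or (firstCol col y) := by
  cases x <;> simp [firstCol]

theorem lastCol_append (x y : List L) :
    lastCol col (x ++ y) = (lastCol col y).or (lastCol col x) := by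
  rw [lastCol, List.getLast?_append, lastCol, lastCol]
  cases y.getLast? <;> simp

theorem firstCol_eq_none {x : List L} : firstCol col x = none ↔ x = [] := by
  simp [firstCol]

theorem lastCol_eq_none {x : List L} : lastCol col x = none ↔ x = [] := by
  simp [lastCol]

theorem firstCol_cons (l : L) (x : List L) : firstCol col (l :: x) = some (col l) := rfl

theorem lastCol_cons (l : L) (x : List L) :
    lastCol col (l :: x) = (lastCol col x).or (some (col l)) :=
  lastCol_append [l] x

theorem lastCol_ne_firstCol {x y : List L} (h : (x ++ y).IsChain (fun l l' => col l ≠ col l'))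
    (hx : x ≠ []) : lastCol col x ≠ firstCol col y := by
  intro he
  have h1 := (List.isChain_append.1 h).2.2
  rw [lastCol, firstCol] at he
  cases hl : x.getLast? with
  | none => exact hx (by simpa using hl)
  | some a =>
    rw [hl] at he
    cases hf : y.head? with
    | none => rw [hf] at he; simp at he
    | some b =>
      rw [hf] at he
      exact h1 a (by simp [hl]) b (by simp [hf]) (by simpa using he)

theorem firstCol_of_forall₂ {R : L → L → Prop} (hc : ∀ a b, R a b → col a = col b) {x y : List L}
    (h : List.Forall₂ R x y) : firstCol col x = firstCol col y := by
  cases h with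
  | nil => rfl
  | cons h _ => simp [firstCol, hc _ _ h]

theorem firstCol_reverse (x : List L) : firstCol col x.reverse = lastCol col x := by
  simp [firstCol, lastCol]

theorem lastCol_reverse (x : List L) : lastCol col x.reverse = firstCol col x := by
  simp [firstCol, lastCol]

theorem lastCol_of_forall₂ {R : L → L → Prop} (hc : ∀ a b, R a b → col a = col b) {x y : List L}
    (h : List.Forall₂ R x y) : lastCol col x = lastCol col y := by
  rw [← firstCol_reverse, ← firstCol_reverse]
  exact firstCol_of_forall₂ hc (List.forall₂_reverse_iff.2 h)

variable (col) in
/-- The relation `FusionRel` for an abstract relation of duality. -/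
def FuseWith (R : L → L → Prop) (z x y : List L) : Prop :=
  ∃ x₁ e e' y₁, x = x₁ ++ e ∧ y = e' ++ y₁ ∧ List.Forall₂ R e.reverse e' ∧
    (z = x₁ ++ y₁ ∨ ∃ x₂ c c' s y₂, x₁ = x₂ ++ [c] ∧ y₁ = c' :: y₂ ∧ z = x₂ ++ s :: y₂ ∧
      col c = col s ∧ col c' = col s)

theorem forall₂_unique {R : L → L → Prop} (hf : ∀ a b c, R a b → R a c → b = c) {x y y' : List L}
    (h : List.Forall₂ R x y) (h' : List.Forall₂ R x y') : y = y' := by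
  induction h generalizing y' with
  | nil => cases h'; rfl
  | cons h _ ih =>
    cases h' with
    | cons h' h'' => rw [hf _ _ _ h h', ih h'']

theorem forall₂_append_left {R : L → L → Prop} {x y z : List L}
    (h : List.Forall₂ R (x ++ y) z) :
    ∃ p q, z = p ++ q ∧ List.Forall₂ R x p ∧ List.Forall₂ R y q := by
  induction x generalizing z with
  | nil => exact ⟨[], z, rfl, .nil, h⟩
  | cons a x ih =>
    cases h with
    | cons h h' =>
      obtain ⟨p, q, rfl, h1, h2⟩ := ih h'
      exact ⟨_ :: p, q, rfl, .cons h h1, h2⟩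

/-- The possible shapes of a fusion `z` of `x` and `y`: a word in which letters merge, or a word in
which one of the three parts is empty. -/
theorem FuseWith.cases {R : L → L → Prop} (hc : ∀ a b, R a b → col a = col b) {z x y : List L}
    (h : FuseWith col R z x y) (hz : z.IsChain (fun l l' => col l ≠ col l'))
    (hx : x.IsChain (fun l l' => col l ≠ col l')) (hy : y.IsChain (fun l l' => col l ≠ col l')) :
    (x ≠ [] ∧ y ≠ [] ∧ firstCol col z = firstCol col x ∧ lastCol col z = lastCol col y ∧
        lastCol col x = firstCol col y) ∨
      (z = x ++ y) ∨
      (∃ e', List.Forall₂ R x.reverse e' ∧ x ≠ [] ∧ y = e' ++ z ∧ lastCol col x = firstCol col y) ∨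
      (∃ e, List.Forall₂ R e.reverse y ∧ y ≠ [] ∧ x = z ++ e ∧ lastCol col x = firstCol col y) := by
  obtain ⟨x₁, e, e', y₁, rfl, rfl, hR, rfl | ⟨x₂, c, c', s, y₂, rfl, rfl, rfl, h1, h2⟩⟩ := h
  · right
    by_cases he : e = []
    · subst he
      rw [List.reverse_nil, List.forall₂_nil_left_iff] at hR
      subst hR
      left
      simp
    right
    have e1 := firstCol_of_forall₂ hc hR
    have e2 := lastCol_of_forall₂ hc hR
    rw [firstCol_reverse] at e1
    rw [lastCol_reverse] at e2
    have he' : e' ≠ [] := by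
      rintro rfl
      rw [List.forall₂_nil_right_iff, List.reverse_eq_nil_iff] at hR
      exact he hR
    have e3 : lastCol col (x₁ ++ e) = firstCol col (e' ++ y₁) := by
      rw [lastCol_append, firstCol_append, e1]
      have := firstCol_eq_none (col := col) (x := e')
      cases h : firstCol col e' <;> simp_all
    by_cases hx₁ : x₁ = []
    · subst hx₁
      left
      exact ⟨e', hR, by simpa using he, by simp, e3⟩
    by_cases hy₁ : y₁ = []
    · subst hy₁
      right
      exact ⟨e, by simpa using hR, by simpa using he', by simp, e3⟩
    -- With two colours only: the letters adjacent to the cancelled part on either side both differ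
    -- in colour from its outermost letters, so they have the same colour and `z` is not
    -- alternating.
    exfalso
    have h3 := lastCol_ne_firstCol hx hx₁
    have h4 := lastCol_ne_firstCol hy he'
    have h5 := lastCol_ne_firstCol hz hx₁
    have n1 := mt (lastCol_eq_none (col := col)).1 hx₁
    have n2 := mt (firstCol_eq_none (col := col)).1 hy₁
    have n3 := mt (firstCol_eq_none (col := col)).1 he
    rw [← e2] at h4
    revert h3 h4 h5 n1 n2 n3
    generalize lastCol col x₁ = p
    generalize firstCol col y₁ = q
    generalize firstCol col e = r
    revert p q r
    decide
  · left
    have e1 := firstCol_of_forall₂ hc hR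
    rw [firstCol_reverse] at e1
    refine ⟨by simp, by simp, ?_, ?_, ?_⟩
    · simp only [firstCol_append, firstCol_cons]
      rw [h1]
      cases firstCol col x₂ <;> simp
    · simp only [lastCol_append, lastCol_cons]
      rw [h2]
      cases lastCol col y₂ <;> simp
    · simp only [lastCol_append, firstCol_append, firstCol_cons, lastCol_cons]
      rw [e1, h1, h2]
      cases firstCol col e' <;> simp [lastCol]

/-- Each of the two fusions is a merger, a concatenation, or the total cancellation of one factor.
The colours at the ends of `w₁` and `w₂`, or their lengths, exclude all but five of the sixteen
combinations. Mergers never survive, and duality `R` transfers statements between a word and its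
reversed dual. -/
theorem rotation_of_fuseWith {R : L → L → Prop} (hs : ∀ a b, R a b → R b a)
    (hf : ∀ a b c, R a b → R a c → b = c) (hc : ∀ a b, R a b → col a = col b)
    {z a w₁ w₂ : List L} (hz : z.IsChain (fun l l' => col l ≠ col l'))
    (ha : a.IsChain (fun l l' => col l ≠ col l')) (h₁ : w₁.IsChain (fun l l' => col l ≠ col l'))
    (h₂ : w₂.IsChain (fun l l' => col l ≠ col l')) (f₁ : firstCol col w₁ = some true)
    (l₁ : lastCol col w₁ = some false) (f₂ : firstCol col w₂ = some true)
    (l₂ : lastCol col w₂ = some false) (hA : FuseWith col R z a w₁) (hB : FuseWith col R z w₂ a) :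
    ∃ u v, w₁ = u ++ v ∧ w₂ = v ++ u := by
  have bar : ∀ {x y : List L}, List.Forall₂ R x.reverse y → List.Forall₂ R y.reverse x := by
    intro x y h
    have h1 := List.forall₂_reverse_iff.2 (h.flip)
    rw [List.reverse_reverse] at h1
    exact h1.imp (fun a b h => hs _ _ h)
  have first : ∀ {x y : List L}, List.Forall₂ R x.reverse y → firstCol col y = lastCol col x := by
    intro x y h
    rw [← firstCol_of_forall₂ hc h, firstCol_reverse]
  have last : ∀ {x y : List L}, List.Forall₂ R x.reverse y → lastCol col y = firstCol col x := by
    intro x y h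
    rw [← lastCol_of_forall₂ hc h, lastCol_reverse]
  rcases hA.cases hc hz ha h₁ with ⟨a1, a2, a3, a4, a5⟩ | rfl | ⟨e', a1, a2, a3, a4⟩ |
    ⟨e, a1, a2, a3, a4⟩
  · exfalso
    rcases hB.cases hc hz h₂ ha with ⟨b1, b2, b3, b4, b5⟩ | rfl | ⟨f', b1, b2, b3, b4⟩ |
      ⟨f, b1, b2, b3, b4⟩
    · simp_all
    · rw [lastCol_append, a5, f₁, l₁] at a4
      simp at a4
    · rw [b3, lastCol_append, a4, l₁, f₁] at a5
      simp at a5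
    · rw [b3, firstCol_append] at f₂
      have h3 := first b1
      rw [← b4, l₂] at a3
      rw [a3] at f₂
      simp at f₂
  · rcases hB.cases hc hz h₂ ha with ⟨b1, b2, b3, b4, b5⟩ | b | ⟨f', b1, b2, b3, b4⟩ |
      ⟨f, b1, b2, b3, b4⟩
    · rw [firstCol_append, ← b5, l₂, f₂] at b3
      simp at b3
    -- Two concatenations give `a w₁ = w₂ a`.
    · exact exists_rotation_of_append_eq b
    · have h3 := congrArg List.length b3
      have h4 : w₁ ≠ [] := fun h => by simp [h, firstCol] at f₁
      have := List.length_pos_of_ne_nil h4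
      simp only [List.length_append] at h3
      omega
    · rw [b3, firstCol_append, firstCol_append, ← b4, l₂] at f₂
      simp at f₂
  · rcases hB.cases hc hz h₂ ha with ⟨b1, b2, b3, b4, b5⟩ | rfl | ⟨f', b1, b2, b3, b4⟩ |
      ⟨f, b1, b2, b3, b4⟩
    · rw [a3, lastCol_append, b4, a4, f₁] at l₁
      simp at l₁
    · rw [a3, lastCol_append, lastCol_append, a4, f₁] at l₁
      simp at l₁
    · rw [b3, List.reverse_append] at a1
      obtain ⟨p, q, rfl, hp, hq⟩ := forall₂_append_left a1
      obtain rfl : q = w₂ := forall₂_unique hf hq (bar b1)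
      -- Here `w₁` is the dual of `z`, then `w₂`, then `z`. For nonempty `z` this word would begin
      -- and end with the same colour, so `z` is empty and the words coincide.
      by_cases hz0 : z = []
      · subst hz0
        rw [List.reverse_nil, List.forall₂_nil_left_iff] at hp
        subst hp
        exact ⟨q, [], by simpa using a3, by simp⟩
      · rw [a3, lastCol_append] at l₁
        rw [a3, firstCol_append, firstCol_append, first hp] at f₁
        have := mt (lastCol_eq_none (col := col)).1 hz0
        cases h : lastCol col z <;> simp_all
    -- The dual of `a` is a prefix of `w₁` and a suffix of `w₂`, with the same complement `z`.
    · have e : e' = f := forall₂_unique hf a1 (bar b1)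
      rw [e] at a3
      exact ⟨f, z, a3, b3⟩
  · rcases hB.cases hc hz h₂ ha with ⟨b1, b2, b3, b4, b5⟩ | rfl | ⟨f', b1, b2, b3, b4⟩ |
      ⟨f, b1, b2, b3, b4⟩
    · rw [a3, firstCol_append, b3, f₂, l₂] at b5
      simp at b5
    · have h3 := congrArg List.length a3
      have h4 : w₂ ≠ [] := fun h => by simp [h, firstCol] at f₂
      have := List.length_pos_of_ne_nil h4
      simp only [List.length_append] at h3
      omega
    -- Now `z e = f' z`, where `e` and `f'` are the duals of `w₁` and `w₂`. The resulting rotation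
    -- of the duals is dualised back.
    · obtain ⟨u, v, rfl, rfl⟩ := exists_rotation_of_append_eq (a3.symm.trans b3)
      have hb := bar b1
      rw [List.reverse_append] at a1 hb
      obtain ⟨p, q, rfl, hp, hq⟩ := forall₂_append_left a1
      obtain ⟨p', q', rfl, hp', hq'⟩ := forall₂_append_left hb
      rw [forall₂_unique hf hp' hq, forall₂_unique hf hq' hp]
      exact ⟨p, q, rfl, rfl⟩
    · have hb := bar b1
      rw [a3, List.reverse_append] at hb
      obtain ⟨p, q, rfl, hp, hq⟩ := forall₂_append_left hb
      obtain rfl : p = w₁ := forall₂_unique hf hp a1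
      by_cases hz0 : z = []
      · subst hz0
        rw [List.reverse_nil, List.forall₂_nil_left_iff] at hq
        subst hq
        exact ⟨p, [], by simp, by simpa using b3⟩
      · rw [b3, firstCol_append] at f₂
        rw [b3, lastCol_append, lastCol_append, last hq] at l₂
        have := mt (firstCol_eq_none (col := col)).1 hz0
        cases h : firstCol col z <;> simp_all

end Conjugacy

/-! ## Duality -/

section Duality

variable {M : Type u} [Category.{v} M] [Preadditive M] [Linear ℂ M] [MonoidalCategory M]
  [MonoidalPreadditive M] [MonoidalLinear ℂ M] [StarCategory M] [IsRigidCStarTensorCategory M]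

theorem exists_exactPairing (X : M) : ∃ (X' : M) (_ : ExactPairing X X') (R : 𝟙_ M ⟶ X' ⊗ X),
    ε_ X X' = dag R := by
  obtain ⟨X', R, R', h1, h2⟩ := IsRigidCStarTensorCategory.duals X
  refine ⟨X', ⟨R', dag R, ?_, ?_⟩, R, rfl⟩
  · rw [← cancel_epi (ρ_ X').inv, ← cancel_mono (λ_ X').hom]
    simpa using h2
  · rw [← cancel_epi (λ_ X).inv, ← cancel_mono (ρ_ X).hom]
    simpa using h1

theorem coev_comp_left_injective {X X' Y : M} [ExactPairing X X'] {f g : X' ⟶ Y}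
    (h : η_ X X' ≫ X ◁ f = η_ X X' ≫ X ◁ g) : f = g := by
  have h1 := congrArg (tensorLeftHomEquiv (𝟙_ M) X X' Y).symm h
  rw [tensorLeftHomEquiv_symm_coevaluation_comp_whiskerLeft,
    tensorLeftHomEquiv_symm_coevaluation_comp_whiskerLeft] at h1
  exact (cancel_epi _).1 h1

theorem exists_eq_coev_comp_left {X X' Y : M} [ExactPairing X X'] (φ : 𝟙_ M ⟶ X ⊗ Y) :
    ∃ f : X' ⟶ Y, φ = η_ X X' ≫ X ◁ f := by
  refine ⟨(ρ_ X').inv ≫ (tensorLeftHomEquiv (𝟙_ M) X X' Y).symm φ,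
    (tensorLeftHomEquiv (𝟙_ M) X X' Y).symm.injective ?_⟩
  rw [tensorLeftHomEquiv_symm_coevaluation_comp_whiskerLeft]
  simp

theorem exists_eq_coev_comp_right {X X' Y : M} [ExactPairing X X'] (φ : 𝟙_ M ⟶ Y ⊗ X') :
    ∃ f : X ⟶ Y, φ = η_ X X' ≫ f ▷ X' := by
  refine ⟨(λ_ X).inv ≫ (tensorRightHomEquiv (𝟙_ M) X X' Y).symm φ,
    (tensorRightHomEquiv (𝟙_ M) X X' Y).symm.injective ?_⟩
  rw [tensorRightHomEquiv_symm_coevaluation_comp_whiskerRight]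
  simp

theorem coev_ne_zero {X X' : M} [ExactPairing X X'] (hX : 𝟙 X ≠ 0) : η_ X X' ≠ 0 := by
  intro h
  have h1 := ExactPairing.evaluation_coevaluation X X'
  rw [h, MonoidalPreadditive.zero_whiskerRight, Limits.zero_comp] at h1
  apply hX
  calc 𝟙 X = (λ_ X).inv ≫ ((λ_ X).hom ≫ (ρ_ X).inv) ≫ (ρ_ X).hom := by simp
    _ = 0 := by rw [← h1]; simp

theorem ev_ne_zero {X X' : M} [ExactPairing X X'] (hX : 𝟙 X ≠ 0) : ε_ X X' ≠ 0 := by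
  intro h
  have h1 := ExactPairing.evaluation_coevaluation X X'
  rw [h, MonoidalPreadditive.whiskerLeft_zero, Limits.comp_zero, Limits.comp_zero] at h1
  apply hX
  calc 𝟙 X = (λ_ X).inv ≫ ((λ_ X).hom ≫ (ρ_ X).inv) ≫ (ρ_ X).hom := by simp
    _ = 0 := by rw [← h1]; simp

/-- An endomorphism of the dual is determined by its composite with the coevaluation, which can be
rewritten through an endomorphism of `X`, that is, a scalar. -/
theorem IsSimpleObj.dual {X X' : M} [ExactPairing X X'] (hX : IsSimpleObj X) :
    IsSimpleObj X' := by
  refine ⟨fun h => coev_ne_zero (X := X) (X' := X') hX.1 ?_, fun f => ?_⟩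
  · calc η_ X X' = η_ X X' ≫ X ◁ 𝟙 X' := by simp
      _ = 0 := by rw [h, MonoidalPreadditive.whiskerLeft_zero, Limits.comp_zero]
  · obtain ⟨g, hg⟩ := exists_eq_coev_comp_right (X := X) (X' := X') (η_ X X' ≫ X ◁ f)
    obtain ⟨c, rfl⟩ := hX.2 g
    refine ⟨c, coev_comp_left_injective (X := X) ?_⟩
    rw [hg]
    simp

/-- The dual of a simple object is determined by the morphisms from the unit. -/
theorem IsSimpleObj.exists_dual {X : M} (hX : IsSimpleObj X) : ∃ X' : M,
    (∃ ψ : 𝟙_ M ⟶ X' ⊗ X, ψ ≠ 0) ∧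
      ∀ Y : M, IsSimpleObj Y → ∀ φ : 𝟙_ M ⟶ X ⊗ Y, φ ≠ 0 → Nonempty (X' ≅ Y) := by
  obtain ⟨X', _, R, hR⟩ := exists_exactPairing X
  refine ⟨X', ⟨R, fun h => ev_ne_zero (X := X) (X' := X') hX.1 (by rw [hR, h, dag_zero])⟩,
    fun Y hY φ hφ => ?_⟩
  obtain ⟨f, rfl⟩ := exists_eq_coev_comp_left (X := X) (X' := X') φ
  refine IsSimpleObj.iso_of_hom (IsSimpleObj.dual (X := X) hX) hY f ?_
  rintro rfl
  exact hφ (by rw [MonoidalPreadditive.whiskerLeft_zero, Limits.comp_zero])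

theorem IsSimpleObj.exists_hom_swap {X Y : M} (hX : IsSimpleObj X) (hY : IsSimpleObj Y)
    {φ : 𝟙_ M ⟶ X ⊗ Y} (hφ : φ ≠ 0) : ∃ ψ : 𝟙_ M ⟶ Y ⊗ X, ψ ≠ 0 := by
  obtain ⟨X', ⟨ψ, hψ⟩, h⟩ := hX.exists_dual
  obtain ⟨e⟩ := h Y hY φ hφ
  refine ⟨ψ ≫ e.hom ▷ X, fun h0 => hψ ?_⟩
  calc ψ = (ψ ≫ e.hom ▷ X) ≫ e.inv ▷ X := by simp
    _ = 0 := by rw [h0, Limits.zero_comp]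

theorem IsSimpleObj.iso_of_hom_unit {X Y Z : M} (hX : IsSimpleObj X) (hY : IsSimpleObj Y)
    (hZ : IsSimpleObj Z) {φ : 𝟙_ M ⟶ X ⊗ Y} (hφ : φ ≠ 0) {ψ : 𝟙_ M ⟶ X ⊗ Z} (hψ : ψ ≠ 0) :
    Nonempty (Y ≅ Z) := by
  obtain ⟨X', -, h⟩ := hX.exists_dual
  obtain ⟨e⟩ := h Y hY φ hφ
  obtain ⟨e'⟩ := h Z hZ ψ hψ
  exact ⟨e.symm ≪≫ e'⟩

/-- If `X ⊗ Y` were zero, then `R ▷ Y`, whose target contains it as a factor, would vanish. But `R ≫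
dag R` is a nonzero scalar, so this would make `Y` zero. -/
theorem id_tensor_ne_zero {X Y : M} (hX : 𝟙 X ≠ 0) (hY : 𝟙 Y ≠ 0) : 𝟙 (X ⊗ Y) ≠ 0 := by
  intro h
  obtain ⟨X', _, R, hR⟩ := exists_exactPairing X
  have hR0 : R ≠ 0 := fun h => ev_ne_zero (X := X) (X' := X') hX (by rw [hR, h, dag_zero])
  obtain ⟨c, hc⟩ := (IsRigidCStarTensorCategory.unit_simple (C := M)).2 (R ≫ dag R)
  have hc0 : c ≠ 0 := fun h => hR0 (eq_zero_of_comp_dag R (by rw [hc, h, zero_smul]))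
  have h1 : R ▷ Y = 0 := by
    calc R ▷ Y = R ▷ Y ≫ (α_ X' X Y).hom ≫ X' ◁ 𝟙 (X ⊗ Y) ≫ (α_ X' X Y).inv := by simp
      _ = 0 := by rw [h]; simp
  have h2 : c • 𝟙 Y = 0 := by
    calc c • 𝟙 Y = (λ_ Y).inv ≫ (c • 𝟙 (𝟙_ M)) ▷ Y ≫ (λ_ Y).hom := by simp
      _ = 0 := by rw [← hc, comp_whiskerRight, h1]; simp
  exact hY ((smul_eq_zero.1 h2).resolve_left hc0)

theorem id_tw_ne_zero {x : List M} (hx : ∀ X ∈ x, 𝟙 X ≠ 0) : 𝟙 (tw x) ≠ 0 := by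
  induction x with
  | nil => exact (IsRigidCStarTensorCategory.unit_simple (C := M)).1
  | cons X x ih => exact id_tensor_ne_zero (hx X (by simp)) (ih fun Y hY => hx Y (by simp [hY]))

end Duality

/-- Linear functionals that do not vanish on `x` and on `y` detect the tensor. -/
theorem tmul_ne_zero {V W : Type*} [AddCommGroup V] [Module ℂ V] [AddCommGroup W] [Module ℂ W]
    {x : V} {y : W} (hx : x ≠ 0) (hy : y ≠ 0) : x ⊗ₜ[ℂ] y ≠ 0 := by
  intro h
  have h1 : ∃ φ : Module.Dual ℂ V, φ x ≠ 0 := by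
    by_contra! h
    exact hx ((Module.forall_dual_apply_eq_zero_iff ℂ x).1 h)
  have h2 : ∃ ψ : Module.Dual ℂ W, ψ y ≠ 0 := by
    by_contra! h
    exact hy ((Module.forall_dual_apply_eq_zero_iff ℂ y).1 h)
  obtain ⟨φ, hφ⟩ := h1
  obtain ⟨ψ, hψ⟩ := h2
  have h3 := congrArg (TensorProduct.lid ℂ ℂ ∘ TensorProduct.map φ ψ) h
  simp only [Function.comp_apply, TensorProduct.map_tmul, TensorProduct.lid_tmul, map_zero,
    smul_eq_mul] at h3
  exact mul_ne_zero hφ hψ h3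

/-! ### Dual letters and the passage to abstract words -/

section DualLetters

variable {C : Type u₁} [Category.{v₁} C] [Preadditive C] [Linear ℂ C] [MonoidalCategory C]
  [MonoidalPreadditive C] [MonoidalLinear ℂ C] [StarCategory C] [IsRigidCStarTensorCategory C]
variable {D : Type u₂} [Category.{v₂} D] [Preadditive D] [Linear ℂ D] [MonoidalCategory D]
  [MonoidalPreadditive D] [MonoidalLinear ℂ D] [StarCategory D] [IsRigidCStarTensorCategory D]

theorem tmulHom_ne_zero {σ τ : List (C ⊕ D)} {f : tL σ ⟶ tL τ} {g : tR σ ⟶ tR τ} (hf : f ≠ 0)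
    (hg : g ≠ 0) : tmulHom f g ≠ 0 :=
  tmul_ne_zero hf hg

variable {IC : Set C} {ID : Set D}

theorem Reduced.id_ne_zero (hIC : IsNonunitSimpleReps IC) (hID : IsNonunitSimpleReps ID)
    {w : List (C ⊕ D)} (hw : ∀ l ∈ w, Sum.elim (fun c => c ∈ IC) (fun d => d ∈ ID) l) :
    𝟙 w ≠ 0 := by
  refine tmulHom_ne_zero (id_tw_ne_zero fun X hX => ?_) (id_tw_ne_zero fun X hX => ?_)
  · obtain ⟨l, hl, hlX⟩ := List.mem_filterMap.1 hX
    obtain c | d := l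
    · obtain rfl : c = X := by simpa using hlX
      exact (hIC.simple c (hw _ hl)).1
    · simp at hlX
  · obtain ⟨l, hl, hlX⟩ := List.mem_filterMap.1 hX
    obtain c | d := l
    · simp at hlX
    · obtain rfl : d = X := by simpa using hlX
      exact (hID.simple d (hw _ hl)).1

/-- The morphisms from the unit to a two letter word of one colour. -/
theorem DualLetter.iff_left {X Y : C} : DualLetter (.inl X : C ⊕ D) (.inl Y) ↔
    ∃ φ : 𝟙_ C ⟶ X ⊗ Y, φ ≠ 0 := by
  constructor
  · rintro ⟨-, u, hu⟩
    by_contra! h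
    refine hu (eq_zero_of_left (fun f => ?_) u)
    exact conj_eq_zero (Iso.refl _) (whiskerLeftIso X (ρ_ Y).symm) h f
  · rintro ⟨φ, hφ⟩
    have h1 : φ ≫ (whiskerLeftIso X (ρ_ Y).symm).hom ≠ 0 := by
      intro h
      apply hφ
      rw [← cancel_mono (whiskerLeftIso X (ρ_ Y).symm).hom, h, Limits.zero_comp]
    exact ⟨⟨true, by simp⟩, tmulHom (σ := []) (τ := [.inl X, .inl Y]) (φ ≫ (whiskerLeftIso X (ρ_ Y).symm).hom) (𝟙 (𝟙_ D)),
      tmulHom_ne_zero h1 IsRigidCStarTensorCategory.unit_simple.1⟩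

theorem DualLetter.iff_right {X Y : D} : DualLetter (.inr X : C ⊕ D) (.inr Y) ↔
    ∃ φ : 𝟙_ D ⟶ X ⊗ Y, φ ≠ 0 := by
  constructor
  · rintro ⟨-, u, hu⟩
    by_contra! h
    refine hu (eq_zero_of_right (fun f => ?_) u)
    exact conj_eq_zero (Iso.refl _) (whiskerLeftIso X (ρ_ Y).symm) h f
  · rintro ⟨φ, hφ⟩
    have h1 : φ ≫ (whiskerLeftIso X (ρ_ Y).symm).hom ≠ 0 := by
      intro h
      apply hφ
      rw [← cancel_mono (whiskerLeftIso X (ρ_ Y).symm).hom, h, Limits.zero_comp]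
    exact ⟨⟨false, by simp⟩, tmulHom (σ := []) (τ := [.inr X, .inr Y]) (𝟙 (𝟙_ C)) (φ ≫ (whiskerLeftIso X (ρ_ Y).symm).hom),
      tmulHom_ne_zero IsRigidCStarTensorCategory.unit_simple.1 h1⟩

theorem DualLetter.isLeft_eq {l l' : C ⊕ D} (h : DualLetter l l') : l.isLeft = l'.isLeft := by
  obtain ⟨b, hb⟩ := h.1
  rw [hb l (by simp), hb l' (by simp)]

theorem DualLetter.symm (hIC : IsNonunitSimpleReps IC) (hID : IsNonunitSimpleReps ID)
    {l l' : C ⊕ D} (hl : Sum.elim (fun c => c ∈ IC) (fun d => d ∈ ID) l)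
    (hl' : Sum.elim (fun c => c ∈ IC) (fun d => d ∈ ID) l') (h : DualLetter l l') :
    DualLetter l' l := by
  have hc := h.isLeft_eq
  match l, l', hc with
  | .inl X, .inl Y, _ =>
    obtain ⟨φ, hφ⟩ := DualLetter.iff_left.1 h
    exact DualLetter.iff_left.2 ((hIC.simple X hl).exists_hom_swap (hIC.simple Y hl') hφ)
  | .inr X, .inr Y, _ =>
    obtain ⟨φ, hφ⟩ := DualLetter.iff_right.1 h
    exact DualLetter.iff_right.2 ((hID.simple X hl).exists_hom_swap (hID.simple Y hl') hφ)

theorem DualLetter.unique (hIC : IsNonunitSimpleReps IC) (hID : IsNonunitSimpleReps ID)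
    {l l' l'' : C ⊕ D} (hl : Sum.elim (fun c => c ∈ IC) (fun d => d ∈ ID) l)
    (hl' : Sum.elim (fun c => c ∈ IC) (fun d => d ∈ ID) l')
    (hl'' : Sum.elim (fun c => c ∈ IC) (fun d => d ∈ ID) l'') (h : DualLetter l l')
    (h' : DualLetter l l'') : l' = l'' := by
  have hc := h.isLeft_eq
  have hc' := h'.isLeft_eq
  match l, l', l'', hc, hc' with
  | .inl X, .inl Y, .inl Z, _, _ =>
    obtain ⟨φ, hφ⟩ := DualLetter.iff_left.1 h
    obtain ⟨ψ, hψ⟩ := DualLetter.iff_left.1 h'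
    rw [hIC.unique Y hl' Z hl'' ((hIC.simple X hl).iso_of_hom_unit (hIC.simple Y hl')
      (hIC.simple Z hl'') hφ hψ)]
  | .inr X, .inr Y, .inr Z, _, _ =>
    obtain ⟨φ, hφ⟩ := DualLetter.iff_right.1 h
    obtain ⟨ψ, hψ⟩ := DualLetter.iff_right.1 h'
    rw [hID.unique Y hl' Z hl'' ((hID.simple X hl).iso_of_hom_unit (hID.simple Y hl')
      (hID.simple Z hl'') hφ hψ)]

/-- The fusion of reduced words in both orders determines a rotation. -/
theorem rotation_of_fusionRel (hIC : IsNonunitSimpleReps IC) (hID : IsNonunitSimpleReps ID)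
    {z a w₁ w₂ : List (C ⊕ D)} (hz : Reduced IC ID z) (ha : Reduced IC ID a)
    (hw₁ : w₁ ∈ evenWords IC ID) (hw₂ : w₂ ∈ evenWords IC ID) (hA : FusionRel z a w₁)
    (hB : FusionRel z w₂ a) : ∃ u v, w₁ = u ++ v ∧ w₂ = v ++ u := by
  let good : C ⊕ D → Prop := fun l => Sum.elim (fun c => c ∈ IC) (fun d => d ∈ ID) l
  -- Duality of letters is symmetric and single-valued only for the chosen simple representatives,
  -- so the relation is restricted to them.
  let R : C ⊕ D → C ⊕ D → Prop := fun l l' => good l ∧ good l' ∧ DualLetter l l'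
  have conv : ∀ {z x y : List (C ⊕ D)}, (∀ l ∈ x, good l) → (∀ l ∈ y, good l) →
      FusionRel z x y → FuseWith Sum.isLeft R z x y := by
    rintro z x y hx hy ⟨x₁, e, e', y₁, rfl, rfl, h, h'⟩
    refine ⟨x₁, e, e', y₁, rfl, rfl, ?_, ?_⟩
    · rw [List.forall₂_iff_get] at h ⊢
      refine ⟨h.1, fun i h1 h2 => ⟨hx _ ?_, hy _ ?_, h.2 i h1 h2⟩⟩
      · have := List.get_mem e.reverse ⟨i, h1⟩
        simp only [List.mem_reverse] at this
        exact List.mem_append_right _ this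
      · exact List.mem_append_left _ (List.get_mem e' ⟨i, h2⟩)
    · refine h'.imp id ?_
      rintro ⟨x₂, c, c', s, y₂, h1, h2, h3, b, hb⟩
      exact ⟨x₂, c, c', s, y₂, h1, h2, h3, by rw [hb c (by simp), hb s (by simp)],
        by rw [hb c' (by simp), hb s (by simp)]⟩
  have ends : ∀ {w : List (C ⊕ D)}, w ∈ evenWords IC ID →
      firstCol Sum.isLeft w = some true ∧ lastCol Sum.isLeft w = some false := by
    rintro w ⟨-, heven, -, hchain, c, hc⟩
    refine ⟨by simp [firstCol, hc], ?_⟩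
    -- Two letters are removed at a time, which preserves the first colour; the last colour is then
    -- the opposite one.
    have key : ∀ (n : ℕ) (w : List (C ⊕ D)), w.length = 2 * n →
        w.IsChain (fun l l' => l.isLeft ≠ l'.isLeft) → ∀ c, w.head? = some (.inl c) →
        lastCol Sum.isLeft w = some false := by
      intro n
      induction n with
      | zero =>
        intro w hw _ c hc
        rw [List.length_eq_zero_iff.1 hw] at hc
        simp at hc
      | succ n ih =>
        intro w hw hchain c hc
        match w, hw, hchain, hc with
        | [l, l'], _, hchain, hc =>
          obtain rfl : l = .inl c := by simpa using hc
          simp only [List.isChain_cons_cons] at hchain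
          simpa [lastCol] using hchain.1
        | l :: l' :: l'' :: w, hw, hchain, hc =>
          obtain rfl : l = .inl c := by simpa using hc
          simp only [List.isChain_cons_cons] at hchain
          obtain ⟨c', rfl⟩ : ∃ c', l'' = .inl c' := by
            rcases l' with c' | d
            · simp at hchain
            · rcases l'' with c' | d'
              · exact ⟨c', rfl⟩
              · simp at hchain
          have h1 := ih (.inl c' :: w) (by simp at hw ⊢; omega) hchain.2.2 c' rfl
          rw [lastCol_cons, lastCol_cons, h1]
          rfl
    obtain ⟨n, hn⟩ := heven
    exact key n w (by omega) hchain c hc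
  exact rotation_of_fuseWith (R := R) (fun a b h => ⟨h.2.1, h.1, h.2.2.symm hIC hID h.1 h.2.1⟩)
    (fun a b c h h' => h.2.2.unique hIC hID h.1 h.2.1 h'.2.1 h'.2.2) (fun a b h => h.2.2.isLeft_eq)
    hz.2 ha.2 hw₁.2.2.2.1 hw₂.2.2.2.1 (ends hw₁).1 (ends hw₁).2 (ends hw₂).1 (ends hw₂).2
    (conv ha.1 hw₁.2.2.1 hA) (conv hw₂.2.2.1 ha.1 hB)

end DualLetters

/-! ## The annular spaces -/

section Annular

variable {C : Type u₁} [Category.{v₁} C] [Preadditive C] [Linear ℂ C] [MonoidalCategory C]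
  [MonoidalPreadditive C] [MonoidalLinear ℂ C] [StarCategory C] [IsRigidCStarTensorCategory C]
variable {D : Type u₂} [Category.{v₂} D] [Preadditive D] [Linear ℂ D] [MonoidalCategory D]
  [MonoidalPreadditive D] [MonoidalLinear ℂ D] [StarCategory D] [IsRigidCStarTensorCategory D]

namespace WordEnd

/-- The identity morphism of an object of the free product. -/
def one (X : WordEnd C D) : X.word ⟶ X.word := X.proj

theorem ambTensor_eq_wten {σ σ' τ τ' : List (C ⊕ D)} (f : σ ⟶ σ') (g : τ ⟶ τ') :
    (ambTensor σ σ' τ τ' f g : σ ++ τ ⟶ σ' ++ τ') = wten rfl rfl f g := by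
  rw [wten]
  exact ambTensor_eq _ _ _ _ f g

theorem one_tensor (X Y : WordEnd C D) :
    (X.tensor Y).one = wten (rfl : X.word ++ Y.word = _) (rfl : X.word ++ Y.word = _) X.one Y.one :=
  ambTensor_eq_wten X.one Y.one

theorem IsObj.one_comp_one {X : WordEnd C D} (h : X.IsObj) : X.one ≫ X.one = X.one := h.2.1

variable {IC : Set C} {ID : Set D}

theorem mem_hom_iff (hIC : IsNonunitSimpleReps IC) (hID : IsNonunitSimpleReps ID)
    {X Y : WordEnd C D} {f : X.word ⟶ Y.word} :
    f ∈ hom X Y ↔ ∃ g : X.word ⟶ Y.word, Planar g ∧ f = X.one ≫ g ≫ Y.one := by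
  constructor
  · rintro ⟨g, hg, rfl⟩
    exact ⟨g, planar_of_mem_ncpHom hg, Category.assoc X.one (g : X.word ⟶ Y.word) Y.one⟩
  · rintro ⟨g, hg, rfl⟩
    exact ⟨g, (mem_ncpHom_iff hIC hID).2 hg, Category.assoc X.one g Y.one⟩

theorem mem_hom_tensor_iff (hIC : IsNonunitSimpleReps IC) (hID : IsNonunitSimpleReps ID)
    {X : WordEnd C D} {w₁ w₂ : List (C ⊕ D)} {m : X.word ++ w₁ ⟶ w₂ ++ X.word} :
    m ∈ hom (X.tensor (ofWord w₁)) ((ofWord w₂).tensor X) ↔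
      ∃ g : X.word ++ w₁ ⟶ w₂ ++ X.word, Planar g ∧
        m = wten rfl rfl X.one (𝟙 w₁) ≫ g ≫ wten rfl rfl (𝟙 w₂) X.one := by
  have h := mem_hom_iff hIC hID (X := X.tensor (ofWord w₁)) (Y := (ofWord w₂).tensor X) (f := m)
  rw [one_tensor, one_tensor] at h
  exact h

theorem isObj_ofWord (hIC : IsNonunitSimpleReps IC) (hID : IsNonunitSimpleReps ID)
    (w : List (C ⊕ D)) : (ofWord w).IsObj :=
  ⟨(mem_ncpHom_iff hIC hID).2 (.id w), Category.comp_id (𝟙 w), wdag_id w⟩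

theorem isSimple_ofWord (hIC : IsNonunitSimpleReps IC) (hID : IsNonunitSimpleReps ID)
    {w : List (C ⊕ D)} (hw : Reduced IC ID w) : (ofWord w).IsSimple := by
  refine ⟨Reduced.id_ne_zero hIC hID hw.1, fun f hf => ?_⟩
  obtain ⟨g, hg, rfl⟩ := (mem_hom_iff hIC hID).1 hf
  have key : ∀ g : w ⟶ w, Planar g → ∃ c : ℂ, 𝟙 w ≫ g ≫ 𝟙 w = c • 𝟙 w := by
    intro g hg
    rw [Category.id_comp, Category.comp_id]
    rcases (hg.fan hIC hID hw).schur hIC hID hw hw with ⟨e, c, h⟩ | h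
    · exact ⟨c, by rw [h, eqToHom_refl]⟩
    · exact ⟨0, by rw [h, zero_smul]⟩
  exact key g hg

/-- The identity of a simple object factors through a reduced word. -/
theorem IsSimple.exists_factor (hIC : IsNonunitSimpleReps IC) (hID : IsNonunitSimpleReps ID)
    {X : WordEnd C D} (hX : X.IsObj) (hs : X.IsSimple) :
    ∃ (w : List (C ⊕ D)) (a : X.word ⟶ w) (b : w ⟶ X.word), Reduced IC ID w ∧ Planar a ∧
      Planar b ∧ a ≫ b = X.one := by
  have h1 : Planar X.one := planar_of_mem_ncpHom hX.1
  have h0 : X.one ≫ 𝟙 _ ≫ X.one ≠ 0 := by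
    rw [Category.id_comp, hX.one_comp_one]
    exact hs.1
  obtain ⟨w, a, b, hw, ha, hb, hab⟩ := (Thru.id hIC hID X.word).exists_ne_zero h0
  -- Simplicity makes the surviving summand a nonzero multiple of the identity; rescaling it gives
  -- the factorisation.
  obtain ⟨c, hc⟩ := hs.2 _ ((mem_hom_iff hIC hID).2 ⟨a ≫ b, ha.comp hb, rfl⟩)
  have hc' : X.one ≫ (a ≫ b) ≫ X.one = c • X.one := hc
  have hc0 : c ≠ 0 := fun h => hab (by rw [hc', h, zero_smul])
  refine ⟨w, c⁻¹ • (X.one ≫ a), b ≫ X.one, hw, .smul _ _ (h1.comp ha), hb.comp h1, ?_⟩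
  have e : (X.one ≫ a) ≫ b ≫ X.one = X.one ≫ (a ≫ b) ≫ X.one := by simp only [Category.assoc]
  rw [Linear.smul_comp, e, hc', smul_smul, inv_mul_cancel₀ hc0, one_smul]

end WordEnd

theorem Planar.wten {ρ ρ' σ σ' τ τ' : List (C ⊕ D)} (h : ρ = σ ++ τ) (h' : ρ' = σ' ++ τ')
    {f : σ ⟶ σ'} {g : τ ⟶ τ'} (hf : Planar f) (hg : Planar g) :
    Planar (AnnularFreeProduct.wten h h' f g) :=
  (hf.whisker _ _).comp (hg.whisker _ _)

variable {IC : Set C} {ID : Set D}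

theorem reduced_of_mem_evenWords {w : List (C ⊕ D)} (hw : w ∈ evenWords IC ID) :
    Reduced IC ID w :=
  ⟨hw.2.2.1, hw.2.2.2.1⟩

/-- The simple object is replaced by the reduced word through which its identity factors. A reduced
word `z` with nonzero morphisms to both sides then satisfies both fusion relations. -/
theorem rotation_of_ne_zero (hIC : IsNonunitSimpleReps IC) (hID : IsNonunitSimpleReps ID)
    {w₁ w₂ : List (C ⊕ D)} (hw₁ : w₁ ∈ evenWords IC ID) (hw₂ : w₂ ∈ evenWords IC ID)
    {X : WordEnd C D} (hX : X.IsObj) (hs : X.IsSimple)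
    {m : X.word ++ w₁ ⟶ w₂ ++ X.word}
    (hm : m ∈ WordEnd.hom (X.tensor (.ofWord w₁)) ((WordEnd.ofWord w₂).tensor X)) (h0 : m ≠ 0) :
    ∃ u v, w₁ = u ++ v ∧ w₂ = v ++ u := by
  obtain ⟨r, a, b, hr, ha, hb, hab⟩ := hs.exists_factor hIC hID hX
  obtain ⟨g, hg, hmg⟩ := (WordEnd.mem_hom_tensor_iff hIC hID).1 hm
  rw [← hab] at hmg
  have e₁ : wten (rfl : X.word ++ w₁ = X.word ++ w₁) (rfl : X.word ++ w₁ = X.word ++ w₁) (a ≫ b)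
      (𝟙 w₁) = wten rfl (rfl : r ++ w₁ = _) a (𝟙 w₁) ≫ wten rfl rfl b (𝟙 w₁) := by
    rw [wten_comp, Category.comp_id]
  have e₂ : wten (rfl : w₂ ++ X.word = w₂ ++ X.word) (rfl : w₂ ++ X.word = w₂ ++ X.word) (𝟙 w₂)
      (a ≫ b) = wten rfl (rfl : w₂ ++ r = _) (𝟙 w₂) a ≫ wten rfl rfl (𝟙 w₂) b := by
    rw [wten_comp, Category.comp_id]
  -- The given morphism `m` is recovered from `n` by composing with `a` and `b`, so `n` cannot
  -- vanish.
  obtain ⟨n, hn⟩ : ∃ n : r ++ w₁ ⟶ w₂ ++ r, n = wten rfl rfl b (𝟙 w₁) ≫ g ≫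
    wten rfl rfl (𝟙 w₂) a := ⟨_, rfl⟩
  have hnP : Planar n := by
    rw [hn]
    exact (hb.wten rfl rfl (.id _)).comp (hg.comp (Planar.wten rfl rfl (.id _) ha))
  have hn0 : n ≠ 0 := by
    intro h
    apply h0
    have e : m = wten rfl (rfl : r ++ w₁ = _) a (𝟙 w₁) ≫ n ≫
        wten (rfl : w₂ ++ r = _) rfl (𝟙 w₂) b := by
      rw [hn, hmg, e₁, e₂]
      simp only [Category.assoc]
    rw [e, h, Limits.zero_comp, Limits.comp_zero]
  -- One summand of the identity of `r w₁` survives composition with `n`; its second half shows that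
  -- `z` occurs in `r w₁` and, followed by `n`, in `w₂ r`.
  obtain ⟨z, p, q, hz, hp, hq, hpq⟩ := (Thru.id hIC hID (r ++ w₁)).exists_ne_zero
    (p := 𝟙 _) (q := n) (by simpa using hn0)
  have hq0 : q ≠ 0 := fun h => hpq (by simp [h])
  have hqn0 : q ≫ n ≠ 0 := fun h => hpq (by simp [h])
  exact rotation_of_fusionRel hIC hID hz hr hw₁ hw₂
    ((hq.fan hIC hID hz).fusion hIC hID hq0 rfl hz hr (reduced_of_mem_evenWords hw₁))
    (((hq.comp hnP).fan hIC hID hz).fusion hIC hID hqn0 rfl hz (reduced_of_mem_evenWords hw₂) hr)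

/-- The word `v` is reduced, hence simple, and is represented by some `X` in `Irr`. Conjugating the
identity of `v u v` by an isomorphism `v ≅ X`, on the left `v` at the source and on the right `v` at
the target, gives a morphism that can be undone. -/
theorem exists_ne_zero_of_rotation (hIC : IsNonunitSimpleReps IC) (hID : IsNonunitSimpleReps ID)
    {Irr : Set (WordEnd C D)} (hIrr : IsSimpleReps Irr) {u v : List (C ⊕ D)}
    (h : Reduced IC ID (u ++ v)) :
    ∃ X ∈ Irr, ∃ m ∈ WordEnd.hom (X.tensor (.ofWord (u ++ v))) ((WordEnd.ofWord (v ++ u)).tensor X),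
      m ≠ 0 := by
  have hv : Reduced IC ID v :=
    ⟨fun l hl => h.1 l (List.mem_append_right u hl), h.2.right_of_append⟩
  obtain ⟨X, hX, f, hf, g, hg, hfg, -⟩ := hIrr.complete _ (WordEnd.isObj_ofWord hIC hID v)
    (WordEnd.isSimple_ofWord hIC hID hv)
  have hf' : ∃ f' : v ⟶ X.word, Planar f' ∧ f = 𝟙 v ≫ f' ≫ X.one :=
    (WordEnd.mem_hom_iff hIC hID).1 hf
  have hg' : ∃ g' : X.word ⟶ v, Planar g' ∧ g = X.one ≫ g' ≫ 𝟙 v :=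
    (WordEnd.mem_hom_iff hIC hID).1 hg
  obtain ⟨f', hf', hff⟩ := hf'
  obtain ⟨g', hg', hgg⟩ := hg'
  rw [Category.id_comp] at hff
  rw [Category.comp_id] at hgg
  have hvv : (f' ≫ X.one) ≫ X.one ≫ g' = 𝟙 v := by
    rw [← hff, ← hgg]
    exact hfg
  have eA : v ++ (u ++ v) = (v ++ u) ++ v := (List.append_assoc v u v).symm
  have hP : Planar (wten rfl rfl g' (𝟙 (u ++ v)) ≫ wten eA rfl (𝟙 (v ++ u)) f') :=
    (hg'.wten rfl rfl (.id _)).comp (Planar.wten eA rfl (.id _) hf')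
  refine ⟨X, hX, _, (WordEnd.mem_hom_tensor_iff hIC hID).2 ⟨_, hP, rfl⟩, fun h0 => ?_⟩
  have hid : (𝟙 (v ++ (u ++ v)) : v ++ (u ++ v) ⟶ v ++ (u ++ v)) ≠ 0 :=
    Reduced.id_ne_zero hIC hID fun l hl => by
      rcases List.mem_append.1 hl with hl | hl
      · exact hv.1 l hl
      · exact h.1 l hl
  apply hid
  -- Composing with the isomorphism and its inverse on the outer factors recovers the identity, so a
  -- vanishing morphism would make the word `v u v` zero.
  have e : wten rfl rfl (f' ≫ X.one) (𝟙 (u ++ v)) ≫ (wten rfl rfl X.one (𝟙 (u ++ v)) ≫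
      (wten rfl rfl g' (𝟙 (u ++ v)) ≫ wten eA rfl (𝟙 (v ++ u)) f') ≫
      wten rfl rfl (𝟙 (v ++ u)) X.one) ≫ wten rfl eA (𝟙 (v ++ u)) (X.one ≫ g') =
      𝟙 (v ++ (u ++ v)) := by
    have e₁ : wten rfl rfl (f' ≫ X.one) (𝟙 (u ++ v)) ≫ wten rfl rfl X.one (𝟙 (u ++ v)) ≫
        wten rfl rfl g' (𝟙 (u ++ v)) = 𝟙 (v ++ (u ++ v)) := by
      rw [wten_comp, wten_comp, hvv, Category.comp_id, Category.comp_id, wten_id]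
    have e₂ : wten eA rfl (𝟙 (v ++ u)) f' ≫ wten rfl rfl (𝟙 (v ++ u)) X.one ≫
        wten rfl eA (𝟙 (v ++ u)) (X.one ≫ g') = 𝟙 (v ++ (u ++ v)) := by
      rw [wten_comp, wten_comp, ← Category.assoc f', hvv, Category.comp_id, Category.comp_id,
        wten_id]
    simp only [Category.assoc] at e₁ e₂ ⊢
    rw [e₂, Category.comp_id, e₁]
  have h0' : wten rfl rfl X.one (𝟙 (u ++ v)) ≫
      (wten rfl rfl g' (𝟙 (u ++ v)) ≫ wten eA rfl (𝟙 (v ++ u)) f') ≫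
      wten rfl rfl (𝟙 (v ++ u)) X.one = 0 := h0
  rw [← e, h0', Limits.zero_comp, Limits.comp_zero]

end Annular

end

end AnnularFreeProduct

theorem mainTheorem9
    {C : Type u₁} [Category.{v₁} C] [Preadditive C] [Linear ℂ C] [MonoidalCategory C]
    [MonoidalPreadditive C] [MonoidalLinear ℂ C] [StarCategory C] [IsRigidCStarTensorCategory C]
    {D : Type u₂} [Category.{v₂} D] [Preadditive D] [Linear ℂ D] [MonoidalCategory D]
    [MonoidalPreadditive D] [MonoidalLinear ℂ D] [StarCategory D] [IsRigidCStarTensorCategory D]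
    (IC : Set C) (hIC : IsNonunitSimpleReps IC)
    (ID : Set D) (hID : IsNonunitSimpleReps ID)
    (Irr : Set (WordEnd C D)) (hIrr : IsSimpleReps Irr)
    (w₁ w₂ : List (C ⊕ D)) (hw₁ : w₁ ∈ evenWords IC ID) (hw₂ : w₂ ∈ evenWords IC ID) :
    Nontrivial (AnnularSpace Irr (WordEnd.ofWord w₁) (WordEnd.ofWord w₂)) ↔
      ∃ u v : List (C ⊕ D), w₁ = u ++ v ∧ w₂ = v ++ u := by
  constructor
  · intro _
    obtain ⟨x, hx⟩ := exists_ne (0 : AnnularSpace Irr (WordEnd.ofWord w₁) (WordEnd.ofWord w₂))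
    obtain ⟨X, hX⟩ := DFinsupp.ne_iff.1 hx
    exact rotation_of_ne_zero hIC hID hw₁ hw₂ (hIrr.isObj X X.2) (hIrr.simple X X.2) (x X).2
      fun h => hX (Subtype.ext h)
  · rintro ⟨u, v, rfl, rfl⟩
    obtain ⟨X, hX, m, hm, h0⟩ :=
      exists_ne_zero_of_rotation hIC hID hIrr (reduced_of_mem_evenWords hw₁)
    classical
    refine nontrivial_of_ne (DirectSum.of (fun a : Irr => WordEnd.hom
      (a.1.tensor (WordEnd.ofWord (u ++ v))) ((WordEnd.ofWord (v ++ u)).tensor a.1)) ⟨X, hX⟩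
      ⟨m, hm⟩) 0 fun h => h0 ?_
    have h' := DirectSum.of_injective _ (h.trans (map_zero _).symm)
    exact congrArg Subtype.val h'
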